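/- Let $m\ge 1$ and $n\ge 2$, let $F_n$ be the free group on $x_1,\dots,x_n$ and let $G=\mathbb{Z}^m\times F_n$. Write automorphisms on the right of their arguments, so that in an automorphism group the product $\alpha\beta$ means "first $\alpha$, then $\beta$". For $\phi\in\operatorname{Aut}(F_n)$ let $M_\phi\in\operatorname{GL}_n(\mathbb{Z})$ be the matrix of the abelianization of $\phi$, that is, the matrix whose $(i,j)$ entry is the total exponent of $x_j$ in $x_i\phi$. Let $\mathcal{M}_{n\times m}(\mathbb{Z})$ be the additive group of integral $n\times m$ matrices. Then $\operatorname{Aut}(G)$ is isomorphic to the semidirect product $$\mathcal{M}_{n\times m}(\mathbb{Z})\rtimes\bigl(\operatorname{Aut}(F_n)\times \operatorname{GL}_m(\mathbb{Z})\bigr)$$ with respect to the natural action, in which conjugation is given by $$(\phi,Q)^{-1}\,P\,(\phi,Q)=M_\phi^{-1}PQ,\qquad\text{equivalently}\qquad (\phi,Q)\,P\,(\phi,Q)^{-1}=M_\phi PQ^{-1},$$ for $\phi\in\operatorname{Aut}(F_n)$, $Q\in\operatorname{GL}_m(\mathbb{Z})$ and $P\in\mathcal{M}_{n\times m}(\mathbb{Z})$.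 In particular, $\operatorname{Aut}(G)$ is finitely presented. -/

import Mathlib

open scoped MatrixGroups

/-- The group `Aut(G)` with automorphisms acting on the right of their arguments: the product
`α * β` means "first `α`, then `β`". Mathlib's `MulAut G` has the composition of maps acting on the
left as its product, so this is its opposite group. -/
abbrev RightAut (G : Type*) [Group G] : Type _ := (MulAut G)ᵐᵒᵖ

/-- The value `xα` of an automorphism acting on the right. -/
def RightAut.app {G : Type*} [Group G] (x : G) (α : RightAut G) : G := α.unop x

/-- The group `ℤ^m × F_n`, with the free-abelian factor written multiplicatively. -/
abbrev FreeAbelianTimesFree (m n : ℕ) : Type :=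
  Multiplicative (Fin m → ℤ) × FreeGroup (Fin n)

/-- The abelianization map `F_n → ℤ^n`, sending the `i`-th free generator to the `i`-th canonical
vector; the `j`-th coordinate of the image of `u` is the total exponent of `x_j` in `u`. -/
def freeGroupAb (n : ℕ) : FreeGroup (Fin n) →* Multiplicative (Fin n → ℤ) :=
  FreeGroup.lift fun i => Multiplicative.ofAdd (Pi.single i 1)

/-- The matrix of the abelianization of an automorphism of `F_n`: its `i`-th row is the
abelianization of the image of the `i`-th free generator (row vectors, matrices acting on the
right). -/
def abMatrix {n : ℕ} (φ : RightAut (FreeGroup (Fin n))) : Matrix (Fin n) (Fin n) ℤ :=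
  Matrix.of fun i => (freeGroupAb n (RightAut.app (FreeGroup.of i) φ)).toAdd

/-- The matrix `M` of `φ` is that of the map which `φ` induces on `ℤ^n`:
`(uφ)^ab = u^ab M`. -/
theorem freeGroupAb_app {n : ℕ} (φ : RightAut (FreeGroup (Fin n))) (u : FreeGroup (Fin n)) :
    (freeGroupAb n (RightAut.app u φ)).toAdd
      = Matrix.vecMul (freeGroupAb n u).toAdd (abMatrix φ) := by
  have h : (freeGroupAb n).comp (φ.unop.toMonoidHom) =
      (AddMonoidHom.toMultiplicative
        (Matrix.vecMulLinear (abMatrix φ)).toAddMonoidHom).comp (freeGroupAb n) := by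
    ext1 i
    apply Multiplicative.toAdd.injective
    simp [freeGroupAb, abMatrix, RightAut.app, Matrix.row]
    rfl
  exact congrArg Multiplicative.toAdd (DFunLike.congr_fun h u)

/-- The abelianization homomorphism `Aut(F_n) → GL_n(ℤ)`. -/
def abGL (n : ℕ) : RightAut (FreeGroup (Fin n)) →* GL (Fin n) ℤ :=
  MonoidHom.toHomUnits
    { toFun := abMatrix
      map_one' := by
        ext i j
        simp [abMatrix, RightAut.app, freeGroupAb, Matrix.one_apply, Pi.single_apply, eq_comm]
      map_mul' := by
        intro φ ψ
        funext i
        exact freeGroupAb_app ψ (RightAut.app (FreeGroup.of i) φ) }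

/-- The natural action of `Aut(F_n) × GL_m(ℤ)` on the additive group of integral `n × m` matrices
by group automorphisms: `(φ, Q)` sends `P` to `M P Q⁻¹`, where `M` is the abelianization of `φ`.
As `SemidirectProduct` uses left actions, this is the conjugation `g P g⁻¹`; the corresponding right
action is `g⁻¹ P g = M⁻¹ P Q`. -/
def matrixAction (m n : ℕ) :
    RightAut (FreeGroup (Fin n)) × GL (Fin m) ℤ →*
      MulAut (Multiplicative (Matrix (Fin n) (Fin m) ℤ)) where
  toFun g := AddEquiv.toMultiplicative
    { toFun := fun P => (abGL n g.1).val * P * (g.2⁻¹).val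
      invFun := fun P => ((abGL n g.1)⁻¹).val * P * g.2.val
      left_inv := fun P => by
        beta_reduce
        rw [← Matrix.mul_assoc, ← Matrix.mul_assoc, Units.inv_mul, Matrix.one_mul,
          Matrix.mul_assoc, Units.inv_mul, Matrix.mul_one]
      right_inv := fun P => by
        beta_reduce
        rw [← Matrix.mul_assoc, ← Matrix.mul_assoc, Units.mul_inv, Matrix.one_mul,
          Matrix.mul_assoc, Units.mul_inv, Matrix.mul_one]
      map_add' := fun P P' => by rw [Matrix.mul_add, Matrix.add_mul] }
  map_one' := by
    ext1 P
    apply Multiplicative.toAdd.injective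
    simp
  map_mul' := by
    intro g h
    ext1 P
    apply Multiplicative.toAdd.injective
    simp [Matrix.mul_assoc]

/-!
Write `G = ℤ^m × F_n`. For `n ≥ 2` the free group has trivial center, so that `ℤ^m` is the center of
`G` and every automorphism preserves it. Hence an automorphism acts on `ℤ^m` by a matrix `Q`, induces
an automorphism `φ` on the quotient `F_n`, and sends `u ∈ F_n` to `uφ` times an element of `ℤ^m`
depending on the abelianization of `u` only. It has thus the form `(a, u) ↦ (a Q + u^ab P Q, u φ)`
for unique `P`, `φ` and `Q`; with this placing of `Q` in the second summand, composition is the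
multiplication of the semidirect product (`FreeAbelianTimesFree.toRightAut`).

Finite presentability passes to extensions (`Group.IsFinitelyPresented.of_extension`), so it remains
to treat `GL_m(ℤ)` and `Aut(F_n)`. Both follow from one criterion,
`Group.IsFinitelyPresented.of_peak_reduction`. Let a group act on a set with a level function `L`
which takes its minimum on the orbit of `x₀` at `x₀`, at finitely many points of the orbit, and let the
stabilizer of `x₀` be finitely presented. Let `S` be a finite generating set. A path in the orbit with
steps in `S` has a peak at `x` if the steps of the path there lead from `x` backwards to a lower point
and forwards to a point that is not higher. If the corner at every peak can be replaced by a path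
below the level of `x` which stays in `B • x` for a fixed finite set `B`, then the products `s b` with
`s ∈ S` and `b ∈ B` give finitely many relations by which every path from `x₀` to `x₀` can be pushed
down to the minimal level; there it is accounted for by the stabilizer and finitely many further
relations.

For `GL_n(ℤ)`, the criterion is applied to the action on `ℤ^n`, with the `ℓ¹`-norm as level, the first
basis vector as `x₀`, and the elementary matrices and signed permutations as generators. The stabilizer
of `x₀` is an extension of `GL_{n-1}(ℤ)` by `ℤ^{n-1}`, so induction applies. Peaks are reduced by
inspecting the mutual position of two elementary matrices (`IntVector.linked_elem`).

For `Aut(F_n)`, it is applied to the action on `n`-tuples, with the total length as level, the free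
basis as `x₀`, which has trivial stabilizer, and the Whitehead automorphisms and the permutations of the
letters as generators. The change of length under the Whitehead automorphism with set `A` and letter
`a` is the number of edges of the Whitehead graph crossing the cut `A`, minus the number of occurrences
of `a` and `a⁻¹` (`Whitehead.len_wh`). As cuts are submodular, for a peak formed by `(A, a)` and
`(B, b)` one of the corners `A ∩ B`, `A ∪ B`, `A \ B` and `B \ A` gives a Whitehead automorphism
reducing the length (`Whitehead.exists_corner`); its set is nested with `A` and with `B`, and for nested
sets there are explicit relations which reduce the peak (`Whitehead.linked_of_nested`). That these
automorphisms generate is Nielsen's theorem (`Whitehead.closure_gens`): Nielsen transformations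
decrease the lengths of the images of the letters and, in case of ties, the ranks of their left halves,
until the images are Nielsen reduced; then they are letters, since an automorphism whose values are
Nielsen reduced does not shorten any word.
-/

set_option linter.unusedSectionVars false
set_option linter.unusedSimpArgs false

/-! ### Finite presentability: extensions and peak reduction -/

namespace Group.IsFinitelyPresented

open Monoid

/-- A quotient of a finitely presented group is finitely presented if finitely many relators, imposed on
the group, make every element of the kernel trivial. -/
theorem of_ker_le_normalClosure {P G : Type*} [Group P] [Group G] [IsFinitelyPresented P]
    (π : P →* G) (hπ : Function.Surjective π) (R : Set P) (hR : R.Finite)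
    (hRπ : ∀ r ∈ R, π r = 1) (h : ∀ p, π p = 1 → (QuotientGroup.mk p : P ⧸ Subgroup.normalClosure R) = 1) :
    IsFinitelyPresented G := by
  refine of_surjective π hπ ⟨R, hR, le_antisymm ?_ ?_⟩
  · exact Subgroup.normalClosure_le_normal fun r hr => hRπ r hr
  · intro p hp
    exact (QuotientGroup.eq_one_iff p).1 (h p hp)

/-- An extension of a finitely presented group by a finitely presented group is finitely
presented. -/
theorem of_extension {G Q : Type*} [Group G] [Group Q] (f : G →* Q) (hf : Function.Surjective f)
    [IsFinitelyPresented f.ker] [hQ : IsFinitelyPresented Q] : IsFinitelyPresented G := by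
  -- `G` is a quotient of the free product of the kernel and the free group on lifts of the generators of
  -- `Q`, which is finitely presented
  obtain ⟨n, φ, hφ, RQ, hRQ, hRker⟩ := hQ.out
  obtain ⟨k, ψ, hψ, -⟩ := ‹IsFinitelyPresented f.ker›.out
  choose sec hsec using hf
  let σ : FreeGroup (Fin n) →* G := FreeGroup.lift fun i => sec (φ (FreeGroup.of i))
  have hσ : ∀ w, f (σ w) = φ w := by
    have : f.comp σ = φ := by ext i; simp [σ, hsec]
    exact fun w => DFunLike.congr_fun this w
  let K := f.ker
  let π : Coprod K (FreeGroup (Fin n)) →* G := Coprod.lift K.subtype σ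
  have hπl : ∀ a : K, π (Coprod.inl a) = a := fun a => by simp [π]
  have hπr : ∀ w, π (Coprod.inr w) = σ w := fun w => by simp [π]
  have hfπ : ∀ w : FreeGroup (Fin n), w ∈ Subgroup.normalClosure RQ → σ w ∈ K := by
    intro w hw
    rw [hRker] at hw
    show f (σ w) = 1
    rw [hσ]; exact hw
  let conjK (g : G) (a : K) : K := ⟨g * a * g⁻¹, (MonoidHom.normal_ker f).conj_mem a a.2 g⟩
  let i : Fin k → Coprod K (FreeGroup (Fin n)) := fun y => Coprod.inl (ψ (FreeGroup.of y))
  let e : Fin n → Coprod K (FreeGroup (Fin n)) := fun s => Coprod.inr (FreeGroup.of s)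
  -- the relators of `Q` are expressed in the kernel
  let R1 : Set (Coprod K (FreeGroup (Fin n))) :=
    Set.range fun w : RQ => Coprod.inr w.1 *
      (Coprod.inl (⟨σ w.1, hfπ _ (Subgroup.subset_normalClosure w.2)⟩ : K))⁻¹
  -- so are the conjugates of the generators of the kernel by the lifts and by their inverses
  let R2 : Set (Coprod K (FreeGroup (Fin n))) :=
    Set.range fun q : Fin n × Fin k => e q.1 * i q.2 * (e q.1)⁻¹ *
      (Coprod.inl (conjK (σ (FreeGroup.of q.1)) (ψ (FreeGroup.of q.2))))⁻¹
  let R3 : Set (Coprod K (FreeGroup (Fin n))) :=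
    Set.range fun q : Fin n × Fin k => (e q.1)⁻¹ * i q.2 * e q.1 *
      (Coprod.inl (conjK (σ (FreeGroup.of q.1))⁻¹ (ψ (FreeGroup.of q.2))))⁻¹
  have hfin : (R1 ∪ R2 ∪ R3).Finite := by
    have := hRQ.to_subtype
    exact ((Set.finite_range _).union (Set.finite_range _)).union (Set.finite_range _)
  refine of_ker_le_normalClosure π ?_ (R1 ∪ R2 ∪ R3) hfin ?_ ?_
  · intro g
    obtain ⟨w, hw⟩ := hφ (f g)
    have hk : g * (σ w)⁻¹ ∈ K := by
      show f _ = 1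
      rw [map_mul, map_inv, hσ, hw, mul_inv_cancel]
    refine ⟨Coprod.inl ⟨g * (σ w)⁻¹, hk⟩ * Coprod.inr w, ?_⟩
    rw [map_mul, hπl, hπr]; simp
  · rintro r ((⟨w, rfl⟩ | ⟨q, rfl⟩) | ⟨q, rfl⟩)
    · simp [hπl, hπr]
    · simp [hπl, hπr, e, i, conjK]
    · simp [hπl, hπr, e, i, conjK]
  -- modulo these relators, the image of the kernel is normal, so that every element is a product of one
  -- from the kernel and one from the free group
  set N := Subgroup.normalClosure (R1 ∪ R2 ∪ R3) with hN
  let m : Coprod K (FreeGroup (Fin n)) →* Coprod K (FreeGroup (Fin n)) ⧸ N := QuotientGroup.mk' N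
  let j : K →* Coprod K (FreeGroup (Fin n)) ⧸ N := m.comp Coprod.inl
  let u : FreeGroup (Fin n) →* Coprod K (FreeGroup (Fin n)) ⧸ N := m.comp Coprod.inr
  have hrel : ∀ a b, a * b⁻¹ ∈ R1 ∪ R2 ∪ R3 → m a = m b := by
    intro a b hab
    rw [← mul_inv_eq_one, ← map_inv, ← map_mul]
    exact (QuotientGroup.eq_one_iff _).2 (Subgroup.subset_normalClosure hab)
  have hgenK : ∀ (T : Subgroup K), (∀ y, ψ (FreeGroup.of y) ∈ T) → ∀ a, a ∈ T := by
    intro T hT a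
    obtain ⟨w, rfl⟩ := hψ a
    induction w using FreeGroup.induction_on with
    | C1 => rw [map_one]; exact T.one_mem
    | of y => exact hT y
    | inv_of y _ => rw [map_inv]; exact T.inv_mem (hT y)
    | mul a b ha hb => rw [map_mul]; exact T.mul_mem ha hb
  have hc1 : ∀ s a, u (FreeGroup.of s) * j a * (u (FreeGroup.of s))⁻¹ ∈ j.range := by
    intro s
    refine hgenK ((j.range.comap (MulAut.conj (u (FreeGroup.of s))).toMonoidHom).comap j) ?_
    intro y
    refine ⟨conjK (σ (FreeGroup.of s)) (ψ (FreeGroup.of y)), ?_⟩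
    have := hrel (e s * i y * (e s)⁻¹) _ (Or.inl (Or.inr ⟨(s, y), rfl⟩))
    simpa [e, i, j, u] using this.symm
  have hc2 : ∀ s a, (u (FreeGroup.of s))⁻¹ * j a * (u (FreeGroup.of s)) ∈ j.range := by
    intro s
    refine hgenK ((j.range.comap (MulAut.conj (u (FreeGroup.of s))⁻¹).toMonoidHom).comap j) ?_
    intro y
    refine ⟨conjK (σ (FreeGroup.of s))⁻¹ (ψ (FreeGroup.of y)), ?_⟩
    have := hrel ((e s)⁻¹ * i y * (e s)) _ (Or.inr ⟨(s, y), rfl⟩)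
    simpa [e, i, j, u] using this.symm
  have hcw : ∀ w a, u w * j a * (u w)⁻¹ ∈ j.range := by
    intro w
    induction w using FreeGroup.induction_on with
    | C1 => intro a; simp
    | of s => exact hc1 s
    | inv_of s _ => intro a; rw [map_inv, inv_inv]; exact hc2 s a
    | mul v w hv hw =>
      intro a
      obtain ⟨b, hb⟩ := hw a
      have := hv b
      rw [hb] at this
      simpa only [map_mul, mul_inv_rev, mul_assoc] using this
  have hnormal : j.range.Normal := by
    refine ⟨?_⟩
    rintro _ ⟨a, rfl⟩ g
    obtain ⟨g, rfl⟩ := QuotientGroup.mk'_surjective N g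
    induction g using Coprod.induction_on' generalizing a with
    | one => simp
    | inl_mul b x hx =>
      obtain ⟨c, hc⟩ := hx a
      refine ⟨b * c * b⁻¹, ?_⟩
      rw [map_mul, map_mul, hc, map_mul, map_inv]
      simp only [j, m, MonoidHom.comp_apply, mul_assoc, mul_inv_rev]
    | inr_mul w x hx =>
      obtain ⟨c, hc⟩ := hx a
      have := hcw w c
      rw [hc] at this
      simpa only [u, m, MonoidHom.comp_apply, map_mul, mul_assoc, mul_inv_rev] using this
  have hu : ∀ w, φ w = 1 → u w ∈ j.range := by
    intro w hw
    have h1 : Subgroup.normalClosure RQ ≤ j.range.comap u := by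
      refine Subgroup.normalClosure_le_normal fun r hr => ?_
      refine ⟨⟨σ r, hfπ _ (Subgroup.subset_normalClosure hr)⟩, ?_⟩
      exact (hrel (Coprod.inr r) _ (Or.inl (Or.inl ⟨⟨r, hr⟩, rfl⟩))).symm
    rw [hRker] at h1
    exact h1 hw
  have hdec : ∀ p : Coprod K (FreeGroup (Fin n)), ∃ a w, m p = j a * u w ∧ f (π p) = φ w := by
    intro p
    induction p using Coprod.induction_on' with
    | one => exact ⟨1, 1, by simp, by simp⟩
    | inl_mul b x hx =>
      obtain ⟨a, w, h1, h2⟩ := hx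
      refine ⟨b * a, w, ?_, ?_⟩
      · rw [map_mul, h1]; simp [j, mul_assoc]
      · rw [map_mul, map_mul, hπl, h2, show f b = 1 from b.2, one_mul]
    | inr_mul v x hx =>
      obtain ⟨a, w, h1, h2⟩ := hx
      obtain ⟨c, hc⟩ := hcw v a
      refine ⟨c, v * w, ?_, ?_⟩
      · rw [map_mul, h1, hc, map_mul]; simp [u, mul_assoc]
      · rw [map_mul, map_mul, hπr, h2, hσ, map_mul]
  intro p hp
  obtain ⟨a, w, h1, h2⟩ := hdec p
  rw [hp, map_one] at h2
  obtain ⟨b, hb⟩ := hu w h2.symm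
  have hπm : ∀ q q', m q = m q' → π q = π q' := by
    intro q q' h
    have h3 : q⁻¹ * q' ∈ N := QuotientGroup.eq.1 h
    have h4 : N ≤ π.ker := by
      refine Subgroup.normalClosure_le_normal ?_
      rintro r ((⟨w, rfl⟩ | ⟨q, rfl⟩) | ⟨q, rfl⟩)
      · simp [hπl, hπr]
      · simp [hπl, hπr, e, i, conjK]
      · simp [hπl, hπr, e, i, conjK]
    have h5 : π (q⁻¹ * q') = 1 := h4 h3
    rw [map_mul, map_inv] at h5
    exact (inv_mul_eq_one.1 h5)
  have h6 : m p = m (Coprod.inl (a * b)) := by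
    rw [h1, ← hb, ← map_mul]; rfl
  have h7 := hπm _ _ h6
  rw [hp, hπl] at h7
  have h8 : a * b = 1 := Subtype.ext h7.symm
  show m p = 1
  rw [h6, h8, map_one, map_one]

/-- The elements of `P` that are products of generators all of whose partial products move the base
point to points of level below `n`. -/
inductive LowPath {P X σ : Type*} [Group P] [MulAction P X] (x₀ : X) (L : X → ℕ) (ι : σ → P)
    (n : ℕ) : P → Prop
  | one : L x₀ < n → LowPath x₀ L ι n 1
  | step (p : P) (s : σ) : LowPath x₀ L ι n p → L ((ι s * p) • x₀) < n →
      LowPath x₀ L ι n (ι s * p)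

theorem LowPath.level_lt {P X σ : Type*} [Group P] [MulAction P X] {x₀ : X} {L : X → ℕ} {ι : σ → P}
    {n : ℕ} {p : P} (h : LowPath x₀ L ι n p) : L (p • x₀) < n := by
  cases h with
  | one h => rwa [one_smul]
  | step p s _ h => exact h

/-- `IsPeakReduced x L S B s t` says that the path `s • x, x, t • x` can be replaced by a path through
points below the level of `x`, which takes its steps in `S` and stays in `B • x`. -/
def IsPeakReduced {G X : Type*} [Group G] [MulAction G X] (L : X → ℕ) (S B : Set G) (x : X)
    (s t : G) : Prop :=
  ∃ h, Relation.ReflTransGen (fun a b => b ∈ B ∧ b * a⁻¹ ∈ S ∧ L (b • x) < L x) s h ∧ t * h⁻¹ ∈ S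

/-- One round of peak reduction: in a group `P` over `G` in which the relations `ŝ b̂ = (sb)^` hold
for `s ∈ S` and `b ∈ B`, a path below level `n + 1` can be pushed below level `n`, up to
its last step. -/
theorem LowPath.reduce {G P X : Type*} [Group G] [Group P] [MulAction G X] [MulAction P X]
    {x₀ : X} {L : X → ℕ} {S B : Set G} (hSB : S ⊆ B) (hinv : ∀ s ∈ S, s⁻¹ ∈ S)
    (hpeak : ∀ g : G, ∀ s ∈ S, ∀ t ∈ S, L (s • g • x₀) < L (g • x₀) →
      L (t • g • x₀) ≤ L (g • x₀) → IsPeakReduced L S B (g • x₀) s t)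
    (π : P →* G) (hsmul : ∀ (p : P) (x : X), p • x = π p • x) (ι : S → P) (c : G → P)
    (hι : ∀ s, π (ι s) = s) (hc : ∀ b, π (c b) = b)
    (r1 : ∀ s : S, c s = ι s) (r2 : ∀ (s : S) (b : G), b ∈ B → ι s * c b = c (s * b))
    (hιinv : ∀ s : S, ι ⟨s⁻¹, hinv s s.2⟩ = (ι s)⁻¹)
    {n : ℕ} {p : P} (hp : LowPath x₀ L ι (n + 1) p) (hn : L x₀ < n) :
    (L (p • x₀) < n → LowPath x₀ L ι n p) ∧
      (n ≤ L (p • x₀) → ∃ q s, LowPath x₀ L ι n q ∧ p = ι s * q) := by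
  induction hp with
  | one =>
    rw [one_smul]
    exact ⟨fun h => .one h, fun h => absurd h (by omega)⟩
  | step p s hp hlt ih =>
    have final : ∀ q, LowPath x₀ L ι n q → ∀ s', ι s * p = ι s' * q →
        (L ((ι s * p) • x₀) < n → LowPath x₀ L ι n (ι s * p)) ∧
        (n ≤ L ((ι s * p) • x₀) → ∃ q s', LowPath x₀ L ι n q ∧ ι s * p = ι s' * q) := by
      intro q hq s' hs'
      refine ⟨fun h => ?_, fun h => ⟨q, s', hq, hs'⟩⟩
      rw [hs'] at h ⊢
      exact .step q s' hq h
    rcases lt_or_ge (L (p • x₀)) n with h | h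
    · exact final p (ih.1 h) s rfl
    · have hpn : L (p • x₀) = n := by have := hp.level_lt; omega
      obtain ⟨q, v, hq, hpq⟩ := ih.2 h
      have hqlt : L (q • x₀) < n := hq.level_lt
      have hgx : π p • x₀ = p • x₀ := (hsmul p x₀).symm
      have hvq : c (v : G)⁻¹ * p = q := by
        rw [show (v : G)⁻¹ = ((⟨v⁻¹, hinv v v.2⟩ : S) : G) from rfl, r1, hιinv, hpq,
          inv_mul_cancel_left]
      have hqx : (v : G)⁻¹ • π p • x₀ = q • x₀ := by
        rw [hsmul q, ← mul_smul, hpq, map_mul, hι, inv_mul_cancel_left]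
      have hsx : (s : G) • π p • x₀ = (ι s * p) • x₀ := by
        rw [hsmul, map_mul, hι, mul_smul]
      obtain ⟨a, ha, hta⟩ := hpeak (π p) _ (hinv v v.2) s s.2 (by rw [hqx, hgx, hpn]; exact hqlt)
        (by rw [hsx, hgx, hpn]; omega)
      have hchain : LowPath x₀ L ι n (c a * p) ∧ a ∈ B := by
        clear hta
        induction ha with
        | refl => exact ⟨by rwa [hvq], hSB (hinv v v.2)⟩
        | @tail a b _ hab ih' =>
          obtain ⟨hbB, hbs, hbL⟩ := hab
          refine ⟨?_, hbB⟩
          have hb : c b * p = ι ⟨b * a⁻¹, hbs⟩ * (c a * p) := by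
            rw [← mul_assoc, r2 _ _ ih'.2]; simp
          rw [hb]
          refine .step _ _ ih'.1 ?_
          rw [← hb, hsmul, map_mul, hc, mul_smul, ← hpn, ← hgx]
          exact hbL
      refine final _ hchain.1 ⟨s * a⁻¹, hta⟩ ?_
      rw [← mul_assoc (ι _) (c a), r2 _ _ hchain.2]
      simp only [inv_mul_cancel_right]
      rw [r1]

/-- The peak reduction criterion: let `G` act on a set with levels, and let `S` be a finite generating
set. If the points of minimal level in the orbit of `x₀` are finite in number and include `x₀`, if the
stabilizer of `x₀` is finitely presented, and if all peaks of paths in the orbit with steps in `S` can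
be reduced within a fixed finite set `B`, then `G` is finitely presented. -/
theorem of_peak_reduction {G X : Type*} [Group G] [MulAction G X] (x₀ : X) (L : X → ℕ)
    (S B : Set G) (hS : S.Finite) (hB : B.Finite) (hSB : S ⊆ B) (h1 : 1 ∈ S)
    (hinv : ∀ s ∈ S, s⁻¹ ∈ S) (hgen : Subgroup.closure S = ⊤)
    (hmin : ∀ g : G, L x₀ ≤ L (g • x₀)) (hlev : {x | ∃ g : G, g • x₀ = x ∧ L x = L x₀}.Finite)
    [hH : IsFinitelyPresented (MulAction.stabilizer G x₀)]
    (hpeak : ∀ g : G, ∀ s ∈ S, ∀ t ∈ S, L (s • g • x₀) < L (g • x₀) →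
      L (t • g • x₀) ≤ L (g • x₀) → IsPeakReduced L S B (g • x₀) s t) :
    IsFinitelyPresented G := by
  let H := MulAction.stabilizer G x₀
  obtain ⟨k, ψ, hψ, -⟩ := hH.out
  let ρ : FreeGroup S →* G := FreeGroup.lift Subtype.val
  have hρ : Function.Surjective ρ := by
    rw [← MonoidHom.range_eq_top, FreeGroup.range_lift_eq_closure, Subtype.range_coe, hgen]
  choose lam hlam using hρ
  let Y : Set X := {x | ∃ g : G, g • x₀ = x ∧ L x = L x₀}
  have hYfin : Y.Finite := hlev
  have htr : ∀ y : Y, ∃ g : G, g • x₀ = y := fun y => ⟨y.2.choose, y.2.choose_spec.1⟩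
  choose tr htr using htr
  let π : Coprod H (FreeGroup S) →* G := Coprod.lift H.subtype ρ
  have hπl : ∀ a : H, π (Coprod.inl a) = a := fun a => by simp [π]
  have hπr : ∀ w, π (Coprod.inr w) = ρ w := fun w => by simp [π]
  let sh (q : Y × Y × S) (hq : q.2.2.1 • (q.1 : X) = q.2.1) : H :=
    ⟨(tr q.2.1)⁻¹ * q.2.2 * tr q.1, by
      rw [MulAction.mem_stabilizer_iff, mul_smul, mul_smul, htr, hq, inv_smul_eq_iff, htr]⟩
  -- `lam` chooses a word for every element of `G`; `R1` makes it trivial on `S`, and `R2` contains the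
  -- relations needed in the reduction of peaks
  let R1 : Set (Coprod H (FreeGroup S)) := Set.range fun s : S =>
    Coprod.inr (lam s) * (Coprod.inr (FreeGroup.of s))⁻¹
  let R2 : Set (Coprod H (FreeGroup S)) := Set.range fun q : S × B =>
    Coprod.inr (FreeGroup.of q.1) * Coprod.inr (lam q.2) * (Coprod.inr (lam (q.1 * q.2)))⁻¹
  -- the generators of the stabilizer `H` are expressed in `S`
  let R3 : Set (Coprod H (FreeGroup S)) := Set.range fun y : Fin k =>
    Coprod.inl (ψ (FreeGroup.of y)) * (Coprod.inr (lam (ψ (FreeGroup.of y))))⁻¹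
  -- the chosen element `tr y` moves `x₀` to the point `y` of minimal level; `R4` and `R5` account for the
  -- paths of minimal level by elements of `H`
  let R4 : Set (Coprod H (FreeGroup S)) :=
    Set.range fun q : {q : Y × Y × S // q.2.2.1 • (q.1 : X) = q.2.1} =>
      Coprod.inr (FreeGroup.of q.1.2.2) * Coprod.inr (lam (tr q.1.1)) *
        (Coprod.inr (lam (tr q.1.2.1)) * Coprod.inl (sh q.1 q.2))⁻¹
  let R5 : Set (Coprod H (FreeGroup S)) :=
    Set.range fun q : {q : Y × H // (q.1 : X) = x₀ ∧ (q.2 : G) = tr q.1} =>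
      Coprod.inr (lam (tr q.1.1)) * (Coprod.inl q.1.2)⁻¹
  have hfS := hS.to_subtype
  have hfB := hB.to_subtype
  have hfY : Finite Y := hYfin.to_subtype
  have hfin5 : Finite {q : Y × H // (q.1 : X) = x₀ ∧ (q.2 : G) = tr q.1} := by
    refine Finite.of_injective (fun q => q.1.1) ?_
    rintro ⟨⟨y, a⟩, h1, h2⟩ ⟨⟨y', a'⟩, h1', h2'⟩ h
    have h : y = y' := h
    subst h
    have : a = a' := Subtype.ext (h2.trans h2'.symm)
    subst this
    rfl
  let R := R1 ∪ R2 ∪ R3 ∪ R4 ∪ R5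
  have hRfin : R.Finite := ((((Set.finite_range _).union (Set.finite_range _)).union
    (Set.finite_range _)).union (Set.finite_range _)).union (Set.finite_range _)
  have hρof : ∀ s : S, ρ (FreeGroup.of s) = s := fun s => by simp [ρ]
  have hRπ : ∀ r ∈ R, π r = 1 := by
    rintro r ((((⟨s, rfl⟩ | ⟨q, rfl⟩) | ⟨q, rfl⟩) | ⟨q, rfl⟩) | ⟨q, rfl⟩)
    · simp [hπr, hlam, hρof]
    · simp [hπr, hlam, hρof]
    · simp [hπr, hπl, hlam]
    · simp only [map_mul, map_inv, hπr, hπl, hlam, hρof, sh]; group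
    · simp [hπr, hπl, hlam, q.2.2]
  refine of_ker_le_normalClosure π ?_ R hRfin hRπ ?_
  · intro g
    exact ⟨Coprod.inr (lam g), by rw [hπr, hlam]⟩
  let N := Subgroup.normalClosure R
  let P := Coprod H (FreeGroup S) ⧸ N
  let m : Coprod H (FreeGroup S) →* P := QuotientGroup.mk' N
  have hm : Function.Surjective m := QuotientGroup.mk'_surjective N
  let πP : P →* G := QuotientGroup.lift N π (by
    intro r hr
    have : N ≤ π.ker := Subgroup.normalClosure_le_normal hRπ
    exact this hr)
  let j : H →* P := m.comp Coprod.inl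
  let u : FreeGroup S →* P := m.comp Coprod.inr
  have hj : ∀ a, πP (j a) = a := fun a => hπl a
  have hu : ∀ w, πP (u w) = ρ w := fun w => hπr w
  have hrel : ∀ a b, a * b⁻¹ ∈ R → m a = m b := by
    intro a b hab
    rw [← mul_inv_eq_one, ← map_inv, ← map_mul]
    exact (QuotientGroup.eq_one_iff _).2 (Subgroup.subset_normalClosure hab)
  let ι : S → P := fun s => u (FreeGroup.of s)
  let c : G → P := fun g => u (lam g)
  have hι : ∀ s, πP (ι s) = s := fun s => (hu _).trans (hρof s)
  have hc : ∀ b, πP (c b) = b := fun b => (hu _).trans (hlam b)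
  have r1 : ∀ s : S, c s = ι s := fun s =>
    hrel _ _ (Or.inl (Or.inl (Or.inl (Or.inl ⟨s, rfl⟩))))
  have r2 : ∀ (s : S) (b : G), b ∈ B → ι s * c b = c (s * b) := fun s b hb =>
    (map_mul m _ _).symm.trans
      (hrel _ _ (Or.inl (Or.inl (Or.inl (Or.inr ⟨(s, ⟨b, hb⟩), rfl⟩)))))
  have r3 : ∀ y, j (ψ (FreeGroup.of y)) ∈ u.range := fun y =>
    ⟨_, (hrel _ _ (Or.inl (Or.inl (Or.inr ⟨y, rfl⟩)))).symm⟩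
  have r4 : ∀ (y y' : Y) (s : S), s.1 • (y : X) = y' → ∃ a, ι s * c (tr y) = c (tr y') * j a :=
    fun y y' s h => ⟨sh (y, y', s) h, by
      have := hrel _ _ (Or.inl (Or.inr ⟨⟨(y, y', s), h⟩, rfl⟩))
      rw [map_mul, map_mul] at this
      exact this⟩
  have r5 : ∀ y : Y, (y : X) = x₀ → ∃ a, c (tr y) = j a := fun y h =>
    ⟨⟨tr y, by rw [MulAction.mem_stabilizer_iff, htr, h]⟩,
      hrel _ _ (Or.inr ⟨⟨(y, ⟨tr y, by rw [MulAction.mem_stabilizer_iff, htr, h]⟩), h, rfl⟩, rfl⟩)⟩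
  let e : S := ⟨1, h1⟩
  have he : ι e = 1 := by
    have h3 := r2 e 1 (hSB h1)
    have h5 : c ((e : G) * 1) = ι e := by rw [mul_one]; exact r1 e
    have h6 : c (1 : G) = ι e := r1 e
    rw [h5, h6] at h3
    exact mul_eq_left.1 h3
  have hιinv : ∀ s : S, ι ⟨s⁻¹, hinv s s.2⟩ = (ι s)⁻¹ := by
    intro s
    refine eq_inv_of_mul_eq_one_left ?_
    have h3 := r2 ⟨s⁻¹, hinv s s.2⟩ s (hSB s.2)
    rw [r1 s] at h3
    rw [h3, show ((⟨s⁻¹, hinv s s.2⟩ : S) : G) * s = (e : G) from inv_mul_cancel _, r1, he]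
  let _ : MulAction P X := MulAction.compHom X πP
  have hsmul : ∀ (p : P) (x : X), p • x = πP p • x := fun _ _ => rfl
  have hur : ∀ p : P, p ∈ u.range := by
    intro p
    obtain ⟨p, rfl⟩ := hm p
    induction p using Coprod.induction_on with
    | inl a =>
      obtain ⟨w, rfl⟩ := hψ a
      induction w using FreeGroup.induction_on with
      | C1 => simp
      | of y => exact r3 y
      | inv_of y _ => rw [map_inv, map_inv, map_inv]; exact inv_mem (r3 y)
      | mul a b ha hb => rw [map_mul, map_mul, map_mul]; exact mul_mem ha hb
    | inr w => exact ⟨w, rfl⟩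
    | mul a b ha hb => rw [map_mul]; exact mul_mem ha hb
  have hpath : ∀ p : P, ∃ n, LowPath x₀ L ι n p := by
    have hmono : ∀ n n' p, n ≤ n' → LowPath x₀ L ι n p → LowPath x₀ L ι n' p := by
      intro n n' p hnn h
      induction h with
      | one h => exact .one (by omega)
      | step p s _ h ih => exact .step p s ih (by omega)
    have hstep : ∀ (s : S) (p : P), (∃ n, LowPath x₀ L ι n p) →
        ∃ n, LowPath x₀ L ι n (ι s * p) := by
      rintro s p ⟨n, hn⟩
      exact ⟨max n (L ((ι s * p) • x₀) + 1), .step p s (hmono _ _ _ (le_max_left _ _) hn)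
        (by have := le_max_right n (L ((ι s * p) • x₀) + 1); omega)⟩
    have hw : ∀ (w : FreeGroup S) (p : P), (∃ n, LowPath x₀ L ι n p) →
        ∃ n, LowPath x₀ L ι n (u w * p) := by
      intro w
      induction w using FreeGroup.induction_on with
      | C1 => intro p hp; rwa [map_one, one_mul]
      | of s => exact hstep s
      | inv_of s _ =>
        intro p hp
        rw [map_inv]
        have := hstep ⟨s⁻¹, hinv s s.2⟩ p hp
        rwa [hιinv] at this
      | mul a b ha hb => intro p hp; rw [map_mul, mul_assoc]; exact ha _ (hb _ hp)
    intro p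
    obtain ⟨w, rfl⟩ := hur p
    simpa using hw w 1 ⟨L x₀ + 1, .one (by omega)⟩
  -- by peak reduction, a closed path is pushed down to the minimal level
  have hdown : ∀ d p, L (p • x₀) = L x₀ → LowPath x₀ L ι (L x₀ + 1 + d) p →
      LowPath x₀ L ι (L x₀ + 1) p := by
    intro d
    induction d with
    | zero => intro p _ h; exact h
    | succ d ih =>
      intro p hp h
      exact ih p hp ((LowPath.reduce (n := L x₀ + 1 + d) hSB hinv hpeak πP hsmul ι c hι hc r1 r2
        hιinv h (by omega)).1 (by omega))
  -- a path of minimal level is a chosen element times an element of the stabilizer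
  have hbase : ∀ p, LowPath x₀ L ι (L x₀ + 1) p → ∃ y : Y, ∃ a, p • x₀ = y ∧ p = c (tr y) * j a := by
    intro p h
    induction h with
    | one =>
      obtain ⟨a, ha⟩ := r5 ⟨x₀, 1, one_smul _ _, rfl⟩ rfl
      exact ⟨⟨x₀, 1, one_smul _ _, rfl⟩, a⁻¹, one_smul _ _, by rw [ha, map_inv, mul_inv_cancel]⟩
    | step p s hp h ih =>
      obtain ⟨y, a, h2, h3⟩ := ih
      have h4 : (ι s * p) • x₀ ∈ Y := by
        refine ⟨πP (ι s * p), rfl, le_antisymm (by omega) (hmin _)⟩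
      obtain ⟨b, hb⟩ := r4 y ⟨_, h4⟩ s (by
        rw [← h2]; show _ = (ι s * p) • x₀; rw [hsmul, hsmul, map_mul, hι, mul_smul])
      refine ⟨⟨_, h4⟩, b * a, rfl, ?_⟩
      rw [map_mul, ← mul_assoc, ← hb, mul_assoc, ← h3]
  intro p hp
  have hp' : πP (m p) = 1 := hp
  have hx : m p • x₀ = x₀ := by rw [hsmul, hp', one_smul]
  obtain ⟨n, hn⟩ := hpath (m p)
  have hn0 : L x₀ < n := by have := hn.level_lt; rwa [hx] at this
  have hlow := hdown (n - (L x₀ + 1)) (m p) (by rw [hx])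
    (by rwa [show L x₀ + 1 + (n - (L x₀ + 1)) = n by omega])
  obtain ⟨y, a, h2, h3⟩ := hbase _ hlow
  obtain ⟨b, hb⟩ := r5 y (by rw [← h2, hx])
  rw [hb, ← map_mul] at h3
  have h4 : (b * a : H) = 1 := Subtype.ext (by rw [← hj, ← h3, hp']; rfl)
  show m p = 1
  rw [h3, h4, map_one]

end Group.IsFinitelyPresented

namespace Group.IsFinitelyPresented

variable {G X : Type*} [Group G] [MulAction G X]

/-- `s • x` and `t • x` are joined by a path with steps in `S`, all of whose intermediate points lie
in `B • x` and strictly below the level of `x`; there is at least one intermediate point. -/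
def IsLinked (L : X → ℕ) (S B : Set G) (x : X) (s t : G) : Prop :=
  ∃ g h, (g ∈ B ∧ L (g • x) < L x) ∧ s * g⁻¹ ∈ S ∧
    Relation.ReflTransGen (fun a b => b ∈ B ∧ b * a⁻¹ ∈ S ∧ L (b • x) < L x) g h ∧ t * h⁻¹ ∈ S

variable {L : X → ℕ} {S B : Set G} {x : X} {r s t : G}

theorem IsLinked.isPeakReduced (hinv : ∀ s ∈ S, s⁻¹ ∈ S) (h : IsLinked L S B x s t) :
    IsPeakReduced L S B x s t := by
  obtain ⟨g, h, hg, hs, hc, ht⟩ := h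
  exact ⟨h, .head ⟨hg.1, by simpa using hinv _ hs, hg.2⟩ hc, ht⟩

theorem IsLinked.symm (hinv : ∀ s ∈ S, s⁻¹ ∈ S) (h : IsLinked L S B x s t) :
    IsLinked L S B x t s := by
  obtain ⟨g, h, hg, hs, hc, ht⟩ := h
  have key : (h ∈ B ∧ L (h • x) < L x) ∧
      Relation.ReflTransGen (fun a b => b ∈ B ∧ b * a⁻¹ ∈ S ∧ L (b • x) < L x) h g := by
    clear ht
    induction hc with
    | refl => exact ⟨hg, .refl⟩
    | tail _ hab ih =>
      exact ⟨⟨hab.1, hab.2.2⟩, .head ⟨ih.1.1, by simpa using hinv _ hab.2.1, ih.1.2⟩ ih.2⟩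
  exact ⟨h, g, key.1, ht, key.2, hs⟩

theorem IsLinked.trans (hinv : ∀ s ∈ S, s⁻¹ ∈ S) (hrB : r ∈ B) (hr : L (r • x) < L x)
    (h₁ : IsLinked L S B x s r) (h₂ : IsLinked L S B x r t) : IsLinked L S B x s t := by
  obtain ⟨g, h, hg, hs, hc, ht⟩ := h₁
  obtain ⟨g', h', hg', hs', hc', ht'⟩ := h₂
  exact ⟨g, h', hg, hs, (hc.tail ⟨hrB, ht, hr⟩).trans
    (.head ⟨hg'.1, by simpa using hinv _ hs', hg'.2⟩ hc'), ht'⟩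

theorem IsLinked.of_mid (g : G) (hgB : g ∈ B) (hg : L (g • x) < L x) (hs : s * g⁻¹ ∈ S)
    (ht : t * g⁻¹ ∈ S) : IsLinked L S B x s t :=
  ⟨g, g, ⟨hgB, hg⟩, hs, .refl, ht⟩

theorem IsLinked.of_step (h1 : 1 ∈ S) (hinv : ∀ s ∈ S, s⁻¹ ∈ S) (hsB : s ∈ B) (htB : t ∈ B)
    (h : L (s • x) < L x ∨ L (t • x) < L x) (ht : t * s⁻¹ ∈ S) : IsLinked L S B x s t := by
  rcases h with h | h
  · exact .of_mid s hsB h (by simpa) ht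
  · exact .of_mid t htB h (by simpa using hinv _ ht) (by simpa)

end Group.IsFinitelyPresented

/-! ### Peak reduction for integral vectors -/

namespace IntVector

open Group.IsFinitelyPresented Function

variable {ι : Type*} [Fintype ι] [DecidableEq ι]

/-- The elementary automorphism of `ℤ^ι` that adds `c` times the `j`-th coordinate to the `i`-th. -/
def elem (i j : ι) (h : i ≠ j) (c : ℤˣ) : (ι → ℤ) ≃ₗ[ℤ] (ι → ℤ) where
  toFun v := update v i (v i + c * v j)
  invFun v := update v i (v i + (-c : ℤˣ) * v j)
  left_inv v := by ext k; by_cases hk : k = i <;> simp [hk, h.symm]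
  right_inv v := by ext k; by_cases hk : k = i <;> simp [hk, h.symm]
  map_add' v w := by ext k; by_cases hk : k = i <;> simp [hk]; ring
  map_smul' a v := by ext k; by_cases hk : k = i <;> simp [hk]; ring

theorem elem_smul (i j : ι) (h : i ≠ j) (c : ℤˣ) (v : ι → ℤ) :
    elem i j h c • v = update v i (v i + c * v j) := rfl

theorem elem_apply (i j : ι) (h : i ≠ j) (c : ℤˣ) (v : ι → ℤ) (k : ι) :
    elem i j h c v k = if k = i then v i + c * v j else v k := by
  show update v i (v i + c * v j) k = _
  rw [update_apply]

theorem elem_inv (i j : ι) (h : i ≠ j) (c : ℤˣ) : (elem i j h c)⁻¹ = elem i j h (-c) := by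
  rw [inv_eq_iff_mul_eq_one]
  ext v k; simp [elem_apply, h.symm]; split_ifs <;> simp_all

/-- The signed permutation `v ↦ (ε i * v (σ i))_i` of the coordinates. -/
def signedPerm (σ : Equiv.Perm ι) (ε : ι → ℤˣ) : (ι → ℤ) ≃ₗ[ℤ] (ι → ℤ) where
  toFun v i := ε i * v (σ i)
  invFun v i := ε (σ.symm i) * v (σ.symm i)
  left_inv v := by
    ext k; simp only [Equiv.apply_symm_apply, ← mul_assoc, ← Units.val_mul, Int.units_mul_self]; simp
  right_inv v := by
    ext k; simp only [Equiv.symm_apply_apply, ← mul_assoc, ← Units.val_mul, Int.units_mul_self]; simp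
  map_add' v w := by ext k; simp [mul_add]
  map_smul' a v := by ext k; simp; ring

theorem signedPerm_apply (σ : Equiv.Perm ι) (ε : ι → ℤˣ) (v : ι → ℤ) (k : ι) :
    signedPerm σ ε v k = ε k * v (σ k) := rfl

theorem signedPerm_inv (σ : Equiv.Perm ι) (ε : ι → ℤˣ) :
    (signedPerm σ ε)⁻¹ = signedPerm σ.symm (fun i => ε (σ.symm i)) := by
  rw [inv_eq_iff_mul_eq_one]
  refine LinearEquiv.ext fun v => funext fun k => ?_
  show ε k * (ε (σ.symm (σ k)) * v (σ.symm (σ k))) = v k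
  rw [Equiv.symm_apply_apply, ← mul_assoc, ← Units.val_mul, Int.units_mul_self]; simp

variable (ι) in
/-- Elementary automorphisms and signed permutations. -/
def gens : Set ((ι → ℤ) ≃ₗ[ℤ] (ι → ℤ)) :=
  (Set.range fun q : {p : ι × ι // p.1 ≠ p.2} × ℤˣ => elem q.1.1.1 q.1.1.2 q.1.2 q.2) ∪
    Set.range fun q : Equiv.Perm ι × (ι → ℤˣ) => signedPerm q.1 q.2

theorem elem_mem (i j : ι) (h : i ≠ j) (c : ℤˣ) : elem i j h c ∈ gens ι :=
  Or.inl ⟨(⟨(i, j), h⟩, c), rfl⟩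

theorem signedPerm_mem (σ : Equiv.Perm ι) (ε : ι → ℤˣ) : signedPerm σ ε ∈ gens ι :=
  Or.inr ⟨(σ, ε), rfl⟩

theorem gens_finite : (gens ι).Finite := (Set.finite_range _).union (Set.finite_range _)

theorem one_mem_gens : 1 ∈ gens ι := Or.inr ⟨(1, 1), by ext v k; simp [signedPerm_apply]⟩

theorem inv_mem_gens (s : (ι → ℤ) ≃ₗ[ℤ] (ι → ℤ)) (hs : s ∈ gens ι) : s⁻¹ ∈ gens ι := by
  obtain ⟨q, rfl⟩ | ⟨q, rfl⟩ := hs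
  · rw [elem_inv]; exact elem_mem _ _ _ _
  · dsimp only; rw [signedPerm_inv]; exact signedPerm_mem _ _

/-- The `ℓ¹`-norm of an integral vector. -/
def norm1 (v : ι → ℤ) : ℕ := ∑ i, (v i).natAbs

theorem norm1_update (v : ι → ℤ) (i : ι) (a : ℤ) :
    norm1 (update v i a) + (v i).natAbs = norm1 v + a.natAbs := by
  have h1 := Finset.add_sum_erase Finset.univ (fun k => (v k).natAbs) (Finset.mem_univ i)
  have h2 := Finset.add_sum_erase Finset.univ (fun k => (update v i a k).natAbs) (Finset.mem_univ i)
  have h3 : ∑ k ∈ Finset.univ.erase i, (update v i a k).natAbs =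
      ∑ k ∈ Finset.univ.erase i, (v k).natAbs :=
    Finset.sum_congr rfl fun k hk => by rw [update_of_ne (Finset.ne_of_mem_erase hk)]
  simp only [update_self] at h2
  unfold norm1
  omega

theorem norm1_elem (i j : ι) (h : i ≠ j) (c : ℤˣ) (v : ι → ℤ) :
    norm1 (elem i j h c • v) + (v i).natAbs = norm1 v + (v i + c * v j).natAbs :=
  norm1_update _ _ _

theorem norm1_signedPerm (σ : Equiv.Perm ι) (ε : ι → ℤˣ) (v : ι → ℤ) :
    norm1 (signedPerm σ ε • v) = norm1 v := by
  show ∑ i, (ε i * v (σ i)).natAbs = _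
  simp only [Int.natAbs_mul, Int.natAbs_of_isUnit (ε _).isUnit, one_mul]
  exact Equiv.sum_comp σ fun k => (v k).natAbs

/-- The products of two generators: all elements in which a peak is reduced. -/
def ball (ι : Type*) [Fintype ι] [DecidableEq ι] : Set ((ι → ℤ) ≃ₗ[ℤ] (ι → ℤ)) :=
  Set.image2 (· * ·) (gens ι) (gens ι)

theorem gens_subset_ball : gens ι ⊆ ball ι := fun s hs => ⟨s, hs, 1, one_mem_gens, mul_one s⟩

local notation "Linked" => IsLinked norm1 (gens ι) (ball ι)

theorem linked_of_commute {s t : (ι → ℤ) ≃ₗ[ℤ] (ι → ℤ)} {x : ι → ℤ} (hs : s ∈ gens ι)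
    (ht : t ∈ gens ι) (h : t * s = s * t) (hlt : norm1 ((t * s) • x) < norm1 x) :
    Linked x s t := by
  refine .of_mid (t * s) ⟨t, ht, s, hs, rfl⟩ hlt ?_ ?_
  · rw [mul_inv_rev, mul_inv_cancel_left]; exact inv_mem_gens _ ht
  · rw [h, mul_inv_rev, mul_inv_cancel_left]; exact inv_mem_gens _ hs

theorem linked_disjoint {i j k l : ι} (hij : i ≠ j) (hkl : k ≠ l) (hik : i ≠ k) (hil : i ≠ l)
    (hkj : k ≠ j) (c d : ℤˣ) (x : ι → ℤ) (hs : norm1 (elem i j hij c • x) ≤ norm1 x)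
    (ht : norm1 (elem k l hkl d • x) ≤ norm1 x)
    (hst : norm1 (elem i j hij c • x) < norm1 x ∨ norm1 (elem k l hkl d • x) < norm1 x) :
    Linked x (elem i j hij c) (elem k l hkl d) := by
  refine linked_of_commute (elem_mem _ _ _ _) (elem_mem _ _ _ _) ?_ ?_
  · refine LinearEquiv.ext fun v => funext fun m => ?_
    simp only [LinearEquiv.mul_apply, elem_apply]
    split_ifs <;> simp_all
  · rw [mul_smul]
    have h1 := norm1_elem k l hkl d (elem i j hij c • x)
    have h2 := norm1_elem k l hkl d x
    have h3 : (elem i j hij c • x) k = x k := by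
      rw [elem_smul, update_of_ne hik.symm]
    have h4 : (elem i j hij c • x) l = x l := by
      rw [elem_smul, update_of_ne hil.symm]
    rw [h3, h4] at h1
    omega

theorem units_cases (c : ℤˣ) : (c : ℤ) = 1 ∨ (c : ℤ) = -1 := by
  rcases Int.units_eq_one_or c with rfl | rfl <;> simp

/-- Two elementary automorphisms in the same two coordinates: they differ by another one and a signed
transposition. -/
theorem linked_opposite {i j : ι} (hij : i ≠ j) (c d : ℤˣ) (x : ι → ℤ)
    (hs : norm1 (elem i j hij c • x) ≤ norm1 x)
    (ht : norm1 (elem j i hij.symm d • x) ≤ norm1 x)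
    (hst : norm1 (elem i j hij c • x) < norm1 x ∨ norm1 (elem j i hij.symm d • x) < norm1 x) :
    Linked x (elem i j hij c) (elem j i hij.symm d) := by
  wlog hle : (x j).natAbs ≤ (x i).natAbs generalizing i j c d
  · exact (this hij.symm d c ht hs hst.symm (by omega)).symm inv_mem_gens
  have h1 := norm1_elem i j hij c x
  have h2 := norm1_elem j i hij.symm d x
  have hcd : c = d ∧ (x i + c * x j).natAbs < (x i).natAbs := by
    rcases Int.units_eq_one_or c with rfl | rfl <;> rcases Int.units_eq_one_or d with rfl | rfl <;>
      simp only [Units.val_one, Units.val_neg, one_mul, neg_mul, true_and] at h1 h2 ⊢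
    · omega
    · omega
    · omega
    · omega
  obtain ⟨rfl, hlt⟩ := hcd
  -- `w` is the signed transposition for which `w * elem i j c = elem i j c⁻¹ * elem j i c`
  let w := signedPerm (Equiv.swap i j) fun k => if k = i then -c else if k = j then c else 1
  have hw : ∀ v k, w v k = if k = i then -c * v j else if k = j then c * v i else v k := by
    intro v k
    rw [signedPerm_apply]
    by_cases hki : k = i
    · simp [hki]
    · by_cases hkj : k = j
      · subst hkj; simp [hki]
      · simp [hki, hkj, Equiv.swap_apply_of_ne_of_ne hki hkj]
  have hmul : elem i j hij c * (w * elem i j hij c) = elem j i hij.symm c := by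
    refine LinearEquiv.ext fun v => funext fun m => ?_
    simp only [LinearEquiv.mul_apply, elem_apply, hw]
    have hc : (c : ℤ) * c = 1 := by rw [← Units.val_mul, Int.units_mul_self]; rfl
    by_cases hmi : m = i
    · subst hmi; simp [hij, hij.symm]; linear_combination (v m + c * v j) * hc
    · by_cases hmj : m = j
      · subst hmj; simp [hmi]; linear_combination (v m) * hc
      · simp [hmi, hmj]
  refine .of_mid (w * elem i j hij c) ⟨w, signedPerm_mem _ _, _, elem_mem _ _ _ _, rfl⟩ ?_ ?_ ?_
  · rw [mul_smul, norm1_signedPerm]; omega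
  · rw [mul_inv_rev, mul_inv_cancel_left]; exact inv_mem_gens _ (signedPerm_mem _ _)
  · rw [← hmul, mul_inv_cancel_right]; exact elem_mem _ _ _ _

/-- The coordinate changed by the second automorphism is added by the first one. Either the commutator
relation reduces the peak, or a third automorphism reduces the norm and is linked to both. -/
theorem linked_chain {i j l : ι} (hij : i ≠ j) (hjl : j ≠ l) (hil : i ≠ l) (c d : ℤˣ) (x : ι → ℤ)
    (hs : norm1 (elem i j hij c • x) ≤ norm1 x)
    (ht : norm1 (elem j l hjl d • x) ≤ norm1 x)
    (hst : norm1 (elem i j hij c • x) < norm1 x ∨ norm1 (elem j l hjl d • x) < norm1 x) :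
    Linked x (elem i j hij c) (elem j l hjl d) := by
  have h1 := norm1_elem i j hij c x
  have h2 := norm1_elem j l hjl d x
  by_cases hA : (x i + c * (x j + d * x l)).natAbs + (x j + d * x l).natAbs <
      (x i).natAbs + (x j).natAbs
  · have hmul : elem i l hil (c * d) * (elem j l hjl d * elem i j hij c) =
        elem i j hij c * elem j l hjl d := by
      refine LinearEquiv.ext fun v => funext fun m => ?_
      by_cases hm : m = i
      · subst hm; simp [elem_apply, hij, hjl.symm, hil.symm]; ring
      · simp [elem_apply, hm, hij.symm, hil.symm]
    refine ⟨elem j l hjl d * elem i j hij c, elem i j hij c * elem j l hjl d,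
      ⟨⟨_, elem_mem _ _ _ _, _, elem_mem _ _ _ _, rfl⟩, ?_⟩, ?_, .single ⟨⟨_, elem_mem _ _ _ _, _,
        elem_mem _ _ _ _, rfl⟩, ?_, ?_⟩, ?_⟩
    · rw [mul_smul]
      have h3 := norm1_elem j l hjl d (elem i j hij c • x)
      have h4 : (elem i j hij c • x) j = x j := by rw [elem_smul, update_of_ne hij.symm]
      have h5 : (elem i j hij c • x) l = x l := by rw [elem_smul, update_of_ne hil.symm]
      rw [h4, h5] at h3
      omega
    · rw [mul_inv_rev, mul_inv_cancel_left]; exact inv_mem_gens _ (elem_mem _ _ _ _)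
    · rw [← hmul, mul_inv_cancel_right]; exact elem_mem _ _ _ _
    · rw [mul_smul]
      have h3 := norm1_elem i j hij c (elem j l hjl d • x)
      have h4 : (elem j l hjl d • x) i = x i := by rw [elem_smul, update_of_ne hij]
      have h5 : (elem j l hjl d • x) j = x j + d * x l := by rw [elem_smul, update_self]
      rw [h4, h5] at h3
      omega
    · rw [mul_inv_rev, mul_inv_cancel_left]; exact inv_mem_gens _ (elem_mem _ _ _ _)
  · -- here `x l` is larger than `x j`, which can be used to shorten it
    obtain ⟨e, he⟩ : ∃ e : ℤˣ, (x l + e * x j).natAbs < (x l).natAbs := by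
      by_cases h : (x l + x j).natAbs < (x l).natAbs
      · exact ⟨1, by simpa using h⟩
      · refine ⟨-1, ?_⟩
        simp only [Units.val_neg, Units.val_one, neg_mul, one_mul]
        rcases units_cases c with hc | hc <;> rcases units_cases d with hd | hd <;>
          simp only [hc, hd, one_mul, neg_mul] at h1 h2 hA <;> omega
    have hr := norm1_elem l j hjl.symm e x
    exact .trans inv_mem_gens (r := elem l j hjl.symm e) (gens_subset_ball (elem_mem _ _ _ _))
      (by omega) (linked_disjoint hij hjl.symm hil hij hjl.symm c e x hs (by omega)
        (Or.inr (by omega))) (linked_opposite hjl.symm e d x (by omega) ht (Or.inl (by omega)))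

/-- Two elementary automorphisms changing the same coordinate: the larger of the two coordinates which
they add can be reduced by the smaller one. -/
theorem linked_same_target {i j k : ι} (hij : i ≠ j) (hik : i ≠ k) (c d : ℤˣ) (x : ι → ℤ)
    (hs : norm1 (elem i j hij c • x) ≤ norm1 x)
    (ht : norm1 (elem i k hik d • x) ≤ norm1 x)
    (hst : norm1 (elem i j hij c • x) < norm1 x ∨ norm1 (elem i k hik d • x) < norm1 x) :
    Linked x (elem i j hij c) (elem i k hik d) := by
  have h1 := norm1_elem i j hij c x
  have h2 := norm1_elem i k hik d x
  by_cases hjk : j = k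
  · subst hjk
    have hcd : c = d := by
      rcases Int.units_eq_one_or c with rfl | rfl <;> rcases Int.units_eq_one_or d with rfl | rfl <;>
        simp only [Units.val_one, Units.val_neg, one_mul, neg_mul] at h1 h2 ⊢ <;> omega
    subst hcd
    exact .of_step one_mem_gens inv_mem_gens (gens_subset_ball (elem_mem _ _ _ _))
      (gens_subset_ball (elem_mem _ _ _ _)) hst (by rw [mul_inv_cancel]; exact one_mem_gens)
  · wlog hle : (x j).natAbs ≤ (x k).natAbs generalizing j k c d
    · exact (this hik hij d c ht hs hst.symm h2 h1 (Ne.symm hjk) (by omega)).symm inv_mem_gens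
    by_cases hj : x j = 0
    · have hsx : elem i j hij c • x = x := by
        rw [elem_smul, hj, mul_zero, add_zero, update_eq_self]
      refine linked_of_commute (elem_mem _ _ _ _) (elem_mem _ _ _ _) ?_ ?_
      · refine LinearEquiv.ext fun v => funext fun m => ?_
        by_cases hm : m = i
        · subst hm; simp [elem_apply, hij.symm, hik.symm]; ring
        · simp [elem_apply, hm]
      · rw [mul_smul, hsx]; rw [hsx] at hst; omega
    · obtain ⟨e, he⟩ : ∃ e : ℤˣ, (x k + e * x j).natAbs < (x k).natAbs := by
        by_cases h : (x k + x j).natAbs < (x k).natAbs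
        · exact ⟨1, by simpa using h⟩
        · refine ⟨-1, ?_⟩
          simp only [Units.val_neg, Units.val_one, neg_mul, one_mul]
          omega
      have hr := norm1_elem k j (Ne.symm hjk) e x
      exact .trans inv_mem_gens (r := elem k j (Ne.symm hjk) e)
        (gens_subset_ball (elem_mem _ _ _ _)) (by omega)
        (linked_disjoint hij (Ne.symm hjk) hik hij (Ne.symm hjk) c e x hs (by omega)
          (Or.inr (by omega)))
        ((linked_chain hik (Ne.symm hjk) hij d e x ht (by omega) (Or.inr (by omega))).symm
          inv_mem_gens)

/-- Peak reduction for elementary automorphisms of `ℤ^ι`. -/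
theorem linked_elem {i j k l : ι} (hij : i ≠ j) (hkl : k ≠ l) (c d : ℤˣ) (x : ι → ℤ)
    (hs : norm1 (elem i j hij c • x) ≤ norm1 x)
    (ht : norm1 (elem k l hkl d • x) ≤ norm1 x)
    (hst : norm1 (elem i j hij c • x) < norm1 x ∨ norm1 (elem k l hkl d • x) < norm1 x) :
    Linked x (elem i j hij c) (elem k l hkl d) := by
  by_cases hik : i = k
  · subst hik; exact linked_same_target hij hkl c d x hs ht hst
  by_cases hjk : k = j
  · subst hjk
    by_cases hli : i = l
    · subst hli; exact linked_opposite hij c d x hs ht hst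
    · exact linked_chain hij hkl hli c d x hs ht hst
  by_cases hli : i = l
  · subst hli; exact (linked_chain hkl hij hjk d c x ht hs hst.symm).symm inv_mem_gens
  · exact linked_disjoint hij hkl hik hli hjk c d x hs ht hst

theorem signedPerm_mul_elem (σ : Equiv.Perm ι) (ε : ι → ℤˣ) (i j : ι) (h : i ≠ j) (c : ℤˣ) :
    signedPerm σ ε * elem i j h c = elem (σ.symm i) (σ.symm j) (σ.symm.injective.ne h)
      (ε (σ.symm i) * c * ε (σ.symm j)) * signedPerm σ ε := by
  refine LinearEquiv.ext fun v => funext fun m => ?_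
  simp only [LinearEquiv.mul_apply, elem_apply, signedPerm_apply, Equiv.apply_symm_apply]
  by_cases hm : σ m = i
  · have hm' : m = σ.symm i := by rw [← hm, Equiv.symm_apply_apply]
    have hc : (ε (σ.symm j) : ℤ) * ε (σ.symm j) = 1 := by
      rw [← Units.val_mul, Int.units_mul_self]; rfl
    simp only [hm', Equiv.apply_symm_apply, if_true, Units.val_mul]
    linear_combination -(ε (σ.symm i) * c * v j : ℤ) * hc
  · have hm' : m ≠ σ.symm i := fun h => hm (by rw [h, Equiv.apply_symm_apply])
    simp only [hm, hm', if_false]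

theorem isPeakReduced_gens (x : ι → ℤ) (s t : (ι → ℤ) ≃ₗ[ℤ] (ι → ℤ)) (hs : s ∈ gens ι)
    (ht : t ∈ gens ι) (hsx : norm1 (s • x) < norm1 x) (htx : norm1 (t • x) ≤ norm1 x) :
    IsPeakReduced norm1 (gens ι) (ball ι) x s t := by
  obtain ⟨⟨⟨⟨i, j⟩, hij⟩, c⟩, rfl⟩ | ⟨q, rfl⟩ := hs
  · obtain ⟨⟨⟨⟨k, l⟩, hkl⟩, d⟩, rfl⟩ | ⟨q, rfl⟩ := ht
    · exact (linked_elem hij hkl c d x hsx.le htx (Or.inl hsx)).isPeakReduced inv_mem_gens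
    · refine IsLinked.isPeakReduced inv_mem_gens (.of_mid (signedPerm q.1 q.2 * elem i j hij c)
        ⟨_, signedPerm_mem _ _, _, elem_mem _ _ _ _, rfl⟩ ?_ ?_ ?_)
      · rw [mul_smul, norm1_signedPerm]; exact hsx
      · rw [mul_inv_rev, mul_inv_cancel_left]; exact inv_mem_gens _ (signedPerm_mem _ _)
      · rw [signedPerm_mul_elem, mul_inv_rev, mul_inv_cancel_left]
        exact inv_mem_gens _ (elem_mem _ _ _ _)
  · exact absurd (norm1_signedPerm q.1 q.2 x) hsx.ne

end IntVector

namespace Group.IsFinitelyPresented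

instance prod {A B : Type*} [Group A] [Group B] [IsFinitelyPresented A] [IsFinitelyPresented B] :
    IsFinitelyPresented (A × B) := by
  let e : A ≃* (MonoidHom.snd A B).ker :=
    { toFun := fun a => ⟨(a, 1), rfl⟩
      invFun := fun p => p.1.1
      left_inv := fun a => rfl
      right_inv := fun p => Subtype.ext (Prod.ext rfl (show (1 : B) = p.1.2 from p.2.symm))
      map_mul' := fun a b => Subtype.ext (Prod.ext rfl (one_mul 1).symm) }
  have := equiv e
  exact of_extension (MonoidHom.snd A B) Prod.snd_surjective

theorem semidirectProduct {N H : Type*} [Group N] [Group H] (φ : H →* MulAut N)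
    [IsFinitelyPresented N] [IsFinitelyPresented H] : IsFinitelyPresented (N ⋊[φ] H) := by
  let f : N →* (SemidirectProduct.rightHom : N ⋊[φ] H →* H).ker :=
    SemidirectProduct.inl.codRestrict _ fun a => by simp [MonoidHom.mem_ker]
  have hf : Function.Bijective f := by
    refine ⟨fun a b h => SemidirectProduct.inl_injective (congrArg Subtype.val h), ?_⟩
    rintro ⟨p, hp⟩
    rw [← SemidirectProduct.range_inl_eq_ker_rightHom] at hp
    obtain ⟨a, ha⟩ := hp
    exact ⟨a, Subtype.ext ha⟩
  have := equiv (MulEquiv.ofBijective f hf)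
  exact of_extension (SemidirectProduct.rightHom : N ⋊[φ] H →* H)
    SemidirectProduct.rightHom_surjective

theorem fin_int (n : ℕ) : IsFinitelyPresented (Multiplicative (Fin n → ℤ)) := by
  induction n with
  | zero => infer_instance
  | succ n ih =>
    exact equiv ((MulEquiv.prodMultiplicative ℤ (Fin n → ℤ)).symm.trans
      (AddEquiv.toMultiplicative (Fin.consLinearEquiv ℤ fun _ : Fin (n + 1) => ℤ).toAddEquiv))

theorem matrix_int (n m : ℕ) : IsFinitelyPresented (Multiplicative (Matrix (Fin n) (Fin m) ℤ)) := by
  have := fin_int (n * m)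
  exact equiv (AddEquiv.toMultiplicative
    ((LinearEquiv.funCongrLeft ℤ ℤ finProdFinEquiv).trans
      (LinearEquiv.curry ℤ ℤ (Fin n) (Fin m))).toAddEquiv)

end Group.IsFinitelyPresented

/-! ### `GL_n(ℤ)` is finitely presented -/

namespace IntVector

open Group Group.IsFinitelyPresented Function

/-- The automorphism group of `ℤ^n`. -/
abbrev AutZ (n : ℕ) := (Fin n → ℤ) ≃ₗ[ℤ] (Fin n → ℤ)

/-- The first basis vector of `ℤ^(n+1)`. -/
def e0 (n : ℕ) : Fin (n + 1) → ℤ := Pi.single 0 1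

theorem eq_smul_e0_add {n : ℕ} (v : Fin (n + 1) → ℤ) :
    v = v 0 • e0 n + (Fin.cons 0 (Fin.tail v) : Fin (n + 1) → ℤ) := by
  ext k
  refine Fin.cases ?_ (fun k => ?_) k
  · simp [e0]
  · simp [e0, Fin.tail]

theorem tail_add {n : ℕ} (v w : Fin (n + 1) → ℤ) : Fin.tail (v + w) = Fin.tail v + Fin.tail w := rfl

theorem tail_smul {n : ℕ} (a : ℤ) (v : Fin (n + 1) → ℤ) : Fin.tail (a • v) = a • Fin.tail v := rfl

theorem tail_e0 (n : ℕ) : Fin.tail (e0 n) = 0 := by ext k; simp [e0, Fin.tail]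

theorem tail_apply_eq {n : ℕ} {φ : AutZ (n + 1)} (hφ : φ (e0 n) = e0 n) (v : Fin (n + 1) → ℤ) :
    Fin.tail (φ v) = Fin.tail (φ (Fin.cons 0 (Fin.tail v))) := by
  conv_lhs => rw [eq_smul_e0_add v, map_add, map_smul, hφ, tail_add, tail_smul, tail_e0]
  simp

theorem mem_stab {n : ℕ} (φ : MulAction.stabilizer (AutZ (n + 1)) (e0 n)) : φ.1 (e0 n) = e0 n := φ.2

/-- The action of the stabilizer of the first basis vector on the quotient `ℤ^n` of `ℤ^(n+1)`. -/
def stabQuot (n : ℕ) : MulAction.stabilizer (AutZ (n + 1)) (e0 n) →* AutZ n where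
  toFun φ :=
    { toFun := fun w => Fin.tail (φ.1 (Fin.cons 0 w))
      invFun := fun w => Fin.tail (φ⁻¹.1 (Fin.cons 0 w))
      left_inv := fun w => by
        dsimp only
        rw [← tail_apply_eq (mem_stab φ⁻¹), ← LinearEquiv.mul_apply, ← Subgroup.coe_mul,
          inv_mul_cancel]
        rfl
      right_inv := fun w => by
        dsimp only
        rw [← tail_apply_eq (mem_stab φ), ← LinearEquiv.mul_apply, ← Subgroup.coe_mul,
          mul_inv_cancel]
        rfl
      map_add' := fun v w => by
        rw [← tail_add, ← map_add]; congr 2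
        ext k; refine Fin.cases ?_ (fun k => ?_) k <;> simp
      map_smul' := fun a w => by
        rw [RingHom.id_apply, ← tail_smul, ← map_smul]; congr 2
        ext k; refine Fin.cases ?_ (fun k => ?_) k <;> simp }
  map_one' := by ext w k; rfl
  map_mul' φ ψ := LinearEquiv.ext fun w => tail_apply_eq (mem_stab φ) _

theorem stabQuot_apply {n : ℕ} (φ : MulAction.stabilizer (AutZ (n + 1)) (e0 n)) (w : Fin n → ℤ) :
    stabQuot n φ w = Fin.tail (φ.1 (Fin.cons 0 w)) := rfl

/-- The extension of an automorphism of `ℤ^n` to `ℤ^(n+1)` that fixes the first coordinate. -/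
def extend (n : ℕ) : AutZ n →* AutZ (n + 1) where
  toFun ψ :=
    { toFun := fun v => Fin.cons (v 0) (ψ (Fin.tail v))
      invFun := fun v => Fin.cons (v 0) (ψ.symm (Fin.tail v))
      left_inv := fun v => by simp
      right_inv := fun v => by simp
      map_add' := fun v w => by
        ext k; refine Fin.cases ?_ (fun k => ?_) k <;> simp [tail_add]
      map_smul' := fun a w => by
        ext k; refine Fin.cases ?_ (fun k => ?_) k <;> simp [tail_smul, -zsmul_eq_mul] }
  map_one' := by ext v k; exact congrFun (Fin.cons_self_tail v) k
  map_mul' φ ψ := rfl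

theorem extend_apply {n : ℕ} (ψ : AutZ n) (v : Fin (n + 1) → ℤ) :
    extend n ψ v = Fin.cons (v 0) (ψ (Fin.tail v)) := rfl

theorem extend_mem {n : ℕ} (ψ : AutZ n) :
    extend n ψ ∈ MulAction.stabilizer (AutZ (n + 1)) (e0 n) := by
  show extend n ψ (e0 n) = e0 n
  rw [extend_apply, tail_e0, map_zero]
  ext k; refine Fin.cases ?_ (fun k => ?_) k <;> simp [e0]

theorem stabQuot_extend {n : ℕ} (ψ : AutZ n) : stabQuot n ⟨extend n ψ, extend_mem ψ⟩ = ψ := rfl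

/-- The shear of `ℤ^(n+1)` that adds a linear form in the other coordinates to the first. -/
def shear (n : ℕ) : Multiplicative (Fin n → ℤ) →* MulAction.stabilizer (AutZ (n + 1)) (e0 n) where
  toFun l := ⟨
    { toFun := fun v => v + (l.toAdd ⬝ᵥ Fin.tail v) • e0 n
      invFun := fun v => v + (-(l.toAdd ⬝ᵥ Fin.tail v)) • e0 n
      left_inv := fun v => by simp [tail_add, tail_smul, tail_e0, -zsmul_eq_mul]
      right_inv := fun v => by
        beta_reduce
        rw [tail_add, tail_smul, tail_e0, smul_zero, add_zero, add_assoc, ← add_smul,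
          neg_add_cancel, zero_smul, add_zero]
      map_add' := fun v w => by simp [tail_add, dotProduct_add, add_smul]; abel
      map_smul' := fun a v => by simp [tail_smul, mul_smul, -zsmul_eq_mul] },
    by show e0 n + _ = e0 n; rw [tail_e0]; simp⟩
  map_one' := by
    ext v k
    show v k + _ = v k
    simp
  map_mul' l l' := by
    refine Subtype.ext (LinearEquiv.ext fun v => ?_)
    show v + _ = (v + _) + _
    simp [tail_add, tail_smul, tail_e0, add_dotProduct, add_smul, -zsmul_eq_mul]
    abel

theorem shear_apply {n : ℕ} (l : Multiplicative (Fin n → ℤ)) (v : Fin (n + 1) → ℤ) :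
    (shear n l).1 v = v + (l.toAdd ⬝ᵥ Fin.tail v) • e0 n := rfl

theorem exists_shear {n : ℕ} (φ : MulAction.stabilizer (AutZ (n + 1)) (e0 n))
    (h : stabQuot n φ = 1) : ∃ l, shear n l = φ := by
  refine ⟨Multiplicative.ofAdd fun i => φ.1 (Pi.single i.succ 1) 0, ?_⟩
  refine Subtype.ext (LinearEquiv.ext fun v => ?_)
  have h1 : ∀ w : Fin n → ℤ, φ.1 (Fin.cons 0 w) 0 = (fun i => φ.1 (Pi.single i.succ 1) 0) ⬝ᵥ w := by
    intro w
    have hw : (Fin.cons 0 w : Fin (n + 1) → ℤ) = ∑ i, w i • Pi.single i.succ 1 := by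
      ext k
      refine Fin.cases ?_ (fun k => ?_) k
      · simp
      · simp [Pi.single_apply]
    rw [hw, map_sum, Finset.sum_apply, dotProduct]
    exact Finset.sum_congr rfl fun i _ => by rw [map_smul]; simp [mul_comm]
  rw [shear_apply]
  conv_rhs => rw [eq_smul_e0_add v, map_add, map_smul, mem_stab]
  ext k
  refine Fin.cases ?_ (fun k => ?_) k
  · have := h1 (Fin.tail v)
    simp [e0, this]
  · have := congrFun (LinearEquiv.congr_fun h (Fin.tail v)) k
    rw [stabQuot_apply] at this
    have this : φ.1 (Fin.cons 0 (Fin.tail v)) k.succ = v k.succ := this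
    simp [e0, this]

theorem stab_isFinitelyPresented (n : ℕ) [IsFinitelyPresented (AutZ n)] :
    IsFinitelyPresented (MulAction.stabilizer (AutZ (n + 1)) (e0 n)) := by
  have hk : ∀ l, shear n l ∈ (stabQuot n).ker := by
    intro l
    rw [MonoidHom.mem_ker]
    refine LinearEquiv.ext fun w => ?_
    rw [stabQuot_apply, shear_apply, tail_add, tail_smul, tail_e0, smul_zero, add_zero]
    rfl
  let f : Multiplicative (Fin n → ℤ) →* (stabQuot n).ker := (shear n).codRestrict _ hk
  have hf : Function.Bijective f := by
    refine ⟨fun l l' h => ?_, fun φ => ?_⟩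
    · refine Multiplicative.toAdd.injective (funext fun i => ?_)
      have h1 : (shear n l).1 = (shear n l').1 := congrArg (fun q => q.1.1) h
      have := congrFun (LinearEquiv.congr_fun h1 (Pi.single i.succ 1)) 0
      have ht : Fin.tail (Pi.single i.succ 1 : Fin (n + 1) → ℤ) = Pi.single i 1 := by
        ext k; simp [Fin.tail, Pi.single_apply]
      rw [shear_apply, shear_apply, ht] at this
      simpa [e0] using this
    · obtain ⟨l, hl⟩ := exists_shear φ.1 φ.2
      exact ⟨l, Subtype.ext hl⟩
  have := fin_int n
  have := equiv (MulEquiv.ofBijective f hf)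
  exact of_extension (stabQuot n) fun ψ => ⟨_, stabQuot_extend ψ⟩

theorem extend_elem {n : ℕ} (i j : Fin n) (h : i ≠ j) (c : ℤˣ) :
    extend n (elem i j h c) = elem i.succ j.succ (by simpa using h) c := by
  refine LinearEquiv.ext fun v => funext fun k => ?_
  rw [extend_apply, elem_apply]
  refine Fin.cases ?_ (fun k => ?_) k
  · simp [(Fin.succ_ne_zero i).symm]
  · simp [elem_apply, Fin.tail]

theorem extend_signedPerm {n : ℕ} (σ : Equiv.Perm (Fin n)) (ε : Fin n → ℤˣ) :
    extend n (signedPerm σ ε) ∈ gens (Fin (n + 1)) := by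
  have : extend n (signedPerm σ ε) =
      signedPerm (Equiv.Perm.decomposeFin.symm (0, σ)) (Fin.cons 1 ε) := by
    refine LinearEquiv.ext fun v => funext fun k => ?_
    rw [extend_apply, signedPerm_apply]
    refine Fin.cases ?_ (fun k => ?_) k
    · simp
    · simp [signedPerm_apply, Fin.tail]
  rw [this]
  exact signedPerm_mem _ _

theorem shear_mem_closure {n : ℕ} (l : Multiplicative (Fin n → ℤ)) :
    (shear n l).1 ∈ Subgroup.closure (gens (Fin (n + 1))) := by
  have hbasis : ∀ i : Fin n, (shear n (Multiplicative.ofAdd (Pi.single i 1))).1 =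
      elem 0 i.succ (Fin.succ_ne_zero i).symm 1 := by
    intro i
    refine LinearEquiv.ext fun v => funext fun k => ?_
    rw [shear_apply, elem_apply]
    refine Fin.cases ?_ (fun k => ?_) k
    · simp [e0, Fin.tail]
    · simp [e0]
  have hl : l = ∏ i, (Multiplicative.ofAdd (Pi.single i 1 : Fin n → ℤ)) ^ (l.toAdd i) := by
    apply Multiplicative.toAdd.injective
    rw [toAdd_prod]
    ext k
    simp [Pi.single_apply]
  have hT : ∀ l', l' ∈ ((Subgroup.closure (gens (Fin (n + 1)))).subgroupOf
      (MulAction.stabilizer (AutZ (n + 1)) (e0 n))).comap (shear n) ↔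
      (shear n l').1 ∈ Subgroup.closure (gens (Fin (n + 1))) := fun _ => Iff.rfl
  rw [← hT, hl]
  refine Subgroup.prod_mem _ fun i _ => Subgroup.zpow_mem _ ?_ _
  rw [hT, hbasis]
  exact Subgroup.subset_closure (elem_mem _ _ _ _)

/-- The Euclidean algorithm: generators move a vector of the orbit of the first basis vector back to
it. -/
theorem exists_smul_eq_e0 {n : ℕ} (g : AutZ (n + 1)) :
    ∃ t ∈ Subgroup.closure (gens (Fin (n + 1))), (t * g) (e0 n) = e0 n := by
  induction hL : norm1 (g (e0 n)) using Nat.strong_induction_on generalizing g with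
  | _ L ih =>
  by_cases hij : ∃ i j, i ≠ j ∧ g (e0 n) i ≠ 0 ∧ g (e0 n) j ≠ 0
  · obtain ⟨i, j, hij, hi, hj⟩ := hij
    wlog hle : (g (e0 n) j).natAbs ≤ (g (e0 n) i).natAbs generalizing i j
    · exact this j i hij.symm hj hi (by omega)
    obtain ⟨c, hc⟩ : ∃ c : ℤˣ, (g (e0 n) i + c * g (e0 n) j).natAbs < (g (e0 n) i).natAbs := by
      by_cases h : (g (e0 n) i + g (e0 n) j).natAbs < (g (e0 n) i).natAbs
      · exact ⟨1, by simpa using h⟩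
      · refine ⟨-1, ?_⟩
        simp only [Units.val_neg, Units.val_one, neg_mul, one_mul]
        omega
    have h1 := norm1_elem i j hij c (g (e0 n))
    obtain ⟨t, ht, h⟩ := ih (norm1 ((elem i j hij c * g) (e0 n)))
      (by rw [LinearEquiv.mul_apply]; change norm1 (elem i j hij c • g (e0 n)) < L; omega) _ rfl
    exact ⟨t * elem i j hij c, mul_mem ht (Subgroup.subset_closure (elem_mem _ _ _ _)), by
      rw [mul_assoc]; exact h⟩
  · push Not at hij
    have hne : g (e0 n) ≠ 0 := by
      intro h
      have h2 : e0 n = 0 := g.injective (by rw [h, map_zero])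
      have := congrFun h2 0
      simp [e0] at this
    obtain ⟨i, hi⟩ := Function.ne_iff.1 hne
    have hg : g (e0 n) = g (e0 n) i • Pi.single i 1 := by
      ext k
      by_cases hk : k = i
      · subst hk; simp
      · have := hij i k (Ne.symm hk) hi
        simp [this, hk]
    have hu : IsUnit (g (e0 n) i) := by
      have h2 : e0 n = g (e0 n) i • g.symm (Pi.single i 1) := by
        rw [← map_smul, ← hg, LinearEquiv.symm_apply_apply]
      have := congrFun h2 0
      refine IsUnit.of_mul_eq_one (g.symm (Pi.single i 1) 0) ?_
      simpa [e0] using this.symm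
    obtain ⟨u, hu⟩ := hu
    refine ⟨signedPerm (Equiv.swap 0 i) fun _ => u, Subgroup.subset_closure (signedPerm_mem _ _), ?_⟩
    rw [LinearEquiv.mul_apply, hg, ← hu]
    ext k
    rw [signedPerm_apply]
    have huu : (u : ℤ) * u = 1 := by rw [← Units.val_mul, Int.units_mul_self]; rfl
    by_cases hk : k = 0
    · subst hk; simp [e0, huu]
    · have : (Equiv.swap 0 i) k ≠ i := by
        intro h
        rw [← Equiv.swap_apply_left 0 i] at h
        exact hk ((Equiv.swap 0 i).injective h)
      simp [e0, hk, this]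

theorem closure_gens (n : ℕ) : Subgroup.closure (gens (Fin n)) = ⊤ := by
  induction n with
  | zero =>
    rw [eq_top_iff]
    intro g _
    rw [show g = 1 from LinearEquiv.ext fun v => Subsingleton.elim _ _]
    exact one_mem _
  | succ n ih =>
    rw [eq_top_iff]
    intro g _
    obtain ⟨t, ht, h⟩ := exists_smul_eq_e0 g
    rw [← Subgroup.mul_mem_cancel_left _ ht]
    let φ : MulAction.stabilizer (AutZ (n + 1)) (e0 n) := ⟨t * g, h⟩
    let χ : MulAction.stabilizer (AutZ (n + 1)) (e0 n) := ⟨_, extend_mem (stabQuot n φ)⟩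
    have hχ : χ.1 ∈ Subgroup.closure (gens (Fin (n + 1))) := by
      have hle : Subgroup.closure (gens (Fin n)) ≤
          (Subgroup.closure (gens (Fin (n + 1)))).comap (extend n) := by
        rw [Subgroup.closure_le]
        rintro s (⟨q, rfl⟩ | ⟨q, rfl⟩)
        · refine Subgroup.subset_closure ?_
          dsimp only
          rw [extend_elem]; exact elem_mem _ _ _ _
        · exact Subgroup.subset_closure (extend_signedPerm _ _)
      rw [ih] at hle
      exact hle (Subgroup.mem_top (stabQuot n φ))
    obtain ⟨l, hl⟩ := exists_shear (φ * χ⁻¹) (by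
      rw [map_mul, map_inv, show stabQuot n χ = stabQuot n φ from rfl, mul_inv_cancel])
    have hmem := shear_mem_closure l
    rw [hl] at hmem
    exact (Subgroup.mul_mem_cancel_right _ (inv_mem hχ)).1 hmem

theorem autZ_isFinitelyPresented (n : ℕ) : IsFinitelyPresented (AutZ n) := by
  induction n with
  | zero =>
    have : Subsingleton (AutZ 0) := ⟨fun g h => LinearEquiv.ext fun v => Subsingleton.elim _ _⟩
    infer_instance
  | succ n ih =>
    have := stab_isFinitelyPresented n
    have hL0 : norm1 (e0 n) = 1 := by
      simp [norm1, e0, Fin.sum_univ_succ]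
    refine of_peak_reduction (e0 n) norm1 (gens _) (ball _) gens_finite
      (gens_finite.image2 _ gens_finite) gens_subset_ball one_mem_gens inv_mem_gens
      (closure_gens _) ?_ ?_ fun g s hs t ht h1 h2 => isPeakReduced_gens _ s t hs ht h1 h2
    · intro g
      rw [hL0, Nat.one_le_iff_ne_zero]
      intro h
      have h1 : g (e0 n) = 0 := by
        ext k
        have := (Finset.sum_eq_zero_iff.1 h) k (Finset.mem_univ k)
        exact Int.natAbs_eq_zero.1 this
      have h2 : e0 n = 0 := g.injective (by rw [h1, map_zero])
      have := congrFun h2 0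
      simp [e0] at this
    · refine (Set.finite_Icc (-1 : Fin (n + 1) → ℤ) 1).subset ?_
      rintro v ⟨-, -, hv⟩
      rw [hL0] at hv
      have hle : ∀ k, (v k).natAbs ≤ 1 := fun k => by
        rw [← hv]
        exact Finset.single_le_sum (f := fun k => (v k).natAbs) (fun _ _ => Nat.zero_le _)
          (Finset.mem_univ k)
      exact ⟨fun k => by have := hle k; simp; omega, fun k => by have := hle k; simp; omega⟩

theorem gl_isFinitelyPresented (n : ℕ) : IsFinitelyPresented (Matrix.GeneralLinearGroup (Fin n) ℤ) := by
  have := autZ_isFinitelyPresented n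
  exact equiv ((Matrix.GeneralLinearGroup.toLin.trans
    (LinearMap.GeneralLinearGroup.generalLinearEquiv ℤ (Fin n → ℤ))).symm)

end IntVector

/-! ### Whitehead automorphisms of a free group -/

namespace Whitehead

variable {α : Type*} [Fintype α] [DecidableEq α]

/-- The inverse of a letter; the letter `(i, true)` is the free generator `i` and `(i, false)` is its
inverse. -/
def bar (y : α × Bool) : α × Bool := (y.1, !y.2)

@[simp] theorem bar_bar (y : α × Bool) : bar (bar y) = y := by simp [bar]

@[simp] theorem bar_inj {y z : α × Bool} : bar y = bar z ↔ y = z :=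
  ⟨fun h => by rw [← bar_bar y, h, bar_bar], fun h => by rw [h]⟩

theorem bar_eq_iff {y z : α × Bool} : bar y = z ↔ y = bar z :=
  ⟨fun h => by rw [← h, bar_bar], fun h => by rw [h, bar_bar]⟩

@[simp] theorem bar_ne_self (y : α × Bool) : bar y ≠ y := by
  rcases y with ⟨i, _ | _⟩ <;> simp [bar]

@[simp] theorem self_ne_bar (y : α × Bool) : y ≠ bar y := (bar_ne_self y).symm

/-- A letter as an element of the free group. -/
def letter (y : α × Bool) : FreeGroup α := FreeGroup.mk [y]

@[simp] theorem letter_bar (y : α × Bool) : letter (bar y) = (letter y)⁻¹ := by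
  simp [letter, bar, FreeGroup.inv_mk, FreeGroup.invRev]

theorem letter_true (i : α) : letter (i, true) = FreeGroup.of i := rfl

@[simp] theorem norm_letter (y : α × Bool) : (letter y).norm = 1 := by
  rcases y with ⟨i, _ | _⟩
  · rw [show (i, false) = bar (i, true) from rfl, letter_bar, FreeGroup.norm_inv_eq, letter_true,
      FreeGroup.norm_of]
  · rw [letter_true, FreeGroup.norm_of]

theorem mk_cons (y : α × Bool) (l : List (α × Bool)) :
    FreeGroup.mk (y :: l) = letter y * FreeGroup.mk l := by
  simp [letter]

theorem letter_injective : Function.Injective (letter : α × Bool → FreeGroup α) := by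
  intro y z h
  have h1 := congrArg FreeGroup.toWord h
  simpa [letter, FreeGroup.toWord_mk] using h1

theorem mulAut_ext {φ ψ : MulAut (FreeGroup α)} (h : ∀ y, φ (letter y) = ψ (letter y)) : φ = ψ := by
  have : φ.toMonoidHom = ψ.toMonoidHom := by
    ext i; exact h (i, true)
  exact MulEquiv.ext fun w => DFunLike.congr_fun this w

/-- The letter `a` if `y` lies in `A`, and `1` otherwise. -/
def ins (A : Finset (α × Bool)) (a y : α × Bool) : FreeGroup α := if y ∈ A then letter a else 1

/-- The image of a letter under a Whitehead automorphism. -/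
def img (A : Finset (α × Bool)) (a y : α × Bool) : FreeGroup α :=
  if y = a then letter a else if y = bar a then (letter a)⁻¹ else
    (ins A a (bar y))⁻¹ * letter y * ins A a y

theorem img_bar (A : Finset (α × Bool)) (a y : α × Bool) : img A a (bar y) = (img A a y)⁻¹ := by
  by_cases h1 : y = a
  · subst h1; simp [img]
  · by_cases h2 : y = bar a
    · subst h2; simp [img]
    · have h3 : bar y ≠ a := fun h => h2 (bar_eq_iff.1 h)
      simp [img, h1, h2, h3, mul_assoc]

/-- The endomorphism with letter `a` and set `A`, which is an automorphism if `A` contains `a` and not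
its inverse. -/
def whHom (A : Finset (α × Bool)) (a : α × Bool) : FreeGroup α →* FreeGroup α :=
  FreeGroup.lift fun i => img A a (i, true)

theorem whHom_letter (A : Finset (α × Bool)) (a y : α × Bool) :
    whHom A a (letter y) = img A a y := by
  rcases y with ⟨i, _ | _⟩
  · rw [show (i, false) = bar (i, true) from rfl, letter_bar, map_inv, img_bar, letter_true, whHom,
      FreeGroup.lift_apply_of]
  · rw [letter_true, whHom, FreeGroup.lift_apply_of]

/-- `a ∈ A` and `a⁻¹ ∉ A`. -/
def Valid (A : Finset (α × Bool)) (a : α × Bool) : Prop := a ∈ A ∧ bar a ∉ A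

/-- The set belonging to the inverse of a Whitehead automorphism. -/
def flip (A : Finset (α × Bool)) (a : α × Bool) : Finset (α × Bool) := insert (bar a) (A.erase a)

theorem Valid.flip {A : Finset (α × Bool)} {a : α × Bool} (_h : Valid A a) :
    Valid (flip A a) (bar a) := by
  simp [Valid, Whitehead.flip]

theorem flip_flip {A : Finset (α × Bool)} {a : α × Bool} (h : Valid A a) :
    flip (flip A a) (bar a) = A := by
  ext y
  by_cases h1 : y = a
  · subst h1; simp [flip, h.1]
  · by_cases h2 : y = bar a
    · subst h2; simp [flip, h.2]
    · simp [flip, h1, h2]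

theorem whHom_flip {A : Finset (α × Bool)} {a : α × Bool} (w : FreeGroup α) :
    whHom (flip A a) (bar a) (whHom A a w) = w := by
  have : (whHom (flip A a) (bar a)).comp (whHom A a) = MonoidHom.id _ := by
    ext i
    show whHom (flip A a) (bar a) (whHom A a (letter (i, true))) = letter (i, true)
    generalize (i, true) = y
    have ha : whHom (flip A a) (bar a) (letter a) = letter a := by simp [whHom_letter, img]
    by_cases h1 : y = a
    · subst h1; simp [whHom_letter, img]
    · by_cases h2 : y = bar a
      · subst h2; simp [whHom_letter, img]
      · have h3 : bar y ≠ a := fun h => h2 (bar_eq_iff.1 h)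
        rw [whHom_letter]
        simp only [img, h1, h2, if_false, map_mul, map_inv, whHom_letter]
        have h6 : y ∈ flip A a ↔ y ∈ A := by simp [flip, h1, h2]
        have h7 : bar y ∈ flip A a ↔ bar y ∈ A := by simp [flip, h1, h3]
        by_cases h4 : y ∈ A <;> by_cases h5 : bar y ∈ A <;>
          simp [ins, h4, h5, h6, h7, ha, h1, mul_assoc]
  exact DFunLike.congr_fun this w

/-- The Whitehead automorphism with letter `a` and set `A`: it sends a letter `y` different from
`a` and `a⁻¹` to `y`, multiplied on the right by `a` if `y ∈ A` and on the left by `a⁻¹` if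
`y⁻¹ ∈ A`, and fixes `a`. -/
def wh (A : Finset (α × Bool)) (a : α × Bool) (h : Valid A a) : MulAut (FreeGroup α) where
  toFun := whHom A a
  invFun := whHom (flip A a) (bar a)
  left_inv w := whHom_flip w
  right_inv w := by
    have := whHom_flip (A := flip A a) (a := bar a) w
    rwa [flip_flip h, bar_bar] at this
  map_mul' := map_mul _

theorem wh_letter {A : Finset (α × Bool)} {a : α × Bool} (h : Valid A a) (y : α × Bool) :
    wh A a h (letter y) = img A a y := whHom_letter A a y

@[simp] theorem wh_self {A : Finset (α × Bool)} {a : α × Bool} (h : Valid A a) :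
    wh A a h (letter a) = letter a := by simp [wh_letter, img]

theorem wh_of_ne {A : Finset (α × Bool)} {a : α × Bool} (h : Valid A a) {y : α × Bool} (h1 : y ≠ a)
    (h2 : y ≠ bar a) :
    wh A a h (letter y) = (ins A a (bar y))⁻¹ * letter y * ins A a y := by
  simp [wh_letter, img, h1, h2]

theorem wh_inv {A : Finset (α × Bool)} {a : α × Bool} (h : Valid A a) :
    (wh A a h)⁻¹ = wh (flip A a) (bar a) h.flip := by
  ext1 w; rfl

/-! ### The effect of Whitehead automorphisms on lengths -/

/-- The sum of `f` over the gaps of a word: a word `y₁ ⋯ yₖ` has the gaps `(u, y₁⁻¹)`,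
`(yᵢ, yᵢ₊₁⁻¹)` and `(yₖ, none)`. With `u = none`, these are the edges of the Whitehead graph of the
word, where `none` stands for the base point. -/
def gapAux (f : Option (α × Bool) → Option (α × Bool) → ℕ) :
    Option (α × Bool) → List (α × Bool) → ℕ
  | u, [] => f u none
  | u, y :: l => f u (some (bar y)) + gapAux f (some y) l

theorem gapAux_mono {f g : Option (α × Bool) → Option (α × Bool) → ℕ} (h : ∀ u v, f u v ≤ g u v)
    (u : Option (α × Bool)) (l : List (α × Bool)) : gapAux f u l ≤ gapAux g u l := by
  induction l generalizing u with
  | nil => exact h _ _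
  | cons y l ih => exact Nat.add_le_add (h _ _) (ih _)

theorem gapAux_add (f g : Option (α × Bool) → Option (α × Bool) → ℕ) (u : Option (α × Bool))
    (l : List (α × Bool)) : gapAux (fun u v => f u v + g u v) u l = gapAux f u l + gapAux g u l := by
  induction l generalizing u with
  | nil => rfl
  | cons y l ih => simp only [gapAux, ih]; omega

/-- Membership in a set of letters, to which the base point never belongs. -/
def memOpt (A : Finset (α × Bool)) : Option (α × Bool) → Prop
  | none => False
  | some y => y ∈ A

instance (A : Finset (α × Bool)) : DecidablePred (memOpt A) := fun u =>
  match u with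
  | none => inferInstanceAs (Decidable False)
  | some y => inferInstanceAs (Decidable (y ∈ A))

@[simp] theorem memOpt_none (A : Finset (α × Bool)) : ¬ memOpt A none := id

@[simp] theorem memOpt_some (A : Finset (α × Bool)) (y : α × Bool) : memOpt A (some y) ↔ y ∈ A :=
  Iff.rfl

/-- Whether the edge `(u, v)` of the Whitehead graph crosses the cut `A`. -/
def cut (A : Finset (α × Bool)) (u v : Option (α × Bool)) : ℕ :=
  if memOpt A u ↔ memOpt A v then 0 else 1

/-- If an endomorphism inserts `g y` after and `(g y⁻¹)⁻¹` before each letter `y`, which it replaces by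
`c y`, then the length of the image of a word is at most a sum over its gaps and its letters. -/
theorem norm_map_le (φ : MulAut (FreeGroup α)) (g : Option (α × Bool) → FreeGroup α)
    (hg : g none = 1) (c : α × Bool → FreeGroup α)
    (hφ : ∀ y, φ (letter y) = (g (some (bar y)))⁻¹ * c y * g (some y)) (u : Option (α × Bool))
    (l : List (α × Bool)) : (g u * φ (FreeGroup.mk l)).norm ≤
      gapAux (fun u v => (g u * (g v)⁻¹).norm) u l + (l.map fun y => (c y).norm).sum := by
  induction l generalizing u with
  | nil => simp [gapAux, hg, ← FreeGroup.one_eq_mk]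
  | cons y l ih =>
    have h1 : g u * φ (FreeGroup.mk (y :: l)) =
        (g u * (g (some (bar y)))⁻¹) * (c y * (g (some y) * φ (FreeGroup.mk l))) := by
      rw [mk_cons, map_mul, hφ]; simp only [mul_assoc]
    rw [h1]
    have h2 := FreeGroup.norm_mul_le (g u * (g (some (bar y)))⁻¹)
      (c y * (g (some y) * φ (FreeGroup.mk l)))
    have h3 := FreeGroup.norm_mul_le (c y) (g (some y) * φ (FreeGroup.mk l))
    have h4 := ih (some y)
    simp only [gapAux, List.map_cons, List.sum_cons]
    omega

/-- The letters different from `a` and `a⁻¹`, the other ones being deleted. -/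
def hat (a y : α × Bool) : List (α × Bool) := if y = a ∨ y = bar a then [] else [y]

/-- The letter inserted in the gap `(u, v)`. -/
def gap (A : Finset (α × Bool)) (a : α × Bool) (u v : Option (α × Bool)) : List (α × Bool) :=
  if memOpt A u then (if memOpt A v then [] else [a]) else (if memOpt A v then [bar a] else [])

/-- The image of a reduced word under a Whitehead automorphism, as a reduced word. -/
def out (A : Finset (α × Bool)) (a : α × Bool) : Option (α × Bool) → List (α × Bool) →
    List (α × Bool)
  | u, [] => gap A a u none
  | u, y :: l => gap A a u (some (bar y)) ++ (hat a y ++ out A a (some y) l)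

theorem mk_gap (A : Finset (α × Bool)) (a : α × Bool) (u v : Option (α × Bool)) :
    FreeGroup.mk (gap A a u v) = (if memOpt A u then letter a else 1) *
      (if memOpt A v then letter a else 1)⁻¹ := by
  have h1 : (FreeGroup.mk [] : FreeGroup α) = 1 := FreeGroup.one_eq_mk.symm
  have h2 : FreeGroup.mk [bar a] = (letter a)⁻¹ := letter_bar a
  have h3 : FreeGroup.mk [a] = letter a := rfl
  by_cases hu : memOpt A u <;> by_cases hv : memOpt A v <;>
    simp [gap, hu, hv, h2, h3, -FreeGroup.inv_mk, h1]

theorem mk_out {A : Finset (α × Bool)} {a : α × Bool} (h : Valid A a) (u : Option (α × Bool))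
    (l : List (α × Bool)) : FreeGroup.mk (out A a u l) =
      (if memOpt A u then letter a else 1) * wh A a h (FreeGroup.mk l) := by
  induction l generalizing u with
  | nil => simp [out, mk_gap, ← FreeGroup.one_eq_mk]
  | cons y l ih =>
    have h1 : wh A a h (letter y) = (ins A a (bar y))⁻¹ * FreeGroup.mk (hat a y) * ins A a y := by
      by_cases h1 : y = a
      · subst h1; simp [hat, ins, h.1, h.2, ← FreeGroup.one_eq_mk]
      · by_cases h2 : y = bar a
        · subst h2; simp [hat, ins, h.1, h.2, ← FreeGroup.one_eq_mk]
        · rw [wh_of_ne h h1 h2]; simp [hat, h1, h2, letter]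
    rw [out, ← FreeGroup.mul_mk, ← FreeGroup.mul_mk, mk_gap, ih, mk_cons, map_mul, h1]
    simp only [ins, memOpt_some, mul_assoc]

theorem isReduced_cons {y : α × Bool} {l : List (α × Bool)} :
    FreeGroup.IsReduced (y :: l) ↔ l.head? ≠ some (bar y) ∧ FreeGroup.IsReduced l := by
  cases l with
  | nil => simp
  | cons z l =>
    rw [FreeGroup.isReduced_cons_cons]
    have : (y.1 = z.1 → y.2 = z.2) ↔ z ≠ bar y := by
      rcases y with ⟨i, _ | _⟩ <;> rcases z with ⟨j, _ | _⟩ <;> simp [bar, eq_comm]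
    simp [this]

/-- The conditions on the first letter `h` of `out A a (some u) l` which make it possible to prove
inductively that this word is reduced. -/
def HeadOK (A : Finset (α × Bool)) (a u h : α × Bool) : Prop :=
  if u = a then h ≠ bar a ∧ (h = a ∨ bar h ∈ A)
  else if u = bar a then h ≠ a ∧ (h = bar a ∨ bar h ∉ A) else h ≠ bar u

theorem out_isReduced {A : Finset (α × Bool)} {a : α × Bool} (hA : Valid A a) (l : List (α × Bool)) :
    ∀ u, FreeGroup.IsReduced (u :: l) → FreeGroup.IsReduced (out A a (some u) l) ∧
      ∀ h, (out A a (some u) l).head? = some h → HeadOK A a u h := by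
  obtain ⟨ha, ha'⟩ := hA
  have haa := bar_ne_self a
  induction l with
  | nil =>
    intro u _
    by_cases hu : u ∈ A
    · simp only [out, gap, memOpt_some, memOpt_none, hu, if_true, if_false]
      refine ⟨FreeGroup.IsReduced.singleton, fun h hh => ?_⟩
      simp only [List.head?_cons, Option.some.injEq] at hh
      subst hh
      unfold HeadOK
      grind [bar_bar]
    · simp [out, gap, hu]
  | cons y l ih =>
    intro u hr
    rw [isReduced_cons] at hr
    obtain ⟨hyu, hr⟩ := hr
    have hyu : y ≠ bar u := by simpa using hyu
    obtain ⟨ho, hh⟩ := ih y hr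
    have hout : out A a (some u) (y :: l) =
      gap A a (some u) (some (bar y)) ++ (hat a y ++ out A a (some y) l) := rfl
    rw [hout]
    generalize out A a (some y) l = o at ho hh
    unfold HeadOK at hh ⊢
    have hb : ∀ z : α × Bool, bar (bar z) = z := bar_bar
    by_cases hu : u ∈ A <;> by_cases hv : bar y ∈ A <;>
      simp only [gap, memOpt_some, hu, hv, if_true, if_false, hat, List.nil_append,
        List.cons_append, isReduced_cons, List.head?_cons]
    all_goals
      by_cases hy : y = a ∨ y = bar a
      · simp only [hy, if_true, List.nil_append]
        cases ho' : o.head? with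
        | none => grind
        | some h =>
          have := hh h ho'
          grind
      · simp only [hy, if_false, List.cons_append, List.nil_append, isReduced_cons, List.head?_cons]
        cases ho' : o.head? with
        | none => grind
        | some h =>
          have := hh h ho'
          grind

theorem cut_length (A : Finset (α × Bool)) (a : α × Bool) (u v : Option (α × Bool)) :
    (gap A a u v).length = cut A u v := by
  by_cases hu : memOpt A u <;> by_cases hv : memOpt A v <;> simp [gap, cut, hu, hv]

theorem out_length (A : Finset (α × Bool)) (a : α × Bool) (u : Option (α × Bool))
    (l : List (α × Bool)) : (out A a u l).length + l.countP (fun y => y = a ∨ y = bar a) =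
      l.length + gapAux (cut A) u l := by
  induction l generalizing u with
  | nil => simp [out, gapAux, cut_length]
  | cons y l ih =>
    have := ih (some y)
    simp only [out, List.length_append, cut_length, List.countP_cons, List.length_cons, gapAux]
    by_cases hy : y = a ∨ y = bar a <;> simp [hat, hy, -Bool.decide_or] <;> omega

end Whitehead

namespace Whitehead

variable {α : Type*} [Fintype α] [DecidableEq α]

theorem out_none_isReduced {A : Finset (α × Bool)} {a : α × Bool} (hA : Valid A a)
    (l : List (α × Bool)) (hl : FreeGroup.IsReduced l) : FreeGroup.IsReduced (out A a none l) := by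
  cases l with
  | nil => simp [out, gap]
  | cons y l =>
    obtain ⟨ho, hh⟩ := out_isReduced hA l y hl
    obtain ⟨ha, ha'⟩ := hA
    have haa := bar_ne_self a
    have hout : out A a none (y :: l) =
      gap A a none (some (bar y)) ++ (hat a y ++ out A a (some y) l) := rfl
    rw [hout]
    generalize out A a (some y) l = o at ho hh
    unfold HeadOK at hh
    have hb : ∀ z : α × Bool, bar (bar z) = z := bar_bar
    by_cases hv : bar y ∈ A <;>
      simp only [gap, memOpt_some, memOpt_none, hv, if_true, if_false, hat, List.nil_append,
        List.cons_append, isReduced_cons]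
    all_goals
      by_cases hy : y = a ∨ y = bar a
      · simp only [hy, if_true, List.nil_append]
        cases ho' : o.head? with
        | none => grind
        | some h =>
          have := hh h ho'
          grind
      · simp only [hy, if_false, List.cons_append, List.nil_append, isReduced_cons, List.head?_cons]
        cases ho' : o.head? with
        | none => grind
        | some h =>
          have := hh h ho'
          grind

/-- The total length of a tuple of elements of a free group. -/
def len (x : α → FreeGroup α) : ℕ := ∑ i, (x i).norm

/-- The number of edges of the Whitehead graph of a tuple which cross the cut `A`. -/
def cuts (A : Finset (α × Bool)) (x : α → FreeGroup α) : ℕ :=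
  ∑ i, gapAux (cut A) none (x i).toWord

/-- The number of occurrences of `a` and `a⁻¹` in a tuple. -/
def cnt (a : α × Bool) (x : α → FreeGroup α) : ℕ :=
  ∑ i, (x i).toWord.countP fun y => y = a ∨ y = bar a

theorem cnt_bar (a : α × Bool) (x : α → FreeGroup α) : cnt (bar a) x = cnt a x := by
  simp only [cnt, bar_bar, or_comm]

theorem norm_wh {A : Finset (α × Bool)} {a : α × Bool} (h : Valid A a) (w : FreeGroup α) :
    (wh A a h w).norm + w.toWord.countP (fun y => y = a ∨ y = bar a) =
      w.norm + gapAux (cut A) none w.toWord := by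
  have h1 := mk_out h none w.toWord
  rw [FreeGroup.mk_toWord, if_neg (memOpt_none A), one_mul] at h1
  rw [← h1, FreeGroup.norm, FreeGroup.toWord_mk,
    (out_none_isReduced h _ FreeGroup.isReduced_toWord).reduce_eq, out_length]
  rfl

/-- Whitehead's formula: under the automorphism with set `A` and letter `a`, the length grows by the
number of edges crossing the cut `A`, diminished by the number of occurrences of `a` and `a⁻¹`. -/
theorem len_wh {A : Finset (α × Bool)} {a : α × Bool} (h : Valid A a) (x : α → FreeGroup α) :
    len (wh A a h • x) + cnt a x = len x + cuts A x := by
  simp only [len, cnt, cuts, ← Finset.sum_add_distrib]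
  exact Finset.sum_congr rfl fun i _ => norm_wh h (x i)

/-- Two sets of letters are nested if one contains the other or if they are disjoint. -/
def Nested (A B : Finset (α × Bool)) : Prop := A ⊆ B ∨ B ⊆ A ∨ Disjoint A B

/-- If the elements `b^[y ∈ B] a^[y ∈ A]` are inserted after the letters `y`, where the sets `A` and `B`
are nested, then the length of what appears in a gap of a word is at most the number of the two cuts
which the gap crosses. -/
theorem norm_label_le {A B : Finset (α × Bool)} (hAB : B ⊆ A ∨ Disjoint A B) (a b : α × Bool)
    (u v : Option (α × Bool)) :
    (((if memOpt B u then letter b else 1) * (if memOpt A u then letter a else 1)) *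
      ((if memOpt B v then letter b else 1) * (if memOpt A v then letter a else 1))⁻¹).norm ≤
      cut A u v + cut B u v := by
  have hB : ∀ w w', memOpt B w → memOpt B w' → (memOpt A w ↔ memOpt A w') := by
    rintro (_ | y) (_ | z) hy hz
    · exact Iff.rfl
    · exact hy.elim
    · exact hz.elim
    · simp only [memOpt_some] at *
      rcases hAB with h | h
      · exact iff_of_true (h hy) (h hz)
      · exact iff_of_false (Finset.disjoint_right.1 h hy) (Finset.disjoint_right.1 h hz)
  have h1 := hB u v
  have n2 : ∀ y z : α × Bool, (letter y * letter z).norm ≤ 2 := fun y z => by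
    simpa using FreeGroup.norm_mul_le (letter y) (letter z)
  have n2' : ∀ y z : α × Bool, (letter y * (letter z)⁻¹).norm ≤ 2 := fun y z => by
    rw [← letter_bar]; exact n2 _ _
  have n2'' : ∀ y z : α × Bool, ((letter y)⁻¹ * (letter z)⁻¹).norm ≤ 2 := fun y z => by
    rw [← letter_bar, ← letter_bar]; exact n2 _ _
  by_cases hu : memOpt A u <;> by_cases hv : memOpt A v <;> by_cases hu' : memOpt B u <;>
    by_cases hv' : memOpt B v <;> simp [cut, hu, hv, hu', hv', n2, n2', n2''] <;> simp_all

/-- An upper bound for the length after an automorphism composed of two Whitehead automorphisms with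
nested sets, which deletes the letters `a` and `b` and inserts `b^[y ∈ B] a^[y ∈ A]` after the letters
`y`: the changes of length under the two are at most added up. -/
theorem len_pair_le {A B : Finset (α × Bool)} (hAB : B ⊆ A ∨ Disjoint A B) {a b : α × Bool}
    (h1 : a ≠ b) (h2 : a ≠ bar b) (φ : MulAut (FreeGroup α))
    (hφ : ∀ y, φ (letter y) = (ins B b (bar y) * ins A a (bar y))⁻¹ *
      (if (y = a ∨ y = bar a) ∨ (y = b ∨ y = bar b) then 1 else letter y) *
      (ins B b y * ins A a y)) (x : α → FreeGroup α) :
    len (φ • x) + cnt a x + cnt b x ≤ len x + cuts A x + cuts B x := by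
  simp only [len, cnt, cuts, ← Finset.sum_add_distrib]
  refine Finset.sum_le_sum fun i _ => ?_
  show (φ (x i)).norm + _ + _ ≤ _
  have key := norm_map_le φ
    (fun u => (if memOpt B u then letter b else 1) * (if memOpt A u then letter a else 1)) (by simp)
    (fun y => if (y = a ∨ y = bar a) ∨ (y = b ∨ y = bar b) then 1 else letter y) hφ none (x i).toWord
  rw [FreeGroup.mk_toWord] at key
  simp only [memOpt_none, if_false, one_mul] at key
  have h3 := gapAux_mono (fun u v => norm_label_le hAB a b u v) none (x i).toWord
  rw [gapAux_add] at h3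
  have h4 : ∀ l : List (α × Bool), (l.map fun y =>
      (if (y = a ∨ y = bar a) ∨ (y = b ∨ y = bar b) then (1 : FreeGroup α) else letter y).norm).sum +
      l.countP (fun y => y = a ∨ y = bar a) + l.countP (fun y => y = b ∨ y = bar b) = l.length := by
    intro l
    induction l with
    | nil => rfl
    | cons y l ih =>
      simp only [List.map_cons, List.sum_cons, List.countP_cons, List.length_cons]
      by_cases hy : y = a ∨ y = bar a
      · have hy' : ¬ (y = b ∨ y = bar b) := by
          rintro (rfl | rfl) <;> rcases hy with hy | hy
          · exact h1 hy.symm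
          · exact h2 (bar_eq_iff.1 hy.symm)
          · exact h2 hy.symm
          · exact h1 (bar_inj.1 hy.symm)
        simp [hy, hy', -Bool.decide_or]; omega
      · by_cases hy' : y = b ∨ y = bar b
        · simp [hy, hy', -Bool.decide_or]; omega
        · simp [hy, hy', -Bool.decide_or]; omega
  have h5 := h4 (x i).toWord
  simp only [FreeGroup.norm] at key h5 h3 ⊢
  omega

theorem gapAux_submodular {f₁ f₂ g₁ g₂ : Option (α × Bool) → Option (α × Bool) → ℕ}
    (h : ∀ u v, f₁ u v + f₂ u v ≤ g₁ u v + g₂ u v) (l : List (α × Bool)) :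
    gapAux f₁ none l + gapAux f₂ none l ≤ gapAux g₁ none l + gapAux g₂ none l := by
  rw [← gapAux_add, ← gapAux_add]
  exact gapAux_mono h _ _

theorem cuts_inter_add_cuts_union (A B : Finset (α × Bool)) (x : α → FreeGroup α) :
    cuts (A ∩ B) x + cuts (A ∪ B) x ≤ cuts A x + cuts B x := by
  simp only [cuts, ← Finset.sum_add_distrib]
  refine Finset.sum_le_sum fun i _ => gapAux_submodular (fun u v => ?_) _
  have hi : ∀ u, memOpt (A ∩ B) u ↔ memOpt A u ∧ memOpt B u := by rintro (_ | y) <;> simp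
  have hu : ∀ u, memOpt (A ∪ B) u ↔ memOpt A u ∨ memOpt B u := by rintro (_ | y) <;> simp
  simp only [cut, hi, hu]
  by_cases hu : memOpt A u <;> by_cases hv : memOpt A v <;> by_cases hu' : memOpt B u <;>
    by_cases hv' : memOpt B v <;> simp [hu, hv, hu', hv']

theorem cuts_sdiff_add_cuts_sdiff (A B : Finset (α × Bool)) (x : α → FreeGroup α) :
    cuts (A \ B) x + cuts (B \ A) x ≤ cuts A x + cuts B x := by
  simp only [cuts, ← Finset.sum_add_distrib]
  refine Finset.sum_le_sum fun i _ => gapAux_submodular (fun u v => ?_) _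
  have hd : ∀ (A B : Finset (α × Bool)) u, memOpt (A \ B) u ↔ memOpt A u ∧ ¬ memOpt B u := by
    rintro A B (_ | y) <;> simp
  simp only [cut, hd]
  by_cases hu : memOpt A u <;> by_cases hv : memOpt A v <;> by_cases hu' : memOpt B u <;>
    by_cases hv' : memOpt B v <;> simp [hu, hv, hu', hv']

/-! ### The generators -/

variable (α) in
/-- The automorphisms that permute the letters. -/
def letterPerms : Subgroup (MulAut (FreeGroup α)) where
  carrier := {φ | ∃ f : Equiv.Perm (α × Bool), ∀ y, φ (letter y) = letter (f y)}
  one_mem' := ⟨1, fun _ => rfl⟩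
  mul_mem' := by
    rintro φ ψ ⟨f, hf⟩ ⟨g, hg⟩
    exact ⟨f * g, fun y => by rw [MulAut.mul_apply, hg, hf]; rfl⟩
  inv_mem' := by
    rintro φ ⟨f, hf⟩
    refine ⟨f⁻¹, fun y => ?_⟩
    rw [MulAut.inv_apply, MulEquiv.symm_apply_eq, hf]
    simp

theorem letterPerms_finite : (letterPerms α : Set (MulAut (FreeGroup α))).Finite := by
  have : ∀ φ : letterPerms α, ∃ f : Equiv.Perm (α × Bool), ∀ y, φ.1 (letter y) = letter (f y) :=
    fun φ => φ.2
  choose f hf using this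
  have : Finite (letterPerms α) := Finite.of_injective f fun φ ψ h => Subtype.ext <|
    mulAut_ext fun y => by rw [hf, hf, h]
  exact Set.toFinite _

theorem norm_letterPerm_le {φ : MulAut (FreeGroup α)} (h : φ ∈ letterPerms α) (w : FreeGroup α) :
    (φ w).norm ≤ w.norm := by
  obtain ⟨f, hf⟩ := h
  have key : ∀ l : List (α × Bool), φ (FreeGroup.mk l) = FreeGroup.mk (l.map f) := by
    intro l
    induction l with
    | nil => exact map_one φ
    | cons y l ih => rw [mk_cons, map_mul, ih, hf, List.map_cons, mk_cons]
  have h1 := key w.toWord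
  rw [FreeGroup.mk_toWord] at h1
  rw [h1]
  refine FreeGroup.norm_mk_le.trans ?_
  rw [List.length_map]; rfl

theorem len_letterPerm {φ : MulAut (FreeGroup α)} (h : φ ∈ letterPerms α) (x : α → FreeGroup α) :
    len (φ • x) = len x := by
  refine Finset.sum_congr rfl fun i _ => le_antisymm (norm_letterPerm_le h _) ?_
  have := norm_letterPerm_le (inv_mem h) (φ (x i))
  rwa [MulAut.inv_apply_self] at this

variable (α) in
/-- Whitehead automorphisms and permutations of the letters. -/
def gens : Set (MulAut (FreeGroup α)) :=
  (Set.range fun q : {q : Finset (α × Bool) × (α × Bool) // Valid q.1 q.2} => wh q.1.1 q.1.2 q.2) ∪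
    letterPerms α

theorem wh_mem {A : Finset (α × Bool)} {a : α × Bool} (h : Valid A a) : wh A a h ∈ gens α :=
  Or.inl ⟨⟨(A, a), h⟩, rfl⟩

theorem perm_mem {φ : MulAut (FreeGroup α)} (h : φ ∈ letterPerms α) : φ ∈ gens α := Or.inr h

theorem gens_finite : (gens α).Finite := (Set.finite_range _).union letterPerms_finite

theorem one_mem_gens : 1 ∈ gens α := perm_mem (one_mem _)

theorem inv_mem_gens (s : MulAut (FreeGroup α)) (hs : s ∈ gens α) : s⁻¹ ∈ gens α := by
  obtain ⟨q, rfl⟩ | h := hs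
  · rw [wh_inv]; exact wh_mem _
  · exact perm_mem (inv_mem h)

/-- The conjugate of a Whitehead automorphism by a permutation of the letters is a Whitehead
automorphism. -/
theorem conj_wh_mem {φ : MulAut (FreeGroup α)} (hφ : φ ∈ letterPerms α) {A : Finset (α × Bool)}
    {a : α × Bool} (h : Valid A a) : φ * wh A a h * φ⁻¹ ∈ gens α := by
  obtain ⟨f, hf⟩ := hφ
  have hbar : ∀ y, f (bar y) = bar (f y) := fun y => by
    apply letter_injective
    rw [← hf, letter_bar, letter_bar, map_inv, hf]
  have hv : Valid (A.map f.toEmbedding) (f a) := by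
    refine ⟨by simpa using h.1, ?_⟩
    rw [← hbar]; simpa using h.2
  have : φ * wh A a h * φ⁻¹ = wh (A.map f.toEmbedding) (f a) hv := by
    rw [mul_inv_eq_iff_eq_mul]
    refine mulAut_ext fun y => ?_
    rw [MulAut.mul_apply, MulAut.mul_apply, hf, wh_letter, wh_letter]
    by_cases h1 : y = a
    · simp [img, h1, hf]
    · by_cases h2 : y = bar a
      · simp [img, h2, hf, hbar]
      · have h3 : f y ≠ bar (f a) := by rw [← hbar]; exact f.injective.ne h2
        by_cases h4 : y ∈ A <;> by_cases h5 : bar y ∈ A <;>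
          simp [img, h1, h2, hf, ins, ← hbar, h4, h5]
  rw [this]
  exact wh_mem _

end Whitehead

/-! ### Peak reduction for Whitehead automorphisms -/

namespace Whitehead

open Group.IsFinitelyPresented

variable {α : Type*} [Fintype α] [DecidableEq α]

variable (α) in
/-- The products of two generators: all elements in which a peak is reduced. -/
def ball : Set (MulAut (FreeGroup α)) := Set.image2 (· * ·) (gens α) (gens α)

theorem gens_subset_ball : gens α ⊆ ball α := fun s hs => ⟨s, hs, 1, one_mem_gens, mul_one s⟩

local notation "Linked" => IsLinked len (gens α) (ball α)

theorem linked_of_square {s t s' t' : MulAut (FreeGroup α)} {x : α → FreeGroup α}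
    (hs : s ∈ gens α) (hs' : s' ∈ gens α) (ht' : t' ∈ gens α) (h : t' * s = s' * t)
    (hlt : len ((t' * s) • x) < len x) : Linked x s t := by
  refine .of_mid (t' * s) ⟨t', ht', s, hs, rfl⟩ hlt ?_ ?_
  · rw [mul_inv_rev, mul_inv_cancel_left]; exact inv_mem_gens _ ht'
  · rw [h, mul_inv_rev, mul_inv_cancel_left]; exact inv_mem_gens _ hs'

variable {A B : Finset (α × Bool)} {a b : α × Bool}

theorem mulAut_ext_of_letters {φ ψ : MulAut (FreeGroup α)} (a b : α × Bool)
    (ha : φ (letter a) = ψ (letter a)) (hb : φ (letter b) = ψ (letter b))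
    (h : ∀ y, y ≠ a → y ≠ bar a → y ≠ b → y ≠ bar b → bar y ≠ a → bar y ≠ b →
      φ (letter y) = ψ (letter y)) : φ = ψ := by
  refine mulAut_ext fun y => ?_
  by_cases k1 : y = a
  · exact k1 ▸ ha
  by_cases k2 : y = bar a
  · rw [k2, letter_bar, map_inv, map_inv, ha]
  by_cases k3 : y = b
  · exact k3 ▸ hb
  by_cases k4 : y = bar b
  · rw [k4, letter_bar, map_inv, map_inv, hb]
  exact h y k1 k2 k3 k4 (fun h => k2 (bar_eq_iff.1 h)) (fun h => k4 (bar_eq_iff.1 h))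

theorem wh_subset_mul (hA : Valid A a) (hB : Valid B a) (hBA : B ⊆ A)
    (hC : Valid (insert a (A \ B)) a) :
    wh A a hA = wh (insert a (A \ B)) a hC * wh B a hB := by
  refine mulAut_ext_of_letters a a (by simp) (by simp) fun y h1 h2 _ _ h3 _ => ?_
  · have k1 := @hBA y
    have k2 := @hBA (bar y)
    by_cases h4 : y ∈ A <;> by_cases h5 : bar y ∈ A <;> by_cases h6 : y ∈ B <;>
      by_cases h7 : bar y ∈ B <;>
      simp [wh_of_ne, h1, h2, h3, ins, h4, h5, h6, h7, mul_assoc] at k1 k2 ⊢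

theorem wh_union_mul (hA : Valid A a) (hB : Valid B (bar a)) (hAB : Disjoint A B)
    (hC : Valid (A ∪ B.erase (bar a)) a) :
    wh A a hA = wh (A ∪ B.erase (bar a)) a hC * wh B (bar a) hB := by
  refine mulAut_ext_of_letters a a (by simp [wh_letter, img]) (by simp [wh_letter, img])
    fun y h1 h2 _ _ h3 _ => ?_
  · have k1 := (fun h => Finset.disjoint_left.1 hAB h : y ∈ A → y ∉ B)
    have k2 := (fun h => Finset.disjoint_left.1 hAB h : bar y ∈ A → bar y ∉ B)
    by_cases h4 : y ∈ A <;> by_cases h5 : bar y ∈ A <;> by_cases h6 : y ∈ B <;>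
      by_cases h7 : bar y ∈ B <;>
      simp [wh_of_ne, h1, h2, h3, ins, h4, h5, h6, h7, mul_assoc] at k1 k2 ⊢

theorem mem_letterPerms_of_forall {φ : MulAut (FreeGroup α)} (h : ∀ y, ∃ z, φ (letter y) = letter z) :
    φ ∈ letterPerms α := by
  choose f hf using h
  have hinj : Function.Injective f := fun y z hyz => by
    have : φ (letter y) = φ (letter z) := by rw [hf, hf, hyz]
    exact letter_injective (φ.injective this)
  exact ⟨Equiv.ofBijective f (Finite.injective_iff_bijective.1 hinj), hf⟩

/-- Two Whitehead automorphisms with the same set and different letters differ by a Whitehead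
automorphism and a permutation of the letters. -/
theorem exists_wh_eq_perm_mul (hA : Valid A a) (hB : Valid A b) (hab : a ≠ b) :
    ∃ π ∈ letterPerms α, ∃ (C : Finset (α × Bool)) (hC : Valid C b),
      wh A b hB = π * (wh C b hC * wh A a hA) := by
  have hab' : a ≠ bar b := fun h => hB.2 (h ▸ hA.1)
  have hba' : b ≠ bar a := fun h => hA.2 (h ▸ hB.1)
  have hC : Valid (flip A a) b := by
    simp [Valid, flip, hba', hab.symm, hab, hB.1, hB.2]
  refine ⟨wh A b hB * (wh A a hA)⁻¹ * (wh (flip A a) b hC)⁻¹, ?_, flip A a, hC, by group⟩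
  have key : ∀ y, (wh A b hB * (wh A a hA)⁻¹ * (wh (flip A a) b hC)⁻¹) (letter y) =
      if y = a then letter b else if y = bar a then letter (bar b) else
      if y = b then letter (bar a) else if y = bar b then letter a else letter y := by
    have ha1 := hA.1
    have ha2 := hA.2
    have hb1 := hB.1
    have hb2 := hB.2
    have ea : (wh A b hB * (wh A a hA)⁻¹ * (wh (flip A a) b hC)⁻¹) (letter a) = letter b := by
      simp [wh_inv, wh_letter, img, ins, flip, hab, hab.symm, hab', hba', hab'.symm, hba'.symm,
        ha1, ha2, hb1, hb2]
    have eb : (wh A b hB * (wh A a hA)⁻¹ * (wh (flip A a) b hC)⁻¹) (letter b) = letter (bar a) := by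
      simp [wh_inv, wh_letter, img, ins, flip, hab, hab.symm, hab', hba', hab'.symm, hba'.symm,
        ha1, ha2, hb1, hb2]
    intro y
    split_ifs with k1 k2 k3 k4
    · rw [k1, ea]
    · rw [k2, letter_bar, map_inv, ea, letter_bar]
    · rw [k3, eb]
    · rw [k4, letter_bar, map_inv, eb, letter_bar, inv_inv]
    · have k5 : bar y ≠ a := fun h => k2 (bar_eq_iff.1 h)
      have k6 : bar y ≠ b := fun h => k4 (bar_eq_iff.1 h)
      by_cases h4 : y ∈ A <;> by_cases h5 : bar y ∈ A <;>
        simp [wh_inv, wh_letter, img, ins, flip, hab, hab.symm, hab', hba', hab'.symm, hba'.symm,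
          ha1, ha2, hb1, hb2, k1, k2, k3, k4, k5, k6, h4, h5, mul_assoc]
  refine mem_letterPerms_of_forall fun y => ?_
  rw [key]
  split_ifs <;> exact ⟨_, rfl⟩

/-- It suffices to check the form of an automorphism required in `len_pair_le` up to inversion of the
letters. -/
theorem label_of_letters {φ : MulAut (FreeGroup α)} (g : α × Bool → FreeGroup α) (a b : α × Bool)
    (ha : φ (letter a) = (g (bar a))⁻¹ * g a) (hb : φ (letter b) = (g (bar b))⁻¹ * g b)
    (h : ∀ y, y ≠ a → y ≠ bar a → y ≠ b → y ≠ bar b → bar y ≠ a → bar y ≠ b →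
      φ (letter y) = (g (bar y))⁻¹ * letter y * g y) (y : α × Bool) :
    φ (letter y) = (g (bar y))⁻¹ *
      (if (y = a ∨ y = bar a) ∨ (y = b ∨ y = bar b) then 1 else letter y) * g y := by
  by_cases k1 : y = a
  · subst k1; simp [ha]
  by_cases k2 : y = bar a
  · subst k2; simp [ha]
  by_cases k3 : y = b
  · subst k3; simp [hb]
  by_cases k4 : y = bar b
  · subst k4; simp [hb]
  rw [h y k1 k2 k3 k4 (fun h => k2 (bar_eq_iff.1 h)) (fun h => k4 (bar_eq_iff.1 h))]
  simp [k1, k2, k3, k4]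

/-- A square of Whitehead automorphisms with nested sets whose diagonal has the form required in
`len_pair_le` reduces the peak formed by two of its sides. -/
theorem linked_of_label (hA : Valid A a) (hB : Valid B b) (hAB : B ⊆ A ∨ Disjoint A B)
    (hab : a ≠ b) (hab' : a ≠ bar b) {x : α → FreeGroup α}
    (hx : cuts A x + cuts B x < cnt a x + cnt b x) {s' t' : MulAut (FreeGroup α)}
    (hs' : s' ∈ gens α) (ht' : t' ∈ gens α) (h : t' * wh A a hA = s' * wh B b hB)
    (hl : ∀ y, (t' * wh A a hA) (letter y) = (ins B b (bar y) * ins A a (bar y))⁻¹ *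
      (if (y = a ∨ y = bar a) ∨ (y = b ∨ y = bar b) then 1 else letter y) *
      (ins B b y * ins A a y)) : Linked x (wh A a hA) (wh B b hB) := by
  refine linked_of_square (wh_mem _) hs' ht' h ?_
  have := len_pair_le hAB hab hab' _ hl x
  omega

/-- Disjoint sets, neither of which contains the inverse of the letter of the other: the automorphisms
commute. -/
theorem linked_disjoint₁ (hA : Valid A a) (hB : Valid B b) (hAB : Disjoint A B)
    (ha : bar a ∉ B) (hb : bar b ∉ A) {x : α → FreeGroup α}
    (hx : cuts A x + cuts B x < cnt a x + cnt b x) : Linked x (wh A a hA) (wh B b hB) := by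
  have hab : a ≠ b := fun h => Finset.disjoint_left.1 hAB hA.1 (h ▸ hB.1)
  have hab' : a ≠ bar b := fun h => hb (h ▸ hA.1)
  have hba' : b ≠ bar a := fun h => ha (h ▸ hB.1)
  have h1 : a ∉ B := Finset.disjoint_left.1 hAB hA.1
  have h2 : b ∉ A := Finset.disjoint_right.1 hAB hB.1
  have ha1 := hA.1
  have ha2 := hA.2
  have hb1 := hB.1
  have hb2 := hB.2
  refine linked_of_label hA hB (Or.inr hAB) hab hab' hx (wh_mem hA) (wh_mem hB) ?_ ?_
  · refine mulAut_ext_of_letters a b ?_ ?_ fun y k1 k2 k3 k4 k5 k6 => ?_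
    · simp [wh_letter, img, ins, hab, hab.symm, hab', hba', ha, hb, h1, h2]
    · simp [wh_letter, img, ins, hab, hab.symm, hab', hba', ha, hb, h1, h2]
    · have e1 := (fun h => Finset.disjoint_left.1 hAB h : y ∈ A → y ∉ B)
      have e2 := (fun h => Finset.disjoint_left.1 hAB h : bar y ∈ A → bar y ∉ B)
      by_cases h4 : y ∈ A <;> by_cases h5 : bar y ∈ A <;> by_cases h6 : y ∈ B <;>
        by_cases h7 : bar y ∈ B <;>
        simp [wh_letter, img, k1, k2, k3, k4, ins, h4, h5, h6, h7, mul_assoc, hab, hab.symm, hab',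
          hba', ha, hb, h1, h2] at e1 e2 ⊢
  · refine label_of_letters (fun y => ins B b y * ins A a y) a b ?_ ?_ fun y k1 k2 k3 k4 k5 k6 => ?_
    · simp [wh_letter, img, ins, hab, hab.symm, hab', hba', ha, hb, h1, h2, ha1, ha2, hb1, hb2]
    · simp [wh_letter, img, ins, hab, hab.symm, hab', hba', ha, hb, h1, h2, ha1, ha2, hb1, hb2]
    · have e1 := (fun h => Finset.disjoint_left.1 hAB h : y ∈ A → y ∉ B)
      have e2 := (fun h => Finset.disjoint_left.1 hAB h : bar y ∈ A → bar y ∉ B)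
      by_cases h4 : y ∈ A <;> by_cases h5 : bar y ∈ A <;> by_cases h6 : y ∈ B <;>
        by_cases h7 : bar y ∈ B <;>
        simp [wh_letter, img, k1, k2, k3, k4, ins, h4, h5, h6, h7, mul_assoc, hab, hab.symm, hab',
          hba', ha, hb, h1, h2] at e1 e2 ⊢

/-- Disjoint sets, with `a⁻¹ ∈ B` only: the square is `(A \ a ∪ B, b) (A, a) = (A, a) (B, b)`. -/
theorem linked_disjoint₂ (hA : Valid A a) (hB : Valid B b) (hAB : Disjoint A B)
    (ha : bar a ∈ B) (hb : bar b ∉ A) {x : α → FreeGroup α}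
    (hx : cuts A x + cuts B x < cnt a x + cnt b x) : Linked x (wh A a hA) (wh B b hB) := by
  have hab : a ≠ b := fun h => Finset.disjoint_left.1 hAB hA.1 (h ▸ hB.1)
  have hab' : a ≠ bar b := fun h => hb (h ▸ hA.1)
  have hba' : b ≠ bar a := fun h => hab' (by rw [h, bar_bar])
  have h1 : a ∉ B := Finset.disjoint_left.1 hAB hA.1
  have h2 : b ∉ A := Finset.disjoint_right.1 hAB hB.1
  have ha1 := hA.1
  have ha2 := hA.2
  have hb1 := hB.1
  have hb2 := hB.2
  have hC : Valid (A.erase a ∪ B) b := by simp [Valid, hb1, hb, hb2]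
  have hsq : wh (A.erase a ∪ B) b hC * wh A a hA = wh A a hA * wh B b hB := by
    refine mulAut_ext_of_letters a b ?_ ?_ fun y k1 k2 k3 k4 k5 k6 => ?_
    · simp [wh_letter, img, ins, hab, hab.symm, hab', hba', ha, hb, h1, h2, ha1, ha2, hb1, hb2]
    · simp [wh_letter, img, ins, hab, hab.symm, hab', hba', ha, hb, h1, h2, ha1, ha2, hb1, hb2]
    · have e1 := (fun h => Finset.disjoint_left.1 hAB h : y ∈ A → y ∉ B)
      have e2 := (fun h => Finset.disjoint_left.1 hAB h : bar y ∈ A → bar y ∉ B)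
      by_cases h4 : y ∈ A <;> by_cases h5 : bar y ∈ A <;> by_cases h6 : y ∈ B <;>
        by_cases h7 : bar y ∈ B <;>
        simp [wh_letter, img, k1, k2, k3, k4, k5, k6, ins, h4, h5, h6, h7, mul_assoc, hab, hab.symm,
          hab', hba', ha, hb, h1, h2] at e1 e2 ⊢
  refine linked_of_label hA hB (Or.inr hAB) hab hab' hx (wh_mem hA) (wh_mem hC) hsq ?_
  rw [hsq]
  refine label_of_letters (fun y => ins B b y * ins A a y) a b ?_ ?_ fun y k1 k2 k3 k4 k5 k6 => ?_
  · simp [wh_letter, img, ins, hab, hab.symm, hab', hba', ha, hb, h1, h2, ha1, ha2, hb1, hb2]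
  · simp [wh_letter, img, ins, hab, hab.symm, hab', hba', ha, hb, h1, h2, ha1, ha2, hb1, hb2]
  · have e1 := (fun h => Finset.disjoint_left.1 hAB h : y ∈ A → y ∉ B)
    have e2 := (fun h => Finset.disjoint_left.1 hAB h : bar y ∈ A → bar y ∉ B)
    by_cases h4 : y ∈ A <;> by_cases h5 : bar y ∈ A <;> by_cases h6 : y ∈ B <;>
      by_cases h7 : bar y ∈ B <;>
      simp [wh_letter, img, k1, k2, k3, k4, ins, h4, h5, h6, h7, mul_assoc, hab, hab.symm, hab',
        hba', ha, hb, h1, h2] at e1 e2 ⊢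

/-- Nested sets, `B ⊆ A`, with `a ∉ B` and `b⁻¹ ∈ A`: the automorphisms commute. -/
theorem linked_subset₁ (hA : Valid A a) (hB : Valid B b) (hBA : B ⊆ A)
    (ha : a ∉ B) (hb : bar b ∈ A) {x : α → FreeGroup α}
    (hx : cuts A x + cuts B x < cnt a x + cnt b x) : Linked x (wh A a hA) (wh B b hB) := by
  have hab : a ≠ b := fun h => ha (h ▸ hB.1)
  have hab' : a ≠ bar b := fun h => hA.2 (hBA (by rw [h, bar_bar]; exact hB.1))
  have hba' : b ≠ bar a := fun h => hab' (by rw [h, bar_bar])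
  have h1 : bar a ∉ B := fun h => hA.2 (hBA h)
  have h2 : b ∈ A := hBA hB.1
  have ha1 := hA.1
  have ha2 := hA.2
  have hb1 := hB.1
  have hb2 := hB.2
  have hsq : wh B b hB * wh A a hA = wh A a hA * wh B b hB := by
    refine mulAut_ext_of_letters a b ?_ ?_ fun y k1 k2 k3 k4 k5 k6 => ?_
    · simp [wh_letter, img, ins, hab, hab.symm, hab', hba', ha, hb, h1, h2, ha1, ha2, hb1, hb2]
    · simp [wh_letter, img, ins, hab, hab.symm, hab', hba', ha, hb, h1, h2, ha1, ha2, hb1, hb2]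
    · have e1 := @hBA y
      have e2 := @hBA (bar y)
      by_cases h4 : y ∈ A <;> by_cases h5 : bar y ∈ A <;> by_cases h6 : y ∈ B <;>
        by_cases h7 : bar y ∈ B <;>
        simp [wh_letter, img, k1, k2, k3, k4, k5, k6, ins, h4, h5, h6, h7, mul_assoc, hab, hab.symm,
          hab', hba', ha, hb, h1, h2] at e1 e2 ⊢
  refine linked_of_label hA hB (Or.inl hBA) hab hab' hx (wh_mem hA) (wh_mem hB) hsq ?_
  refine label_of_letters (fun y => ins B b y * ins A a y) a b ?_ ?_ fun y k1 k2 k3 k4 k5 k6 => ?_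
  · simp [wh_letter, img, ins, hab, hab.symm, hab', hba', ha, hb, h1, h2, ha1, ha2, hb1, hb2]
  · simp [wh_letter, img, ins, hab, hab.symm, hab', hba', ha, hb, h1, h2, ha1, ha2, hb1, hb2,
      mul_assoc]
  · have e1 := @hBA y
    have e2 := @hBA (bar y)
    by_cases h4 : y ∈ A <;> by_cases h5 : bar y ∈ A <;> by_cases h6 : y ∈ B <;>
      by_cases h7 : bar y ∈ B <;>
      simp [wh_letter, img, k1, k2, k3, k4, ins, h4, h5, h6, h7, mul_assoc, hab, hab.symm, hab',
        hba', ha, hb, h1, h2] at e1 e2 ⊢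

/-- Nested sets, `B ⊆ A`, with `a ∉ B` and `b⁻¹ ∉ A`: the square is
`(B, b) (A, a) = (A \ B ∪ b, a) (B, b)`. -/
theorem linked_subset₂ (hA : Valid A a) (hB : Valid B b) (hBA : B ⊆ A)
    (ha : a ∉ B) (hb : bar b ∉ A) {x : α → FreeGroup α}
    (hx : cuts A x + cuts B x < cnt a x + cnt b x) : Linked x (wh A a hA) (wh B b hB) := by
  have hab : a ≠ b := fun h => ha (h ▸ hB.1)
  have hab' : a ≠ bar b := fun h => hA.2 (hBA (by rw [h, bar_bar]; exact hB.1))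
  have hba' : b ≠ bar a := fun h => hab' (by rw [h, bar_bar])
  have h1 : bar a ∉ B := fun h => hA.2 (hBA h)
  have h2 : b ∈ A := hBA hB.1
  have ha1 := hA.1
  have ha2 := hA.2
  have hb1 := hB.1
  have hb2 := hB.2
  have hC : Valid (insert b (A \ B)) a := by simp [Valid, ha1, ha2, ha, hba'.symm]
  have hsq : wh B b hB * wh A a hA = wh (insert b (A \ B)) a hC * wh B b hB := by
    refine mulAut_ext_of_letters a b ?_ ?_ fun y k1 k2 k3 k4 k5 k6 => ?_
    · simp [wh_letter, img, ins, hab, hab.symm, hab', hba', ha, hb, h1, h2, ha1, ha2, hb1, hb2]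
    · simp [wh_letter, img, ins, hab, hab.symm, hab', hba', ha, hb, h1, h2, ha1, ha2, hb1, hb2]
    · have e1 := @hBA y
      have e2 := @hBA (bar y)
      by_cases h4 : y ∈ A <;> by_cases h5 : bar y ∈ A <;> by_cases h6 : y ∈ B <;>
        by_cases h7 : bar y ∈ B <;>
        simp [wh_letter, img, k1, k2, k3, k4, k5, k6, ins, h4, h5, h6, h7, mul_assoc, hab, hab.symm,
          hab', hba', ha, hb, h1, h2, hb1, hb2, hba'.symm, hab'.symm] at e1 e2 ⊢
  refine linked_of_label hA hB (Or.inl hBA) hab hab' hx (wh_mem hC) (wh_mem hB) hsq ?_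
  refine label_of_letters (fun y => ins B b y * ins A a y) a b ?_ ?_ fun y k1 k2 k3 k4 k5 k6 => ?_
  · simp [wh_letter, img, ins, hab, hab.symm, hab', hba', ha, hb, h1, h2, ha1, ha2, hb1, hb2]
  · simp [wh_letter, img, ins, hab, hab.symm, hab', hba', ha, hb, h1, h2, ha1, ha2, hb1, hb2,
      mul_assoc]
  · have e1 := @hBA y
    have e2 := @hBA (bar y)
    by_cases h4 : y ∈ A <;> by_cases h5 : bar y ∈ A <;> by_cases h6 : y ∈ B <;>
      by_cases h7 : bar y ∈ B <;>
      simp [wh_letter, img, k1, k2, k3, k4, ins, h4, h5, h6, h7, mul_assoc, hab, hab.symm, hab',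
        hba', ha, hb, h1, h2] at e1 e2 ⊢

/-- Nested sets, `B ⊆ A`, with `a ∈ B` and `b⁻¹ ∈ A`: the square is
`(A \ B ∪ a⁻¹, b⁻¹) (A, a) = (A, a) (B, b)`. -/
theorem linked_subset₃ (hA : Valid A a) (hB : Valid B b) (hBA : B ⊆ A)
    (ha : a ∈ B) (hb : bar b ∈ A) {x : α → FreeGroup α}
    (hx : cuts A x + cuts B x < cnt a x + cnt b x) : Linked x (wh A a hA) (wh B b hB) := by
  have hab : a ≠ b := fun h => hA.2 (h ▸ hb)
  have hab' : a ≠ bar b := fun h => hB.2 (h ▸ ha)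
  have hba' : b ≠ bar a := fun h => hab' (by rw [h, bar_bar])
  have h1 : bar a ∉ B := fun h => hA.2 (hBA h)
  have h2 : b ∈ A := hBA hB.1
  have ha1 := hA.1
  have ha2 := hA.2
  have hb1 := hB.1
  have hb2 := hB.2
  have hC : Valid (insert (bar a) (A \ B)) (bar b) := by
    simp [Valid, hb, hb2, hb1, hba']
  have hsq : wh (insert (bar a) (A \ B)) (bar b) hC * wh A a hA = wh A a hA * wh B b hB := by
    refine mulAut_ext_of_letters a b ?_ ?_ fun y k1 k2 k3 k4 k5 k6 => ?_
    · simp [wh_letter, img, ins, hab, hab.symm, hab', hba', ha, hb, h1, h2, ha1, ha2, hb1, hb2,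
      mul_assoc]
    · simp [wh_letter, img, ins, hab, hab.symm, hab', hba', ha, hb, h1, h2, ha1, ha2, hb1, hb2,
      mul_assoc]
    · have e1 := @hBA y
      have e2 := @hBA (bar y)
      by_cases h4 : y ∈ A <;> by_cases h5 : bar y ∈ A <;> by_cases h6 : y ∈ B <;>
        by_cases h7 : bar y ∈ B <;>
        simp [wh_letter, img, k1, k2, k3, k4, k5, k6, ins, h4, h5, h6, h7, mul_assoc, hab, hab.symm,
          hab', hba', ha, hb, h1, h2, hb1, hb2, hba'.symm, hab'.symm] at e1 e2 ⊢
  refine linked_of_label hA hB (Or.inl hBA) hab hab' hx (wh_mem hA) (wh_mem hC) hsq ?_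
  rw [hsq]
  refine label_of_letters (fun y => ins B b y * ins A a y) a b ?_ ?_ fun y k1 k2 k3 k4 k5 k6 => ?_
  · simp [wh_letter, img, ins, hab, hab.symm, hab', hba', ha, hb, h1, h2, ha1, ha2, hb1, hb2,
      mul_assoc]
  · simp [wh_letter, img, ins, hab, hab.symm, hab', hba', ha, hb, h1, h2, ha1, ha2, hb1, hb2,
      mul_assoc]
  · have e1 := @hBA y
    have e2 := @hBA (bar y)
    by_cases h4 : y ∈ A <;> by_cases h5 : bar y ∈ A <;> by_cases h6 : y ∈ B <;>
      by_cases h7 : bar y ∈ B <;>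
      simp [wh_letter, img, k1, k2, k3, k4, ins, h4, h5, h6, h7, mul_assoc, hab, hab.symm, hab',
        hba', ha, hb, h1, h2] at e1 e2 ⊢

/-- If `(A, a)` reduces the length, it is linked to `(A, b)`. -/
theorem linked_same_set (hA : Valid A a) (hB : Valid A b) (hab : a ≠ b) {x : α → FreeGroup α}
    (hx : len (wh A a hA • x) < len x) : Linked x (wh A a hA) (wh A b hB) := by
  obtain ⟨π, hπ, C, hC, h⟩ := exists_wh_eq_perm_mul hA hB hab
  refine .of_mid (π * wh A a hA) ⟨π, perm_mem hπ, _, wh_mem hA, rfl⟩ ?_ ?_ ?_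
  · rw [mul_smul, len_letterPerm hπ]; exact hx
  · rw [mul_inv_rev, mul_inv_cancel_left]; exact perm_mem (inv_mem hπ)
  · rw [h, show π * (wh C b hC * wh A a hA) * (π * wh A a hA)⁻¹ = π * wh C b hC * π⁻¹ by group]
    exact conj_wh_mem hπ hC

theorem linked_nested_letter (hA : Valid A a) (hB : Valid B a) (hBA : B ⊆ A)
    {x : α → FreeGroup α} (hx : len (wh A a hA • x) < len x ∨ len (wh B a hB • x) < len x) :
    Linked x (wh A a hA) (wh B a hB) := by
  have hC : Valid (insert a (A \ B)) a := by simp [Valid, hA.2]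
  refine (IsLinked.of_step one_mem_gens inv_mem_gens (gens_subset_ball (wh_mem hB))
    (gens_subset_ball (wh_mem hA)) hx.symm ?_).symm inv_mem_gens
  rw [wh_subset_mul hA hB hBA hC, mul_inv_cancel_right]
  exact wh_mem _

theorem linked_disjoint_letter (hA : Valid A a) (hB : Valid B (bar a)) (hAB : Disjoint A B)
    {x : α → FreeGroup α} (hx : len (wh A a hA • x) < len x ∨ len (wh B (bar a) hB • x) < len x) :
    Linked x (wh A a hA) (wh B (bar a) hB) := by
  have hC : Valid (A ∪ B.erase (bar a)) a := by simp [Valid, hA.1, hA.2]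
  refine (IsLinked.of_step one_mem_gens inv_mem_gens (gens_subset_ball (wh_mem hB))
    (gens_subset_ball (wh_mem hA)) hx.symm ?_).symm inv_mem_gens
  rw [wh_union_mul hA hB hAB hC, mul_inv_cancel_right]
  exact wh_mem _

theorem len_wh_lt_iff (hA : Valid A a) (x : α → FreeGroup α) :
    len (wh A a hA • x) < len x ↔ cuts A x < cnt a x := by
  have := len_wh hA x
  omega

/-- Peak reduction for nested sets. If `a ∈ B` and `b⁻¹ ∉ A`, the letters can be interchanged, and one of
the automorphisms `(B, a)` and `(A, b)` reduces the length, since the two changes of length have the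
same sum as those under `(A, a)` and `(B, b)`. -/
theorem linked_of_subset (hA : Valid A a) (hB : Valid B b) (hBA : B ⊆ A) {x : α → FreeGroup α}
    (hx : cuts A x + cuts B x < cnt a x + cnt b x)
    (hlt : len (wh A a hA • x) < len x ∨ len (wh B b hB • x) < len x) :
    Linked x (wh A a hA) (wh B b hB) := by
  by_cases hab : a = b
  · subst hab; exact linked_nested_letter hA hB hBA hlt
  by_cases ha : a ∈ B <;> by_cases hb : bar b ∈ A
  · exact linked_subset₃ hA hB hBA ha hb hx
  · have hBa : Valid B a := ⟨ha, fun h => hA.2 (hBA h)⟩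
    have hAb : Valid A b := ⟨hBA hB.1, hb⟩
    by_cases h : len (wh B a hBa • x) < len x
    · exact .trans inv_mem_gens (gens_subset_ball (wh_mem hBa)) h
        (linked_nested_letter hA hBa hBA (Or.inr h)) (linked_same_set hBa hB hab h)
    · have h' : len (wh A b hAb • x) < len x := by
        rw [len_wh_lt_iff] at h ⊢; omega
      exact .trans inv_mem_gens (gens_subset_ball (wh_mem hAb)) h'
        ((linked_same_set hAb hA (Ne.symm hab) h').symm inv_mem_gens)
        (linked_nested_letter hAb hB hBA (Or.inl h'))
  · exact linked_subset₁ hA hB hBA ha hb hx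
  · exact linked_subset₂ hA hB hBA ha hb hx

/-- Peak reduction for disjoint sets. If `a⁻¹ ∈ B` and `b⁻¹ ∈ A`, the letters are interchanged as for
nested sets. -/
theorem linked_of_disjoint (hA : Valid A a) (hB : Valid B b) (hAB : Disjoint A B)
    {x : α → FreeGroup α} (hx : cuts A x + cuts B x < cnt a x + cnt b x)
    (hlt : len (wh A a hA • x) < len x ∨ len (wh B b hB • x) < len x) :
    Linked x (wh A a hA) (wh B b hB) := by
  by_cases hab : b = bar a
  · subst hab; exact linked_disjoint_letter hA hB hAB hlt
  by_cases ha : bar a ∈ B <;> by_cases hb : bar b ∈ A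
  · have hBa : Valid B (bar a) := ⟨ha, by
      rw [bar_bar]; exact Finset.disjoint_left.1 hAB hA.1⟩
    have hAb : Valid A (bar b) := ⟨hb, by
      rw [bar_bar]; exact Finset.disjoint_right.1 hAB hB.1⟩
    have hab' : bar b ≠ a := fun h => hab (bar_eq_iff.1 h)
    by_cases h : len (wh B (bar a) hBa • x) < len x
    · exact .trans inv_mem_gens (gens_subset_ball (wh_mem hBa)) h
        (linked_disjoint_letter hA hBa hAB (Or.inr h))
        (linked_same_set hBa hB (Ne.symm hab) h)
    · have h' : len (wh A (bar b) hAb • x) < len x := by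
        rw [len_wh_lt_iff, cnt_bar] at h ⊢; omega
      exact .trans inv_mem_gens (gens_subset_ball (wh_mem hAb)) h'
        ((linked_same_set hAb hA hab' h').symm inv_mem_gens)
        ((linked_disjoint_letter hB hAb hAB.symm (Or.inr h')).symm inv_mem_gens)
  · exact linked_disjoint₂ hA hB hAB ha hb hx
  · exact (linked_disjoint₂ hB hA hAB.symm hb ha (by omega)).symm inv_mem_gens
  · exact linked_disjoint₁ hA hB hAB ha hb hx

theorem linked_of_nested (hA : Valid A a) (hB : Valid B b) (hAB : Nested A B)
    {x : α → FreeGroup α} (h1 : len (wh A a hA • x) ≤ len x)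
    (h2 : len (wh B b hB • x) < len x) : Linked x (wh A a hA) (wh B b hB) := by
  have k1 := len_wh hA x
  have k2 := len_wh hB x
  rcases hAB with h | h | h
  · exact (linked_of_subset hB hA h (by omega) (Or.inl h2)).symm inv_mem_gens
  · exact linked_of_subset hA hB h (by omega) (Or.inr h2)
  · exact linked_of_disjoint hA hB h (by omega) (Or.inr h2)

/-- If `(A, a)` and `(B, b)` form a peak, one of the sets `A ∩ B`, `A ∪ B`, `A \ B` and `B \ A`, with
a suitable letter among `a`, `b` and their inverses, reduces the length: two opposite corners admit
the letters `a` and `b` up to inversion, and submodularity of cuts applies to them. -/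
theorem exists_corner (hA : Valid A a) (hB : Valid B b) {x : α → FreeGroup α}
    (hx : cuts A x + cuts B x < cnt a x + cnt b x) :
    ∃ (C : Finset (α × Bool)) (c : α × Bool) (hC : Valid C c),
      Nested A C ∧ Nested B C ∧ len (wh C c hC • x) < len x := by
  by_contra hcon
  push Not at hcon
  have key : ∀ (C : Finset (α × Bool)) (c : α × Bool), Nested A C → Nested B C → Valid C c →
      cnt c x ≤ cuts C x := by
    intro C c h1 h2 hC
    have h3 := hcon C c hC h1 h2
    have h4 := len_wh hC x
    omega
  have hd1 : Disjoint B (A \ B) := Finset.disjoint_sdiff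
  have hd2 : Disjoint A (B \ A) := Finset.disjoint_sdiff
  have ki := fun c => key (A ∩ B) c (Or.inr (Or.inl Finset.inter_subset_left))
    (Or.inr (Or.inl Finset.inter_subset_right))
  have ku := fun c => key (A ∪ B) c (Or.inl Finset.subset_union_left)
    (Or.inl Finset.subset_union_right)
  have kd := fun c => key (A \ B) c (Or.inr (Or.inl Finset.sdiff_subset)) (Or.inr (Or.inr hd1))
  have kd' := fun c => key (B \ A) c (Or.inr (Or.inr hd2)) (Or.inr (Or.inl Finset.sdiff_subset))
  have s1 := cuts_inter_add_cuts_union A B x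
  have s2 := cuts_sdiff_add_cuts_sdiff A B x
  obtain ⟨ha1, ha2⟩ := hA
  obtain ⟨hb1, hb2⟩ := hB
  have i1 := ki a; have i2 := ki b; have u1 := ku a; have u2 := ku b
  have d1 := kd a; have d2 := kd (bar b); have d3 := kd' b; have d4 := kd' (bar a)
  simp only [Valid, Finset.mem_inter, Finset.mem_union, Finset.mem_sdiff, bar_bar, cnt_bar, ha1, ha2,
    hb1, hb2, true_and, and_true, not_true, not_false_iff, true_or, or_true, false_and, and_false,
    false_or, or_false] at i1 i2 u1 u2 d1 d2 d3 d4
  by_cases h1 : a ∈ B <;> by_cases h2 : bar a ∈ B <;> by_cases h3 : b ∈ A <;>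
    by_cases h4 : bar b ∈ A <;>
    simp only [h1, h2, h3, h4, not_true, not_false_iff, true_imp_iff, false_imp_iff]
      at i1 i2 u1 u2 d1 d2 d3 d4 <;> omega

theorem linked_wh (hA : Valid A a) (hB : Valid B b) {x : α → FreeGroup α}
    (h1 : len (wh A a hA • x) < len x) (h2 : len (wh B b hB • x) ≤ len x) :
    Linked x (wh A a hA) (wh B b hB) := by
  have k1 := len_wh hA x
  have k2 := len_wh hB x
  obtain ⟨C, c, hC, hAC, hBC, h⟩ := exists_corner hA hB (x := x) (by omega)
  exact .trans inv_mem_gens (gens_subset_ball (wh_mem hC)) h (linked_of_nested hA hC hAC h1.le h)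
    ((linked_of_nested hB hC hBC h2 h).symm inv_mem_gens)

theorem isPeakReduced_gens (x : α → FreeGroup α) (s t : MulAut (FreeGroup α)) (hs : s ∈ gens α)
    (ht : t ∈ gens α) (hsx : len (s • x) < len x) (htx : len (t • x) ≤ len x) :
    IsPeakReduced len (gens α) (ball α) x s t := by
  obtain ⟨⟨⟨A, a⟩, hA⟩, rfl⟩ | hs := hs
  · obtain ⟨⟨⟨B, b⟩, hB⟩, rfl⟩ | ht := ht
    · exact (linked_wh hA hB hsx htx).isPeakReduced inv_mem_gens
    · refine IsLinked.isPeakReduced inv_mem_gens (.of_mid (t * wh A a hA)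
        ⟨t, perm_mem ht, _, wh_mem hA, rfl⟩ ?_ ?_ ?_)
      · rw [mul_smul, len_letterPerm ht]; exact hsx
      · rw [mul_inv_rev, mul_inv_cancel_left]; exact perm_mem (inv_mem ht)
      · rw [mul_inv_rev, ← mul_assoc, wh_inv]; exact conj_wh_mem ht _
  · exact absurd (len_letterPerm hs x) hsx.ne

end Whitehead

/-! ### Cancellation in a free group -/

namespace Whitehead

variable {α : Type*} [Fintype α] [DecidableEq α]

/-- The length of the longest common prefix of two words. -/
def lcp : List (α × Bool) → List (α × Bool) → ℕ
  | y :: l, z :: m => if y = z then lcp l m + 1 else 0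
  | _, _ => 0

theorem lcp_comm (l m : List (α × Bool)) : lcp l m = lcp m l := by
  induction l generalizing m with
  | nil => cases m <;> rfl
  | cons y l ih =>
    cases m with
    | nil => rfl
    | cons z m => simp only [lcp, ih m, eq_comm]

theorem min_lcp_le (l m n : List (α × Bool)) : min (lcp l m) (lcp m n) ≤ lcp l n := by
  induction l generalizing m n with
  | nil => cases m <;> simp [lcp]
  | cons y l ih =>
    cases m with
    | nil => simp [lcp]
    | cons z m =>
      cases n with
      | nil => simp [lcp]
      | cons w n =>
        have := ih m n
        simp only [lcp]
        by_cases h1 : y = z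
        · subst h1
          by_cases h2 : y = w
          · simp only [h2, if_true]; omega
          · simp [h2]
        · simp [h1]

theorem le_lcp_iff {l m : List (α × Bool)} {k : ℕ} (hl : k ≤ l.length) (hm : k ≤ m.length) :
    k ≤ lcp l m ↔ l.take k = m.take k := by
  induction k generalizing l m with
  | zero => simp
  | succ k ih =>
    cases l with
    | nil => simp at hl
    | cons y l =>
      cases m with
      | nil => simp at hm
      | cons z m =>
        simp only [List.length_cons, Nat.add_le_add_iff_right] at hl hm
        have := ih hl hm
        by_cases h : y = z <;> simp [lcp, h, this]

theorem norm_mk_of_isReduced {l : List (α × Bool)} (h : FreeGroup.IsReduced l) :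
    (FreeGroup.mk l).norm = l.length := by
  rw [FreeGroup.norm, FreeGroup.toWord_mk, h.reduce_eq]

theorem isReduced_invRev {l : List (α × Bool)} (h : FreeGroup.IsReduced l) :
    FreeGroup.IsReduced (FreeGroup.invRev l) := by
  rw [← h.reduce_eq, ← FreeGroup.reduce_invRev, ← FreeGroup.toWord_mk]
  exact FreeGroup.isReduced_toWord

theorem isReduced_append_cons {l m : List (α × Bool)} {y z : α × Bool}
    (h1 : FreeGroup.IsReduced (l ++ [y])) (h2 : FreeGroup.IsReduced (z :: m)) (h : z ≠ bar y) :
    FreeGroup.IsReduced (l ++ y :: z :: m) := by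
  induction l with
  | nil => exact isReduced_cons.2 ⟨by simpa using h, h2⟩
  | cons w l ih =>
    rw [List.cons_append, isReduced_cons] at h1 ⊢
    refine ⟨?_, ih h1.2⟩
    cases l <;> simpa using h1.1

theorem norm_inv_mul_mk {l m : List (α × Bool)} (hl : FreeGroup.IsReduced l)
    (hm : FreeGroup.IsReduced m) :
    ((FreeGroup.mk l)⁻¹ * FreeGroup.mk m).norm + 2 * lcp l m = l.length + m.length := by
  induction l generalizing m with
  | nil =>
    cases m <;> simp [lcp, ← FreeGroup.one_eq_mk, norm_mk_of_isReduced hm]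
  | cons y l ih =>
    cases m with
    | nil =>
      rw [← FreeGroup.one_eq_mk, mul_one, FreeGroup.norm_inv_eq, norm_mk_of_isReduced hl]
      simp [lcp]
    | cons z m =>
      by_cases h : y = z
      · subst h
        have := ih (isReduced_cons.1 hl).2 (isReduced_cons.1 hm).2
        rw [mk_cons, mk_cons, mul_inv_rev, mul_assoc, inv_mul_cancel_left]
        simp only [lcp, if_true, List.length_cons]
        omega
      · have h1 : FreeGroup.invRev (y :: l) = FreeGroup.invRev l ++ [bar y] := by
          rw [FreeGroup.invRev_cons]; rfl
        have h2 : FreeGroup.IsReduced (FreeGroup.invRev l ++ bar y :: z :: m) :=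
          isReduced_append_cons (h1 ▸ isReduced_invRev hl) hm (by simpa using fun h' => h h'.symm)
        rw [FreeGroup.inv_mk, FreeGroup.mul_mk, h1, List.append_assoc, List.singleton_append,
          norm_mk_of_isReduced h2]
        simp [lcp, h]; omega

/-- The length of the common initial segment of the reduced words of two elements, which is their
Gromov product at the identity. -/
def common (g h : FreeGroup α) : ℕ := lcp g.toWord h.toWord

theorem common_comm (g h : FreeGroup α) : common g h = common h g := lcp_comm _ _

/-- Initial segments satisfy the ultrametric inequality. -/
theorem min_common_le (g h k : FreeGroup α) : min (common g h) (common h k) ≤ common g k :=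
  min_lcp_le _ _ _

theorem norm_inv_mul (g h : FreeGroup α) :
    (g⁻¹ * h).norm + 2 * common g h = g.norm + h.norm := by
  have := norm_inv_mul_mk (FreeGroup.isReduced_toWord (x := g)) (FreeGroup.isReduced_toWord (x := h))
  rwa [FreeGroup.mk_toWord, FreeGroup.mk_toWord] at this

/-- The square of a nontrivial element is longer than the element. -/
theorem two_mul_common_inv_lt {g : FreeGroup α} (hg : g ≠ 1) : 2 * common g⁻¹ g < g.norm := by
  have hr := FreeGroup.isReduced_toWord (x := g)
  have hn : 0 < g.norm := Nat.pos_of_ne_zero (by simpa using hg)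
  rw [common, FreeGroup.toWord_inv]
  unfold FreeGroup.norm at hn ⊢
  generalize g.toWord = l at hr hn
  by_contra! hlt
  -- the letters of the first half of the word are the inverses of those at the mirrored positions
  have key : ∀ i (hi : i < l.length), i < lcp (FreeGroup.invRev l) l →
      l[i] = bar (l[l.length - 1 - i]) := by
    intro i hi hik
    have h1 := (le_lcp_iff (l := FreeGroup.invRev l) (m := l) (k := i + 1) (by simpa using hi) hi).1 hik
    have h2 : (FreeGroup.invRev l)[i]? = l[i]? := by
      have := congrArg (fun t => t[i]?) h1
      simpa [List.getElem?_take] using this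
    have h3 : i < (FreeGroup.invRev l).length := by simpa using hi
    rw [List.getElem?_eq_getElem h3, List.getElem?_eq_getElem hi, Option.some.injEq] at h2
    rw [← h2]
    simp [FreeGroup.invRev, bar]
  rcases Nat.even_or_odd' l.length with ⟨j, hj | hj⟩
  · have h1 := key (j - 1) (by omega) (by omega)
    have h2 := List.isChain_iff_getElem.1 hr (j - 1) (by omega)
    have h3 : l.length - 1 - (j - 1) = j - 1 + 1 := by omega
    simp only [h3] at h1
    have h4 := h2 (by rw [h1]; rfl)
    rw [h1] at h4
    simp [bar] at h4
  · have h1 := key j (by omega) (by omega)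
    have h3 : l.length - 1 - j = j := by omega
    simp only [h3] at h1
    exact self_ne_bar _ h1

/-! ### Ranks of words -/

/-- The number whose digits, in a sufficiently large base, are the letters of a word. -/
noncomputable def val (l : List (α × Bool)) : ℕ :=
  Nat.ofDigits (Fintype.card (α × Bool) + 2)
    ((l.map fun y => (Fintype.equivFin (α × Bool) y : ℕ)).reverse)

theorem val_injOn {l m : List (α × Bool)} (h : l.length = m.length) (hv : val l = val m) : l = m := by
  have h1 : ∀ k : List (α × Bool), ∀ d ∈ (k.map fun y => (Fintype.equivFin (α × Bool) y : ℕ)).reverse,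
      d < Fintype.card (α × Bool) + 2 := by
    intro k d hd
    simp only [List.mem_reverse, List.mem_map] at hd
    obtain ⟨y, -, rfl⟩ := hd
    exact lt_of_lt_of_le (Fin.is_lt _) (by omega)
  have h2 := Nat.ofDigits_inj_of_len_eq (by omega) (by simpa using h) (h1 l) (h1 m) hv
  have h3 := List.reverse_injective h2
  exact List.map_injective_iff.2 (Fin.val_injective.comp (Equiv.injective _)) h3

theorem val_append_lt {l m : List (α × Bool)} (h : val l < val m) (d : List (α × Bool)) :
    val (l ++ d) < val (m ++ d) := by
  unfold val at *
  simp only [List.map_append, List.reverse_append, Nat.ofDigits_append]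
  gcongr

/-- The rank of an element is the value of the left half of its reduced word. -/
noncomputable def rank (g : FreeGroup α) : ℕ := val (g.toWord.take ((g.norm + 1) / 2))

theorem toWord_of_norm {l : List (α × Bool)} (h : (FreeGroup.mk l).norm = l.length) :
    (FreeGroup.mk l).toWord = l := by
  rw [FreeGroup.toWord_mk]
  refine (FreeGroup.reduce.red (L := l)).sublist.eq_of_length ?_
  rw [← h, FreeGroup.norm, FreeGroup.toWord_mk]

/-- Let exactly half of `g` cancel in `g⁻¹ h`, and let `h` be at least as long as `g`. Then the left half
of `g` is replaced by that of `g⁻¹` at the beginning of `h`, which changes neither the length of `h` nor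
the left half of `h⁻¹`. -/
theorem rank_inv_mul {g h : FreeGroup α} {m : ℕ} (hg : g.norm = 2 * m) (hh : 2 * m ≤ h.norm)
    (hc : common g h = m) (hlt : val (g⁻¹.toWord.take m) < val (g.toWord.take m)) :
    (g⁻¹ * h).norm = h.norm ∧ rank (g⁻¹ * h) < rank h ∧ rank (g⁻¹ * h)⁻¹ = rank h⁻¹ := by
  have hn := norm_inv_mul g h
  have hn' : (g⁻¹ * h).norm = h.norm := by omega
  have e1 : g.toWord.take m = h.toWord.take m :=
    (le_lcp_iff (by unfold FreeGroup.norm at hg; omega) (by unfold FreeGroup.norm at hh; omega)).1 hc.ge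
  have e2 : g⁻¹.toWord.take m = FreeGroup.invRev (g.toWord.drop m) := by
    conv_lhs => rw [FreeGroup.toWord_inv, ← List.take_append_drop m g.toWord, FreeGroup.invRev_append]
    rw [List.take_left']
    unfold FreeGroup.norm at hg
    simp; omega
  have e3 : g⁻¹ * h = FreeGroup.mk (g⁻¹.toWord.take m ++ h.toWord.drop m) := by
    rw [e2, ← FreeGroup.mul_mk, ← FreeGroup.inv_mk]
    have h1 : g = FreeGroup.mk (g.toWord.take m) * FreeGroup.mk (g.toWord.drop m) := by
      rw [FreeGroup.mul_mk, List.take_append_drop, FreeGroup.mk_toWord]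
    have h2 : h = FreeGroup.mk (g.toWord.take m) * FreeGroup.mk (h.toWord.drop m) := by
      rw [e1, FreeGroup.mul_mk, List.take_append_drop, FreeGroup.mk_toWord]
    conv_lhs => rw [h1, h2]
    group
  have hlen : (g⁻¹.toWord.take m).length = m := by
    have : g⁻¹.norm = 2 * m := by rw [FreeGroup.norm_inv_eq, hg]
    unfold FreeGroup.norm at this
    rw [List.length_take]; omega
  have hlen' : (h.toWord.take m).length = m := by
    unfold FreeGroup.norm at hh
    rw [List.length_take]; omega
  have e4 : (g⁻¹ * h).toWord = g⁻¹.toWord.take m ++ h.toWord.drop m := by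
    rw [e3]
    apply toWord_of_norm
    rw [← e3, hn', List.length_append, hlen, List.length_drop]
    unfold FreeGroup.norm at hh ⊢
    omega
  refine ⟨hn', ?_, ?_⟩
  · obtain ⟨r, hr⟩ : ∃ r, (h.norm + 1) / 2 = m + r := ⟨(h.norm + 1) / 2 - m, by omega⟩
    rw [rank, rank, hn', e4, hr]
    conv_rhs => rw [← List.take_append_drop m h.toWord]
    have h1 : ∀ p d : List (α × Bool), p.length = m → (p ++ d).take (m + r) = p ++ d.take r := by
      rintro p d rfl
      exact List.take_length_add_append r
    rw [h1 _ _ hlen, h1 _ _ hlen', ← e1]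
    exact val_append_lt hlt _
  · rw [rank, rank, FreeGroup.norm_inv_eq, FreeGroup.norm_inv_eq, hn', FreeGroup.toWord_inv,
      FreeGroup.toWord_inv, e4, FreeGroup.invRev_append]
    conv_rhs => rw [← List.take_append_drop m h.toWord, FreeGroup.invRev_append]
    have : (h.norm + 1) / 2 ≤ (FreeGroup.invRev (h.toWord.drop m)).length := by
      unfold FreeGroup.norm at *
      simp; omega
    rw [List.take_append_of_le_length this, List.take_append_of_le_length this]

end Whitehead

/-! ### Generation by Whitehead automorphisms and permutations of the letters -/

namespace Whitehead

variable {α : Type*} [Fintype α] [DecidableEq α]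

theorem valid_pair {a y : α × Bool} (h : y ≠ bar a) : Valid {a, y} a := by
  simp [Valid, h.symm]

theorem mul_wh_pair_self (β : MulAut (FreeGroup α)) {a y : α × Bool} (h1 : y ≠ a) (h2 : y ≠ bar a) :
    (β * wh {a, y} a (valid_pair h2)) (letter y) = β (letter y) * β (letter a) := by
  have h3 : bar y ≠ a := fun h => h2 (bar_eq_iff.1 h)
  rw [MulAut.mul_apply, wh_of_ne _ h1 h2]
  simp [ins, h3]

theorem mul_wh_pair_of_ne (β : MulAut (FreeGroup α)) {a y z : α × Bool} (h2 : y ≠ bar a)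
    (hz : z ≠ y) (hz' : z ≠ bar y) :
    (β * wh {a, y} a (valid_pair h2)) (letter z) = β (letter z) := by
  rw [MulAut.mul_apply]
  congr 1
  by_cases h3 : z = a
  · rw [h3, wh_self]
  · by_cases h4 : z = bar a
    · rw [h4, letter_bar, map_inv, wh_self]
    · have h5 : bar z ≠ a := fun h => h4 (bar_eq_iff.1 h)
      have h6 : bar z ≠ y := fun h => hz' (bar_eq_iff.1 h)
      rw [wh_of_ne _ h3 h4]
      simp [ins, h3, h5, h6, hz]

theorem exists_sum_eq (f f' : α × Bool → ℕ) (y : α × Bool)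
    (h : ∀ z, z ≠ y → z ≠ bar y → f' z = f z) :
    ∃ c, ∑ z, f z = f y + f (bar y) + c ∧ ∑ z, f' z = f' y + f' (bar y) + c := by
  have hs : ∀ g : α × Bool → ℕ, ∑ z, g z =
      g y + g (bar y) + ∑ z ∈ (Finset.univ.erase y).erase (bar y), g z := by
    intro g
    rw [← Finset.add_sum_erase _ _ (Finset.mem_univ y), ← Finset.add_sum_erase _ _
      (show bar y ∈ Finset.univ.erase y by simp), add_assoc]
  refine ⟨_, hs f, ?_⟩
  rw [hs f']
  congr 1
  exact Finset.sum_congr rfl fun z hz => h z (by simp_all) (by simp_all)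

/-- The sum of the lengths of the images of the letters. -/
def lenSum (β : MulAut (FreeGroup α)) : ℕ := ∑ y, (β (letter y)).norm

/-- The sum of the ranks of the images of the letters. -/
noncomputable def rankSum (β : MulAut (FreeGroup α)) : ℕ := ∑ y, rank (β (letter y))

theorem letter_ne_one (y : α × Bool) : letter y ≠ 1 := by
  intro h
  have := norm_letter y
  rw [h] at this
  simp at this

theorem map_letter_ne_one (β : MulAut (FreeGroup α)) (y : α × Bool) : β (letter y) ≠ 1 := by
  simpa using letter_ne_one y

theorem norm_map_bar (β : MulAut (FreeGroup α)) (y : α × Bool) :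
    (β (letter (bar y))).norm = (β (letter y)).norm := by
  rw [letter_bar, map_inv, FreeGroup.norm_inv_eq]

theorem lenSum_mul_wh_pair (β : MulAut (FreeGroup α)) {a y : α × Bool} (h1 : y ≠ a)
    (h2 : y ≠ bar a) : ∃ c, lenSum β = 2 * (β (letter y)).norm + c ∧
      lenSum (β * wh {a, y} a (valid_pair h2)) = 2 * (β (letter y) * β (letter a)).norm + c := by
  obtain ⟨c, e1, e2⟩ := exists_sum_eq (fun z => (β (letter z)).norm)
    (fun z => ((β * wh {a, y} a (valid_pair h2)) (letter z)).norm) y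
    fun z hz hz' => by rw [mul_wh_pair_of_ne β h2 hz hz']
  rw [norm_map_bar] at e1 e2
  rw [mul_wh_pair_self β h1 h2] at e2
  exact ⟨c, by rw [lenSum]; omega, by rw [lenSum]; omega⟩

/-- A tie is broken by the ranks: if `a` maps to a word exactly half of which cancels in front of the
image of `y⁻¹`, and the half replacing it has smaller rank, then a Nielsen transformation keeps the
lengths and decreases the ranks. -/
theorem rankSum_mul_wh_pair (β : MulAut (FreeGroup α)) {a y : α × Bool} (h1 : y ≠ a)
    (h2 : y ≠ bar a) {m : ℕ} (hg : (β (letter a)).norm = 2 * m) (hh : 2 * m ≤ (β (letter y)).norm)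
    (hc : common (β (letter a)) (β (letter y))⁻¹ = m)
    (hlt : val ((β (letter a))⁻¹.toWord.take m) < val ((β (letter a)).toWord.take m)) :
    lenSum (β * wh {a, y} a (valid_pair h2)) = lenSum β ∧
      rankSum (β * wh {a, y} a (valid_pair h2)) < rankSum β := by
  obtain ⟨k1, k2, k3⟩ := rank_inv_mul hg (by rwa [FreeGroup.norm_inv_eq]) hc hlt
  have e0 : (β (letter a))⁻¹ * (β (letter y))⁻¹ = (β (letter y) * β (letter a))⁻¹ := by group
  rw [e0] at k1 k2 k3
  rw [inv_inv, inv_inv] at k3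
  rw [FreeGroup.norm_inv_eq, FreeGroup.norm_inv_eq] at k1
  constructor
  · obtain ⟨c, e1, e2⟩ := lenSum_mul_wh_pair β h1 h2
    omega
  · obtain ⟨c, e1, e2⟩ := exists_sum_eq (fun z => rank (β (letter z)))
      (fun z => rank ((β * wh {a, y} a (valid_pair h2)) (letter z))) y
      fun z hz hz' => by rw [mul_wh_pair_of_ne β h2 hz hz']
    simp only [letter_bar, map_inv] at e1 e2
    rw [mul_wh_pair_self β h1 h2] at e2
    rw [rankSum, rankSum]
    omega

/-- Nielsen's condition on the images of the letters: in a product of three of them, no two adjacent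
ones being inverse, a part of the middle factor survives cancellation. -/
def IsNielsenReduced (β : MulAut (FreeGroup α)) : Prop :=
  (∀ a y, y ≠ bar a → 2 * common (β (letter y))⁻¹ (β (letter a)) ≤ (β (letter a)).norm) ∧
  ∀ y a z, y ≠ bar a → z ≠ bar a →
    common (β (letter y))⁻¹ (β (letter a)) + common (β (letter a))⁻¹ (β (letter z)) <
      (β (letter a)).norm

/-- Under a Nielsen reduced automorphism, the image of the first letter of a reduced word cancels against
the image of the rest at most as far as against the image of the next letter, and each further letter
contributes at least one to the length. -/
theorem IsNielsenReduced.key {β : MulAut (FreeGroup α)} (hβ : IsNielsenReduced β)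
    (l : List (α × Bool)) : ∀ z, FreeGroup.IsReduced (z :: l) →
      ((∀ y ∈ l.head?, common (β (letter z))⁻¹ (β (FreeGroup.mk l)) ≤
          common (β (letter z))⁻¹ (β (letter y))) ∧
        (l = [] → common (β (letter z))⁻¹ (β (FreeGroup.mk l)) = 0)) ∧
      (β (letter z)).norm + l.length ≤
        (β (FreeGroup.mk (z :: l))).norm + common (β (letter z))⁻¹ (β (FreeGroup.mk l)) := by
  induction l with
  | nil =>
    intro z _
    have : common (β (letter z))⁻¹ (β (FreeGroup.mk [])) = 0 := by
      rw [← FreeGroup.one_eq_mk, map_one, common_comm]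
      simp [common, lcp]
    refine ⟨⟨by simp, fun _ => this⟩, ?_⟩
    rw [this]
    simp [letter]
  | cons y l ih =>
    intro z hz
    rw [isReduced_cons] at hz
    obtain ⟨hyz, hyl⟩ := hz
    have hyz : y ≠ bar z := by simpa using hyz
    obtain ⟨⟨i1, i2⟩, i3⟩ := ih y hyl
    set u' := β (FreeGroup.mk l) with hu'
    have hu : β (FreeGroup.mk (y :: l)) = β (letter y) * u' := by rw [mk_cons, map_mul]
    have hzu : β (FreeGroup.mk (z :: y :: l)) = (β (letter z))⁻¹⁻¹ * (β (letter y) * u') := by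
      rw [mk_cons, map_mul, hu, inv_inv]
    rw [hu] at i3
    rw [hu, hzu]
    have hzy : z ≠ bar y := fun h => hyz (by rw [h, bar_bar])
    -- less than the whole of the image of `y` is cancelled from the two sides
    have h1 : common (β (letter z))⁻¹ (β (letter y)) + common (β (letter y))⁻¹ u' <
        (β (letter y)).norm := by
      cases l with
      | nil =>
        rw [i2 rfl]
        have := hβ.1 y z hzy
        have := (FreeGroup.norm_eq_zero (x := β (letter y))).not.2 (map_letter_ne_one β y)
        omega
      | cons w l =>
        have := i1 w rfl
        have hwy : w ≠ bar y := by simpa using (isReduced_cons.1 hyl).1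
        have := hβ.2 z y w hzy hwy
        omega
    have h2 := norm_inv_mul (β (letter y)) (β (letter y) * u')
    have h3 := norm_inv_mul (β (letter y))⁻¹ u'
    rw [inv_inv, FreeGroup.norm_inv_eq] at h3
    rw [inv_mul_cancel_left] at h2
    have h4 := norm_inv_mul (β (letter z))⁻¹ (β (letter y) * u')
    rw [FreeGroup.norm_inv_eq] at h4
    have h5 := min_common_le (β (letter z))⁻¹ (β (letter y) * u') (β (letter y))
    rw [common_comm (β (letter y) * u') (β (letter y))] at h5
    refine ⟨⟨fun w hw => ?_, fun h => by simp at h⟩, ?_⟩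
    · simp only [List.head?_cons, Option.mem_def, Option.some.injEq] at hw
      subst hw
      omega
    · simp only [List.length_cons]
      omega

theorem IsNielsenReduced.norm_le {β : MulAut (FreeGroup α)} (hβ : IsNielsenReduced β)
    (w : FreeGroup α) : w.norm ≤ (β w).norm := by
  obtain ⟨l, hl, rfl⟩ : ∃ l, FreeGroup.IsReduced l ∧ FreeGroup.mk l = w :=
    ⟨w.toWord, FreeGroup.isReduced_toWord, FreeGroup.mk_toWord⟩
  rw [norm_mk_of_isReduced hl]
  cases l with
  | nil => simp
  | cons z l =>
    obtain ⟨⟨i1, i2⟩, i3⟩ := hβ.key l z hl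
    have h0 := (FreeGroup.norm_eq_zero (x := β (letter z))).not.2 (map_letter_ne_one β z)
    simp only [List.length_cons]
    cases l with
    | nil => rw [i2 rfl] at i3; omega
    | cons y l =>
      have h1 := i1 y rfl
      have hyz : y ≠ bar z := by simpa using (isReduced_cons.1 hl).1
      have h2 := hβ.1 (bar z) (bar y) (by rwa [Ne, bar_inj])
      rw [letter_bar, letter_bar, map_inv, map_inv, inv_inv, common_comm, FreeGroup.norm_inv_eq] at h2
      omega

theorem eq_letter_of_norm {w : FreeGroup α} (h : w.norm = 1) : ∃ z, w = letter z := by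
  obtain ⟨z, hz⟩ := List.length_eq_one_iff.1 h
  exact ⟨z, by rw [letter, ← hz, FreeGroup.mk_toWord]⟩

theorem IsNielsenReduced.mem_letterPerms {β : MulAut (FreeGroup α)} (hβ : IsNielsenReduced β) :
    β ∈ letterPerms α := by
  rw [← inv_mem_iff]
  refine mem_letterPerms_of_forall fun y => eq_letter_of_norm ?_
  have h1 := hβ.norm_le (β⁻¹ (letter y))
  rw [← MulAut.mul_apply, mul_inv_cancel, MulAut.one_apply, norm_letter] at h1
  have h0 := (FreeGroup.norm_eq_zero (x := β⁻¹ (letter y))).not.2 (map_letter_ne_one _ y)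
  omega

/-- If neither a Nielsen transformation shortens the images of the letters, nor one keeps their lengths
and decreases their ranks, then they satisfy Nielsen's condition. -/
theorem isNielsenReduced_of_forall {β : MulAut (FreeGroup α)}
    (h : ∀ a y (_ : y ≠ a) (h2 : y ≠ bar a),
      lenSum β ≤ lenSum (β * wh {a, y} a (valid_pair h2)) ∧
      (lenSum (β * wh {a, y} a (valid_pair h2)) = lenSum β →
        rankSum β ≤ rankSum (β * wh {a, y} a (valid_pair h2)))) : IsNielsenReduced β := by
  have hsq : ∀ a, 2 * common (β (letter a))⁻¹ (β (letter a)) < (β (letter a)).norm :=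
    fun a => two_mul_common_inv_lt (map_letter_ne_one β a)
  have h1 : ∀ a y, y ≠ bar a → 2 * common (β (letter y))⁻¹ (β (letter a)) ≤ (β (letter a)).norm := by
    intro a y hy
    by_cases hya : y = a
    · subst hya; exact (hsq y).le
    · obtain ⟨c, e1, e2⟩ := lenSum_mul_wh_pair β hya hy
      have := (h a y hya hy).1
      have := norm_inv_mul (β (letter y))⁻¹ (β (letter a))
      rw [inv_inv, FreeGroup.norm_inv_eq] at this
      omega
  have h1' : ∀ a y, y ≠ bar a → 2 * common (β (letter y))⁻¹ (β (letter a)) ≤ (β (letter y)).norm := by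
    intro a y hy
    have := h1 (bar y) (bar a) (by simpa using hy.symm)
    rwa [letter_bar, letter_bar, map_inv, map_inv, inv_inv, common_comm, FreeGroup.norm_inv_eq] at this
  refine ⟨h1, fun y a z hy hz => ?_⟩
  by_contra! hlt
  have k1 := h1 a y hy
  have k1' := h1' a y hy
  have k2 := h1' z a (fun h => hz (by rw [h, bar_bar]))
  have k2' := h1 z a (fun h => hz (by rw [h, bar_bar]))
  have hsa := hsq a
  have hya : y ≠ a := by rintro rfl; omega
  have hza : z ≠ a := by rintro rfl; omega
  obtain ⟨m, hm⟩ : ∃ m, (β (letter a)).norm = 2 * m :=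
    ⟨common (β (letter y))⁻¹ (β (letter a)), by omega⟩
  -- the two halves of the image of `a` are the inverses of distinct words of the same length
  rcases lt_trichotomy (val ((β (letter a))⁻¹.toWord.take m)) (val ((β (letter a)).toWord.take m))
    with hv | hv | hv
  · obtain ⟨e1, e2⟩ := rankSum_mul_wh_pair β hya hy hm (by omega)
      (by rw [common_comm]; omega) hv
    have := (h a y hya hy).2 e1
    omega
  · have l1 : m ≤ (β (letter a)).toWord.length := by unfold FreeGroup.norm at hm; omega
    have l2 : m ≤ (β (letter a))⁻¹.toWord.length := by
      rw [FreeGroup.toWord_inv, FreeGroup.invRev_length]; exact l1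
    have := (le_lcp_iff l2 l1).2 (val_injOn (by simp [l1]) hv)
    unfold common at hsa
    omega
  · have hz1 : bar z ≠ bar a := by simpa using hza
    have hz2 : bar z ≠ bar (bar a) := by rwa [Ne, bar_inj]
    obtain ⟨e1, e2⟩ := rankSum_mul_wh_pair β hz1 hz2 (m := m)
      (by rw [norm_map_bar, hm]) (by rw [norm_map_bar]; omega)
      (by rw [letter_bar, letter_bar, map_inv, map_inv, inv_inv]; omega)
      (by rw [letter_bar, map_inv, inv_inv]; exact hv)
    have := (h (bar a) (bar z) hz1 hz2).2 e1
    omega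

/-- Nielsen's theorem: the Whitehead automorphisms and the permutations of the letters generate the
automorphism group. -/
theorem closure_gens : Subgroup.closure (gens α) = ⊤ := by
  rw [Subgroup.eq_top_iff']
  intro β
  induction hL : lenSum β using Nat.strong_induction_on generalizing β with
  | _ L ihL =>
  induction hR : rankSum β using Nat.strong_induction_on generalizing β with
  | _ R ihR =>
  by_cases hβ : IsNielsenReduced β
  · exact Subgroup.subset_closure (perm_mem hβ.mem_letterPerms)
  · have hex : ∃ a y, ∃ (_ : y ≠ a) (h2 : y ≠ bar a),
        lenSum (β * wh {a, y} a (valid_pair h2)) < lenSum β ∨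
        lenSum (β * wh {a, y} a (valid_pair h2)) = lenSum β ∧
          rankSum (β * wh {a, y} a (valid_pair h2)) < rankSum β := by
      by_contra! hcon
      exact hβ (isNielsenReduced_of_forall hcon)
    obtain ⟨a, y, -, h2, h⟩ := hex
    have hw : wh {a, y} a (valid_pair h2) ∈ Subgroup.closure (gens α) :=
      Subgroup.subset_closure (wh_mem _)
    rw [← Subgroup.mul_mem_cancel_right _ hw]
    rcases h with h | ⟨h, h'⟩
    · exact ihL _ (hL ▸ h) _ rfl
    · exact ihR _ (hR ▸ h') _ (h.trans hL) rfl

end Whitehead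

/-! ### `Aut(F_n)` is finitely presented -/

namespace Whitehead

variable {α : Type*} [Fintype α] [DecidableEq α]

theorem finite_setOf_norm_le (k : ℕ) : {w : FreeGroup α | w.norm ≤ k}.Finite :=
  Set.Finite.of_finite_image ((List.finite_length_le (α × Bool) k).subset (by
    rintro _ ⟨w, hw, rfl⟩
    exact hw)) FreeGroup.toWord_injective.injOn

theorem finite_setOf_len_le (k : ℕ) : {x : α → FreeGroup α | len x ≤ k}.Finite := by
  refine (Set.Finite.pi' fun _ => finite_setOf_norm_le (α := α) k).subset fun x hx i => ?_
  exact (Finset.single_le_sum (f := fun i => (x i).norm) (fun _ _ => Nat.zero_le _)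
    (Finset.mem_univ i)).trans hx

theorem len_of_le (g : MulAut (FreeGroup α)) :
    len (FreeGroup.of : α → FreeGroup α) ≤ len (g • (FreeGroup.of : α → FreeGroup α)) := by
  refine Finset.sum_le_sum fun i _ => ?_
  rw [FreeGroup.norm_of]
  exact Nat.one_le_iff_ne_zero.2 (FreeGroup.norm_eq_zero.not.2 (map_letter_ne_one g (i, true)))

instance : Subsingleton (MulAction.stabilizer (MulAut (FreeGroup α))
    (FreeGroup.of : α → FreeGroup α)) := by
  refine ⟨fun g h => Subtype.ext ?_⟩
  have h1 : g.1.toMonoidHom = h.1.toMonoidHom := by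
    ext i
    exact (congrFun g.2 i).trans (congrFun h.2 i).symm
  exact MulEquiv.ext fun w => DFunLike.congr_fun h1 w

theorem mulAut_isFinitelyPresented (α : Type*) [Fintype α] [DecidableEq α] :
    Group.IsFinitelyPresented (MulAut (FreeGroup α)) := by
  have : Group.IsFinitelyPresented (MulAction.stabilizer (MulAut (FreeGroup α))
    (FreeGroup.of : α → FreeGroup α)) := inferInstance
  exact .of_peak_reduction FreeGroup.of len (gens α) (ball α) gens_finite
    (gens_finite.image2 _ gens_finite) gens_subset_ball one_mem_gens inv_mem_gens closure_gens
    len_of_le ((finite_setOf_len_le (len FreeGroup.of)).subset fun x hx => hx.choose_spec.2.le)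
    fun g s hs t ht => isPeakReduced_gens (g • FreeGroup.of) s t hs ht

end Whitehead

/-! ### The automorphism group of a free-abelian times free group -/

/-- The free group on at least two generators has trivial center. -/
theorem FreeGroup.eq_one_of_forall_commute {α : Type*} [DecidableEq α] [Nontrivial α]
    {w : FreeGroup α} (h : ∀ u, Commute w u) : w = 1 := by
  rw [← FreeGroup.toWord_eq_nil_iff]
  cases hw : w.toWord with
  | nil => rfl
  | cons y l =>
    exfalso
    obtain ⟨i, hi⟩ := exists_ne y.1
    have hr : FreeGroup.IsReduced (y :: l) := hw ▸ FreeGroup.isReduced_toWord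
    -- `x w` is reduced as written, and equals `w x`, so that `w x` is reduced as well
    have h1 : (FreeGroup.of i * w).toWord = (i, true) :: y :: l := by
      have hr' : FreeGroup.IsReduced ((i, true) :: y :: l) := by
        rw [FreeGroup.isReduced_cons_cons]
        exact ⟨fun h => absurd h hi, hr⟩
      rw [← hr'.reduce_eq, ← FreeGroup.toWord_mk, ← hw]
      congr 1
      conv_lhs => rw [← FreeGroup.mk_toWord (x := w)]
      rfl
    have h2 := FreeGroup.toWord_mul_sublist w (FreeGroup.of i)
    rw [(h (FreeGroup.of i)).eq, h1, hw, FreeGroup.toWord_of] at h2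
    have h3 := h2.eq_of_length (by simp)
    simp only [List.cons_append, List.cons.injEq] at h3
    exact hi (congrArg Prod.fst h3.1)

namespace FreeAbelianTimesFree

open Multiplicative Matrix

variable {m n : ℕ}

/-- The endomorphism `(a, u) ↦ (a Q + u^ab P Q, u φ)` of `ℤ^m × F_n`. The factor `Q` after `P` makes
composition the multiplication of the semidirect product. -/
def endo (P : Matrix (Fin n) (Fin m) ℤ) (φ : RightAut (FreeGroup (Fin n))) (Q : GL (Fin m) ℤ) :
    FreeAbelianTimesFree m n →* FreeAbelianTimesFree m n where
  toFun g := (ofAdd (toAdd g.1 ᵥ* Q.val + toAdd (freeGroupAb n g.2) ᵥ* (P * Q.val)),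
    RightAut.app g.2 φ)
  map_one' := by
    ext <;> simp [RightAut.app]
  map_mul' g h := by
    refine Prod.ext ?_ (map_mul φ.unop g.2 h.2)
    apply toAdd.injective
    simp only [Prod.fst_mul, Prod.snd_mul, map_mul, toAdd_mul, toAdd_ofAdd, add_vecMul]
    abel

theorem endo_apply (P : Matrix (Fin n) (Fin m) ℤ) (φ : RightAut (FreeGroup (Fin n)))
    (Q : GL (Fin m) ℤ) (g : FreeAbelianTimesFree m n) :
    endo P φ Q g = (ofAdd (toAdd g.1 ᵥ* Q.val + toAdd (freeGroupAb n g.2) ᵥ* (P * Q.val)),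
      RightAut.app g.2 φ) := rfl

variable (m n) in
/-- The semidirect product acting on `ℤ^m × F_n`. -/
abbrev Triples : Type := Multiplicative (Matrix (Fin n) (Fin m) ℤ) ⋊[matrixAction m n]
  (RightAut (FreeGroup (Fin n)) × GL (Fin m) ℤ)

/-- The endomorphism belonging to an element of the semidirect product. -/
def toEnd (x : Triples m n) : FreeAbelianTimesFree m n →* FreeAbelianTimesFree m n :=
  endo (toAdd x.left) x.right.1 x.right.2

theorem toEnd_one : toEnd (1 : Triples m n) = MonoidHom.id _ := by
  ext g : 1
  simp [toEnd, endo_apply, RightAut.app]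

theorem toEnd_mul (x y : Triples m n) : toEnd (x * y) = (toEnd y).comp (toEnd x) := by
  refine MonoidHom.ext fun g => Prod.ext ?_ rfl
  apply toAdd.injective
  have h1 : toAdd (matrixAction m n x.right y.left) =
    abMatrix x.right.1 * toAdd y.left * (x.right.2⁻¹).val := rfl
  simp only [toEnd, endo_apply, MonoidHom.comp_apply, toAdd_ofAdd, freeGroupAb_app,
    SemidirectProduct.mul_left, SemidirectProduct.mul_right, Prod.fst_mul, Prod.snd_mul, toAdd_mul,
    h1, Units.val_mul, add_vecMul, vecMul_vecMul, Matrix.add_mul, vecMul_add]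
  have h2 : abMatrix x.right.1 * toAdd y.left * (x.right.2⁻¹).val *
      (x.right.2.val * y.right.2.val) = abMatrix x.right.1 * (toAdd y.left * y.right.2.val) := by
    rw [← Matrix.mul_assoc, Matrix.mul_assoc _ (x.right.2⁻¹).val, Units.inv_mul, Matrix.mul_one,
      Matrix.mul_assoc]
  rw [h2, Matrix.mul_assoc, add_assoc]

variable (m n) in
/-- The homomorphism from the semidirect product to `Aut(ℤ^m × F_n)`, which is an isomorphism for
`n ≥ 2`. -/
def toRightAut : Triples m n →* RightAut (FreeAbelianTimesFree m n) where
  toFun x := MulOpposite.op (MonoidHom.toMulEquiv (toEnd x) (toEnd x⁻¹)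
    (by rw [← toEnd_mul, mul_inv_cancel, toEnd_one])
    (by rw [← toEnd_mul, inv_mul_cancel, toEnd_one]))
  map_one' := by
    apply MulOpposite.unop_injective
    exact MulEquiv.ext fun g => DFunLike.congr_fun toEnd_one g
  map_mul' x y := by
    apply MulOpposite.unop_injective
    exact MulEquiv.ext fun g => DFunLike.congr_fun (toEnd_mul x y) g

theorem toRightAut_injective : Function.Injective (toRightAut m n) := by
  rintro ⟨P, φ, Q⟩ ⟨P', φ', Q'⟩ h
  have h1 : ∀ g, endo (toAdd P) φ Q g = endo (toAdd P') φ' Q' g := fun g =>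
    congrArg (RightAut.app g) h
  obtain rfl : φ = φ' := by
    apply MulOpposite.unop_injective
    exact MulEquiv.ext fun u => congrArg Prod.snd (h1 (1, u))
  obtain rfl : Q = Q' := by
    refine Units.ext (Matrix.ext_of_single_vecMul fun i => ?_)
    have := congrArg (fun g => toAdd g.1) (h1 (ofAdd (Pi.single i 1), 1))
    simpa [endo_apply] using this
  have hP : toAdd P * Q.val = toAdd P' * Q.val := by
    refine Matrix.ext_of_single_vecMul fun i => ?_
    have := congrArg (fun g => toAdd g.1) (h1 (1, FreeGroup.of i))
    simpa [endo_apply, freeGroupAb] using this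
  have hP' : P = P' := by
    apply toAdd.injective
    have := congrArg (· * (Q⁻¹).val) hP
    simpa only [Matrix.mul_assoc, Units.mul_inv, Matrix.mul_one] using this
  rw [hP']

/-- For `n ≥ 2` the factor `ℤ^m` is the center, and so it is preserved by all automorphisms. -/
theorem map_snd_eq_one (hn : 2 ≤ n) (θ : MulAut (FreeAbelianTimesFree m n))
    (a : Multiplicative (Fin m → ℤ)) : (θ (a, 1)).2 = 1 := by
  have : Nontrivial (Fin n) := Fin.nontrivial_iff_two_le.2 hn
  refine FreeGroup.eq_one_of_forall_commute fun u => ?_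
  have h1 : Commute ((a, 1) : FreeAbelianTimesFree m n) (θ.symm (1, u)) :=
    Prod.ext (mul_comm _ _) (by simp)
  have h2 := h1.map θ
  rw [MulEquiv.apply_symm_apply] at h2
  exact congrArg Prod.snd h2.eq

/-- The map which an automorphism induces on the factor `F_n`, as the quotient by `ℤ^m`. -/
def freePart (θ : MulAut (FreeAbelianTimesFree m n)) : FreeGroup (Fin n) →* FreeGroup (Fin n) :=
  (MonoidHom.snd _ _).comp (θ.toMonoidHom.comp (MonoidHom.inr _ _))

theorem exists_map_inl (hn : 2 ≤ n) (θ : MulAut (FreeAbelianTimesFree m n)) :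
    ∃ Q : Matrix (Fin m) (Fin m) ℤ, ∀ a, θ (a, 1) = (ofAdd (toAdd a ᵥ* Q), 1) := by
  let f : (Fin m → ℤ) →+ (Fin m → ℤ) :=
    MonoidHom.toAdditive ((MonoidHom.fst _ _).comp (θ.toMonoidHom.comp (MonoidHom.inl _ _)))
  refine ⟨LinearMap.toMatrixRight' f.toIntLinearMap, fun a => Prod.ext ?_ (map_snd_eq_one hn θ a)⟩
  have h1 : toAdd a ᵥ* LinearMap.toMatrixRight' f.toIntLinearMap = f (toAdd a) :=
    LinearMap.congr_fun (LinearMap.toMatrixRight'.symm_apply_apply f.toIntLinearMap) (toAdd a)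
  rw [h1]
  rfl

theorem exists_map_inr (θ : MulAut (FreeAbelianTimesFree m n)) :
    ∃ R : Matrix (Fin n) (Fin m) ℤ,
      ∀ u, θ (1, u) = (ofAdd (toAdd (freeGroupAb n u) ᵥ* R), freePart θ u) := by
  refine ⟨Matrix.of fun i => toAdd (θ (1, FreeGroup.of i)).1, fun u => Prod.ext ?_ rfl⟩
  have h : (MonoidHom.fst _ _).comp (θ.toMonoidHom.comp (MonoidHom.inr _ _)) =
      (AddMonoidHom.toMultiplicative (Matrix.vecMulLinear
        (Matrix.of fun i => toAdd (θ (1, FreeGroup.of i)).1)).toAddMonoidHom).comp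
        (freeGroupAb n) := by
    ext1 i
    apply toAdd.injective
    simp [freeGroupAb, Matrix.row]
    rfl
  exact DFunLike.congr_fun h u

/-- The first component of `θ (1, u)` is central, so it does not contribute to the second component of
its image under `θ⁻¹`. -/
theorem freePart_freePart (hn : 2 ≤ n) (θ : MulAut (FreeAbelianTimesFree m n))
    (u : FreeGroup (Fin n)) : freePart θ⁻¹ (freePart θ u) = u := by
  have h1 : ((1, freePart θ u) : FreeAbelianTimesFree m n) = ((θ (1, u)).1⁻¹, 1) * θ (1, u) :=
    Prod.ext (inv_mul_cancel _).symm (one_mul _).symm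
  show (θ⁻¹ (1, freePart θ u)).2 = u
  rw [h1, map_mul, MulAut.inv_apply_self, Prod.snd_mul, map_snd_eq_one hn, one_mul]

theorem toRightAut_surjective (hn : 2 ≤ n) : Function.Surjective (toRightAut m n) := by
  intro α
  set θ := α.unop with hθ
  obtain ⟨Q, hQ⟩ := exists_map_inl hn θ
  obtain ⟨Q', hQ'⟩ := exists_map_inl hn θ⁻¹
  obtain ⟨R, hR⟩ := exists_map_inr θ
  have h1 : Q * Q' = 1 := by
    refine Matrix.ext_iff_vecMul.2 fun v => ?_
    have := congrArg (fun g => toAdd g.1) (MulAut.inv_apply_self _ θ (ofAdd v, 1))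
    rw [hQ, hQ'] at this
    simpa using this
  let φ : RightAut (FreeGroup (Fin n)) := MulOpposite.op
    (MonoidHom.toMulEquiv (freePart θ) (freePart θ⁻¹) (MonoidHom.ext (freePart_freePart hn θ))
      (MonoidHom.ext fun u => by
        have := freePart_freePart hn θ⁻¹ u
        rwa [inv_inv] at this))
  refine ⟨⟨ofAdd (R * Q'), φ, ⟨Q, Q', h1, mul_eq_one_comm.1 h1⟩⟩, ?_⟩
  apply MulOpposite.unop_injective
  refine MulEquiv.ext fun g => ?_
  have h2 : g = (g.1, 1) * (1, g.2) := by simp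
  have h3 : R * Q' * Q = R := by
    rw [Matrix.mul_assoc, mul_eq_one_comm.1 h1, Matrix.mul_one]
  have h4 : θ g = (ofAdd (toAdd g.1 ᵥ* Q + toAdd (freeGroupAb n g.2) ᵥ* R), freePart θ g.2) := by
    conv_lhs => rw [h2, map_mul, hQ, hR]
    simp
  rw [← hθ, h4]
  refine Prod.ext ?_ rfl
  show ofAdd (toAdd g.1 ᵥ* Q + toAdd (freeGroupAb n g.2) ᵥ* (R * Q' * Q)) = _
  rw [h3]

end FreeAbelianTimesFree

theorem mainTheorem3 (m n : ℕ) (hm : 1 ≤ m) (hn : 2 ≤ n) :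
    Nonempty (RightAut (FreeAbelianTimesFree m n) ≃*
      Multiplicative (Matrix (Fin n) (Fin m) ℤ) ⋊[matrixAction m n]
        (RightAut (FreeGroup (Fin n)) × GL (Fin m) ℤ)) ∧
    Group.IsFinitelyPresented (RightAut (FreeAbelianTimesFree m n)) := by
  let e := MulEquiv.ofBijective (FreeAbelianTimesFree.toRightAut m n)
    ⟨FreeAbelianTimesFree.toRightAut_injective, FreeAbelianTimesFree.toRightAut_surjective hn⟩
  refine ⟨⟨e.symm⟩, ?_⟩
  have h1 := Whitehead.mulAut_isFinitelyPresented (Fin n)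
  have h2 : Group.IsFinitelyPresented (RightAut (FreeGroup (Fin n))) :=
    Group.IsFinitelyPresented.equiv (MulEquiv.inv' (MulAut (FreeGroup (Fin n))))
  have h3 := IntVector.gl_isFinitelyPresented m
  have h4 := Group.IsFinitelyPresented.matrix_int n m
  have h5 := Group.IsFinitelyPresented.semidirectProduct (matrixAction m n)
  exact Group.IsFinitelyPresented.equiv e
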